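/- Let $\mathcal A=\{1,2,3\}$. The Brun substitutions are $\sigma^{\mathsf{Br}}_1: 1\mapsto 1,\,2\mapsto 2,\,3\mapsto 32$; $\ \sigma^{\mathsf{Br}}_2: 1\mapsto 1,\,2\mapsto 3,\,3\mapsto 23$; $\ \sigma^{\mathsf{Br}}_3: 1\mapsto 2,\,2\mapsto 3,\,3\mapsto 13$. For integers $a,b\ge 0$ the Jacobi-Perron substitution is $\sigma^{\mathsf{JP}}_{a,b}: 1\mapsto 3,\ 2\mapsto 13^a,\ 3\mapsto 23^b$. An admissible finite product is either a composition $\sigma=\sigma^{\mathsf{Br}}_{i_1}\cdots\sigma^{\mathsf{Br}}_{i_n}$ with $n\ge1$, $i_k\in\{1,2,3\}$ and $i_k=3$ for at least one $k$; or a composition $\sigma=\sigma^{\mathsf{JP}}_{a_1,b_1}\cdots\sigma^{\mathsf{JP}}_{a_n,b_n}$ with $n\ge 1$, such that $0\le a_k\le b_k$ and $b_k\ne0$ for $1\le k\le n$, and $a_k=b_k$ implies $a_{k+1}\ne 0$ for $1\le k<n$. For a word $w$ let $\mathbf P(w)\in\mathbb N^3$ be the vector of numbers of occurrences of the letters in $w$,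 and let $\mathbf M_\sigma$ be the matrix with columns $\mathbf P(\sigma(1)),\mathbf P(\sigma(2)),\mathbf P(\sigma(3))$. The substitution $\sigma$ is unimodular if $\det\mathbf M_\sigma=\pm1$, and irreducible Pisot if the characteristic polynomial of $\mathbf M_\sigma$ is the minimal polynomial of a Pisot number, that is, of a real algebraic integer $\beta>1$ all of whose other conjugates are smaller than $1$ in modulus. For $\mathbf x\in\mathbb Z^3$ and $i\in\mathcal A$ let $[\mathbf x,i]^\star=\{\mathbf x+\sum_{k\ne i}\lambda_k\mathbf e_k:\lambda_k\in[0,1]\}\subset\mathbb R^3$. For unimodular $\sigma$ let $$\mathbf E_1^\star(\sigma)([\mathbf x,i]^\star)=\bigcup_{(p,j,s)\in\mathcal A^\star\times\mathcal A\times\mathcal A^\star\,:\,\sigma(j)=pis}[\mathbf M_\sigma^{-1}(\mathbf x+\mathbf P(s)),j]^\star ,$$ extended to unions of such faces by $\mathbf E_1^\star(\sigma)(P\cup Q)=\mathbf E_1^\star(\sigma)(P)\cup\mathbf E_1^\star(\sigma)(Q)$, and let $U=[\mathbf 0,1]^\star\cup[\mathbf 0,2]^\star\cup[\mathbf 0,3]^\star$.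 If $\sigma$ is unimodular and irreducible Pisot, let $\pi_{\mathrm c}$ be the projection of $\mathbb R^3$ onto the contracting plane of $\mathbf M_\sigma$ along its expanding eigenline. The Rauzy fractal $\mathcal T_\sigma$ is the limit, in the Hausdorff distance between non-empty compact sets, of $\mathbf M_\sigma^n\,\pi_{\mathrm c}\,\mathbf E_1^\star(\sigma)^n(U)$ as $n\to\infty$, and its subtile $\mathcal T_\sigma(i)$, $i\in\mathcal A$, is the Hausdorff limit of $\mathbf M_\sigma^n\,\pi_{\mathrm c}\,\mathbf E_1^\star(\sigma)^n([\mathbf 0,i]^\star)$. **Corollary 4.6.** Let $\sigma$ be an admissible finite product of Brun or Jacobi-Perron substitutions. Then $\sigma$ is unimodular and irreducible Pisot, so that $\pi_{\mathrm c}$ is defined; the Hausdorff limits defining the Rauzy fractal $\mathcal T_\sigma$ and its subtiles $\mathcal T_\sigma(1),\mathcal T_\sigma(2),\mathcal T_\sigma(3)$ exist; and these four sets are connected. -/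

import Mathlib

open Filter Topology

namespace RauzyFractal

/-! ### Substitutions on three letters

The letters `1, 2, 3` of the mathematical text are `0, 1, 2 : Fin 3`, and the basis vectors
`e₁, e₂, e₃` are indexed in the same way. -/

/-- Endomorphisms of the free monoid on three letters; the product `σ * τ` is the composition
`σ ∘ τ`. A substitution is such a map for which the image of every letter is non-empty; this holds
for all those considered below (and for every unimodular one). -/
abbrev Substitution : Type := Monoid.End (FreeMonoid (Fin 3))

/-- The substitution `1 ↦ u, 2 ↦ v, 3 ↦ w`. -/
def ofWords (u v w : List (Fin 3)) : Substitution :=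
  FreeMonoid.lift (fun a : Fin 3 => FreeMonoid.ofList ((![u, v, w] : Fin 3 → List (Fin 3)) a))

/-- The Brun substitutions
`1 ↦ 1, 2 ↦ 2, 3 ↦ 32`, then `1 ↦ 1, 2 ↦ 3, 3 ↦ 23`, then `1 ↦ 2, 2 ↦ 3, 3 ↦ 13`. -/
def brun : Fin 3 → Substitution :=
  ![ofWords [0] [1] [2, 1], ofWords [0] [2] [1, 2], ofWords [1] [2] [0, 2]]

/-- The Jacobi-Perron substitution `1 ↦ 3, 2 ↦ 1 3^a, 3 ↦ 2 3^b`. -/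
def jacobiPerron (a b : ℕ) : Substitution :=
  ofWords [2] (0 :: List.replicate a 2) (1 :: List.replicate b 2)

/-- A finite sequence of indices of Brun substitutions is admissible if the third substitution
occurs in it at least once. -/
def BrunAdmissible (w : List (Fin 3)) : Prop := 2 ∈ w

/-- A non-empty finite sequence `(a₁, b₁), …, (aₙ, bₙ)` is Jacobi-Perron-admissible if
`0 ≤ a_k ≤ b_k` and `b_k ≠ 0` for all `k`, and `a_k = b_k` implies `a_{k+1} ≠ 0` for `k < n`. -/
def JacobiPerronAdmissible (w : List (ℕ × ℕ)) : Prop :=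
  w ≠ [] ∧ (∀ p ∈ w, p.1 ≤ p.2 ∧ p.2 ≠ 0) ∧ w.IsChain (fun p q => p.1 = p.2 → q.1 ≠ 0)

/-- Admissible finite products of Brun substitutions, or of Jacobi-Perron substitutions. -/
def IsAdmissibleProduct (σ : Substitution) : Prop :=
  (∃ w : List (Fin 3), BrunAdmissible w ∧ σ = (w.map brun).prod) ∨
  (∃ w : List (ℕ × ℕ), JacobiPerronAdmissible w ∧
    σ = (w.map (fun p => jacobiPerron p.1 p.2)).prod)

/-! ### Incidence matrices, the Pisot condition -/

/-- The abelianization map: number of occurrences of each letter in a word. -/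
def abelianization (w : FreeMonoid (Fin 3)) : Fin 3 → ℤ :=
  fun i => ((FreeMonoid.toList w).count i : ℤ)

/-- The incidence matrix: its `j`-th column is the abelianization of the image of `j`. -/
def incidenceMatrix (σ : Substitution) : Matrix (Fin 3) (Fin 3) ℤ :=
  Matrix.of fun i j => abelianization (σ (FreeMonoid.of j)) i

def IsUnimodular (σ : Substitution) : Prop :=
  (incidenceMatrix σ).det = 1 ∨ (incidenceMatrix σ).det = -1

/-- A Pisot number: a real algebraic integer larger than `1` all of whose other conjugates are
smaller than `1` in modulus. -/
def IsPisotNumber (β : ℝ) : Prop :=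
  IsIntegral ℤ β ∧ 1 < β ∧
    ∀ z : ℂ, Polynomial.aeval z (minpoly ℚ β) = 0 → z ≠ (β : ℂ) → ‖z‖ < 1

/-- The characteristic polynomial of the incidence matrix is the minimal polynomial of a Pisot
number. -/
def IsIrreduciblePisot (σ : Substitution) : Prop :=
  ∃ β : ℝ, IsPisotNumber β ∧
    ((incidenceMatrix σ).charpoly).map (Int.castRingHom ℚ) = minpoly ℚ β

/-! ### Faces and dual substitutions -/

/-- The (pointed) face `[x, i]^*`, recorded by its vector `x` and its type `i`. -/
abbrev Face : Type := (Fin 3 → ℤ) × Fin 3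

/-- The face `[x, i]^*` as a subset of `ℝ³`: the unit square at `x` spanned by the two basis
vectors other than `e_i`. -/
def Face.toSet (f : Face) : Set (Fin 3 → ℝ) :=
  {y | y f.2 = f.1 f.2 ∧ ∀ k, k ≠ f.2 → (f.1 k : ℝ) ≤ y k ∧ y k ≤ f.1 k + 1}

/-- The dual substitution `E₁^*(σ)` of a unimodular `σ`, on collections of faces:
`[x, i]^*` is replaced by the faces `[M⁻¹ (x + P(s)), j]^*` for all `p, j, s` such that
`σ(j) = p i s`. -/
def dualSubstitution (σ : Substitution) (Q : Set Face) : Set Face :=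
  {g | ∃ f ∈ Q, ∃ p s : FreeMonoid (Fin 3), σ (FreeMonoid.of g.2) = p * FreeMonoid.of f.2 * s ∧
    g.1 = (incidenceMatrix σ)⁻¹.mulVec (f.1 + abelianization s)}

/-- The pattern `U`, made of the three faces with vector `0`. -/
def unitPattern : Set Face := {f | f.1 = 0}

/-! ### Rauzy fractals -/

/-- The incidence matrix as a linear endomorphism of `ℝ³`. -/
noncomputable def incidenceMap (σ : Substitution) : (Fin 3 → ℝ) →ₗ[ℝ] (Fin 3 → ℝ) :=
  Matrix.toLin' ((incidenceMatrix σ).map (Int.cast : ℤ → ℝ))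

/-- The contracting space of a linear endomorphism: the vectors whose iterates tend to `0`.
For the incidence matrix of a unimodular irreducible Pisot substitution this is the sum of the
eigenspaces of the eigenvalues of modulus `< 1`, a plane. -/
def contractingSpace (A : (Fin 3 → ℝ) →ₗ[ℝ] (Fin 3 → ℝ)) : Submodule ℝ (Fin 3 → ℝ) where
  carrier := {x | Tendsto (fun n : ℕ => (A ^ n) x) atTop (𝓝 0)}
  zero_mem' := by simp
  add_mem' := by
    intro x y hx hy
    simpa using Tendsto.add hx hy
  smul_mem' := by
    intro c x hx
    simpa using Tendsto.const_smul hx c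

/-- The expanding space: the span of the eigenvectors with real eigenvalue `> 1`. For the incidence
matrix of an irreducible Pisot substitution this is the line of the dominant eigenvalue. -/
def expandingSpace (A : (Fin 3 → ℝ) →ₗ[ℝ] (Fin 3 → ℝ)) : Submodule ℝ (Fin 3 → ℝ) :=
  ⨆ β : {β : ℝ // 1 < β}, Module.End.eigenspace A β.1

/-- `π` is the projection onto the contracting space along the expanding space.
There is at most one such `π`. -/
def IsContractingProjection (A π : (Fin 3 → ℝ) →ₗ[ℝ] (Fin 3 → ℝ)) : Prop :=
  LinearMap.IsProj (contractingSpace A) π ∧ LinearMap.ker π = expandingSpace A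

/-- The set `M_σ^n (π (E₁^*(σ)^n (Q)))`. -/
def approximant (σ : Substitution) (π : (Fin 3 → ℝ) →ₗ[ℝ] (Fin 3 → ℝ)) (Q : Set Face) (n : ℕ) :
    Set (Fin 3 → ℝ) :=
  (incidenceMap σ ^ n) '' (π '' (⋃ f ∈ (dualSubstitution σ)^[n] Q, Face.toSet f))

/-- `T` is the Hausdorff limit of the sequence `D`: a non-empty compact set, at Hausdorff distance
tending to `0` from `D n`. Such a `T` is unique. The limit does not depend on the norm of `ℝ³`. -/
def IsHausdorffLimit (D : ℕ → Set (Fin 3 → ℝ)) (T : Set (Fin 3 → ℝ)) : Prop :=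
  IsCompact T ∧ T.Nonempty ∧ Tendsto (fun n => Metric.hausdorffEDist (D n) T) atTop (𝓝 0)

/-- `T` is the Rauzy fractal of `σ`, where `π` is the projection onto the contracting plane. -/
def IsRauzyFractal (σ : Substitution) (π : (Fin 3 → ℝ) →ₗ[ℝ] (Fin 3 → ℝ))
    (T : Set (Fin 3 → ℝ)) : Prop :=
  IsHausdorffLimit (approximant σ π unitPattern) T

/-- `T` is the subtile of index `i` of the Rauzy fractal of `σ`. -/
def IsRauzySubtile (σ : Substitution) (π : (Fin 3 → ℝ) →ₗ[ℝ] (Fin 3 → ℝ)) (i : Fin 3)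
    (T : Set (Fin 3 → ℝ)) : Prop :=
  IsHausdorffLimit (approximant σ π {((0, i) : Face)}) T

end RauzyFractal

open RauzyFractal

namespace RauzyFractal

/-! ### Incidence matrices of products -/

/-! Write `M` for the incidence matrix. The Pisot property rests on a positive left eigenvector `v`
of eigenvalue `β > 1` (`exists_pos_eigenvector`) and on the absence of real eigenvalues of modulus
at least `1` on the plane orthogonal to `v`. Together these make the characteristic polynomial
negative at `1` and `-1` (`charpoly_eval_neg_of_no_eigenvector`). Since `det M = ±1`, the quadratic
cofactor `X² + pX + q` of `X - β` has `|q| = 1/β < 1`; the two signs say `|p| < 1 + q`, and these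
inequalities put both of its roots in the open unit disc. An integer root of the cubic would be
`±1`, so the cubic is irreducible.

For Brun products the plane is contracted in the supremum norm. The left iterates of `v` stay
strictly ordered, so orthogonality makes the only new coordinate `w 1 + w 2` strictly smaller than
the norm bound; after three occurrences of the third matrix every coordinate is. For Jacobi-Perron
products the norm may grow for a moment: the coordinates follow a third-order recurrence that can
produce a spike, but a spike forces smaller terms right after it. The quantity `orbitSize` ignores
spikes and has no positive minimum along an orbit, which rules out eigenvalues of modulus at least
`1` (`IsJacobiPerronOrbit.eq_zero`).

For the limits: `M` brings every face of the dual image of a face back to within bounded distance of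
that face, while `M^n π` decays like `ρ^n` with `ρ < 1`. Consecutive approximants are thus at
Hausdorff distance `O(ρ^n)`, and closed sets form a complete space.

For connectedness: there is a list of small patterns (`IsPattern`), finite up to translation, each
with a point common to all its faces. The dual of each generator maps single faces and patterns to
sets of faces chained together by patterns, so this form of connectedness passes to every
approximant, and topological connectedness passes to the Hausdorff limit. -/

theorem abelianization_mul (u v : FreeMonoid (Fin 3)) :
    abelianization (u * v) = abelianization u + abelianization v := by
  funext i
  simp [abelianization, FreeMonoid.toList_mul]

@[simp] theorem abelianization_one : abelianization 1 = 0 := by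
  funext i
  simp [abelianization]

theorem abelianization_of (j : Fin 3) : abelianization (FreeMonoid.of j) = Pi.single j 1 := by
  funext i
  by_cases h : i = j
  · subst h; simp [abelianization]
  · simp [abelianization, h, Ne.symm h]

theorem abelianization_apply (σ : Substitution) (w : FreeMonoid (Fin 3)) :
    abelianization (σ w) = (incidenceMatrix σ).mulVec (abelianization w) := by
  induction w using FreeMonoid.inductionOn' with
  | one => simp
  | of_mul j w ih =>
    rw [map_mul, abelianization_mul, abelianization_mul, ih, Matrix.mulVec_add]
    congr 1
    rw [abelianization_of, Matrix.mulVec_single_one]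
    rfl

theorem incidenceMatrix_mul (σ τ : Substitution) :
    incidenceMatrix (σ * τ) = incidenceMatrix σ * incidenceMatrix τ := by
  ext i j
  change abelianization (σ (τ (FreeMonoid.of j))) i = _
  rw [abelianization_apply]
  rfl

theorem incidenceMatrix_one : incidenceMatrix 1 = 1 := by
  ext i j
  change abelianization (FreeMonoid.of j) i = _
  rw [abelianization_of, Matrix.one_apply, Pi.single_apply]

theorem isUnimodular_iff_isUnit {σ : Substitution} :
    IsUnimodular σ ↔ IsUnit (incidenceMatrix σ).det := by
  rw [Int.isUnit_iff]; rfl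

theorem IsUnimodular.mul {σ τ : Substitution} (hσ : IsUnimodular σ) (hτ : IsUnimodular τ) :
    IsUnimodular (σ * τ) := by
  rw [isUnimodular_iff_isUnit] at *
  rw [incidenceMatrix_mul, Matrix.det_mul]
  exact hσ.mul hτ

theorem isUnimodular_one : IsUnimodular 1 := by
  left
  simp [incidenceMatrix_one]

theorem isUnimodular_prod {l : List Substitution} (h : ∀ σ ∈ l, IsUnimodular σ) :
    IsUnimodular l.prod := by
  induction l with
  | nil => exact isUnimodular_one
  | cons σ l ih =>
    rw [List.prod_cons]
    exact (h σ (by simp)).mul (ih fun τ hτ => h τ (by simp [hτ]))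

theorem ofWords_of (u v w : List (Fin 3)) (j : Fin 3) :
    ofWords u v w (FreeMonoid.of j) = FreeMonoid.ofList ((![u, v, w] : Fin 3 → List (Fin 3)) j) :=
  FreeMonoid.lift_eval_of _ _

theorem incidenceMatrix_ofWords (u v w : List (Fin 3)) :
    incidenceMatrix (ofWords u v w) =
      !![(u.count 0 : ℤ), v.count 0, w.count 0; u.count 1, v.count 1, w.count 1;
        u.count 2, v.count 2, w.count 2] := by
  ext i j
  fin_cases i <;> fin_cases j <;> simp [incidenceMatrix, abelianization, ofWords_of]

theorem incidenceMatrix_brun_zero :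
    incidenceMatrix (brun 0) = !![1, 0, 0; 0, 1, 1; 0, 0, 1] := by
  change incidenceMatrix (ofWords _ _ _) = _
  rw [incidenceMatrix_ofWords]
  rfl

theorem incidenceMatrix_brun_one :
    incidenceMatrix (brun 1) = !![1, 0, 0; 0, 0, 1; 0, 1, 1] := by
  change incidenceMatrix (ofWords _ _ _) = _
  rw [incidenceMatrix_ofWords]
  rfl

theorem incidenceMatrix_brun_two :
    incidenceMatrix (brun 2) = !![0, 0, 1; 1, 0, 0; 0, 1, 1] := by
  change incidenceMatrix (ofWords _ _ _) = _
  rw [incidenceMatrix_ofWords]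
  rfl

theorem incidenceMatrix_jacobiPerron (a b : ℕ) :
    incidenceMatrix (jacobiPerron a b) = !![0, 1, 0; 0, 0, 1; 1, (a : ℤ), (b : ℤ)] := by
  rw [jacobiPerron, incidenceMatrix_ofWords]
  ext i j
  fin_cases i <;> fin_cases j <;> simp [List.count_replicate]

theorem isUnimodular_brun (i : Fin 3) : IsUnimodular (brun i) := by
  unfold IsUnimodular
  fin_cases i
  · left; simp [incidenceMatrix_brun_zero, Matrix.det_fin_three]
  · right; simp [incidenceMatrix_brun_one, Matrix.det_fin_three]
  · left; simp [incidenceMatrix_brun_two, Matrix.det_fin_three]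

theorem isUnimodular_jacobiPerron (a b : ℕ) : IsUnimodular (jacobiPerron a b) := by
  left
  simp [incidenceMatrix_jacobiPerron, Matrix.det_fin_three]

theorem IsAdmissibleProduct.isUnimodular {σ : Substitution} (hσ : IsAdmissibleProduct σ) :
    IsUnimodular σ := by
  rcases hσ with ⟨w, -, rfl⟩ | ⟨w, -, rfl⟩
  · refine isUnimodular_prod fun τ hτ => ?_
    obtain ⟨i, -, rfl⟩ := List.mem_map.1 hτ
    exact isUnimodular_brun i
  · refine isUnimodular_prod fun τ hτ => ?_
    obtain ⟨p, -, rfl⟩ := List.mem_map.1 hτ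
    exact isUnimodular_jacobiPerron _ _

/-- The real incidence matrix. -/
noncomputable def realMatrix (σ : Substitution) : Matrix (Fin 3) (Fin 3) ℝ :=
  (incidenceMatrix σ).map (Int.cast : ℤ → ℝ)

theorem realMatrix_mul (σ τ : Substitution) :
    realMatrix (σ * τ) = realMatrix σ * realMatrix τ := by
  unfold realMatrix
  rw [incidenceMatrix_mul]
  exact Matrix.map_mul (f := Int.castRingHom ℝ)

theorem realMatrix_one : realMatrix 1 = 1 := by
  unfold realMatrix
  rw [incidenceMatrix_one]
  exact Matrix.map_one _ Int.cast_zero Int.cast_one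

theorem realMatrix_brun_zero : realMatrix (brun 0) = !![1, 0, 0; 0, 1, 1; 0, 0, 1] := by
  rw [realMatrix, incidenceMatrix_brun_zero]
  ext i j; fin_cases i <;> fin_cases j <;> simp

theorem realMatrix_brun_one : realMatrix (brun 1) = !![1, 0, 0; 0, 0, 1; 0, 1, 1] := by
  rw [realMatrix, incidenceMatrix_brun_one]
  ext i j; fin_cases i <;> fin_cases j <;> simp

theorem realMatrix_brun_two : realMatrix (brun 2) = !![0, 0, 1; 1, 0, 0; 0, 1, 1] := by
  rw [realMatrix, incidenceMatrix_brun_two]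
  ext i j; fin_cases i <;> fin_cases j <;> simp

theorem realMatrix_jacobiPerron (a b : ℕ) :
    realMatrix (jacobiPerron a b) = !![0, 1, 0; 0, 0, 1; 1, (a : ℝ), (b : ℝ)] := by
  rw [realMatrix, incidenceMatrix_jacobiPerron]
  ext i j; fin_cases i <;> fin_cases j <;> simp

/-! ### Perron eigenvectors -/

/-- A non-negative real matrix some power of which maps every non-zero non-negative vector to a
positive one has a positive eigenvector. -/
theorem exists_pos_eigenvector {n : Type*} [Fintype n] [DecidableEq n] [Nonempty n]
    (N : Matrix n n ℝ) (hN : ∀ i j, 0 ≤ N i j) (k : ℕ)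
    (hk : ∀ z : n → ℝ, 0 ≤ z → z ≠ 0 → ∀ i, 0 < ((N ^ k).mulVec z) i) :
    ∃ (β : ℝ) (v : n → ℝ), (∀ i, 0 < v i) ∧ N.mulVec v = β • v := by
  classical
  set C : ℝ := ∑ i, ∑ j, N i j with hC
  have bound : ∀ (r : ℝ) (v : n → ℝ), v ∈ stdSimplex ℝ n → r • v ≤ N.mulVec v → r ≤ C := by
    intro r v hv h
    have h1 : ∑ i, r * v i ≤ ∑ i, ∑ j, N i j := by
      refine Finset.sum_le_sum fun i _ => (h i).trans ?_
      refine Finset.sum_le_sum fun j _ => ?_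
      exact mul_le_of_le_one_right (hN i j) (mem_Icc_of_mem_stdSimplex hv j).2
    rwa [← Finset.mul_sum, hv.2, mul_one] at h1
  have mulVec_nonneg : ∀ v : n → ℝ, 0 ≤ v → 0 ≤ N.mulVec v := fun v hv i =>
    Finset.sum_nonneg fun j _ => mul_nonneg (hN i j) (hv j)
  -- Collatz-Wielandt: the eigenvalue is the largest `r` with `r • v ≤ N v` for some `v` in the
  -- simplex, a maximum over a compact set.
  set K : Set (ℝ × (n → ℝ)) :=
    (Set.Icc 0 C ×ˢ stdSimplex ℝ n) ∩ {p | p.1 • p.2 ≤ N.mulVec p.2} with hK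
  have hKc : IsCompact K := by
    refine (isCompact_Icc.prod (isCompact_stdSimplex ℝ n)).inter_right (isClosed_le ?_ ?_)
    · fun_prop
    · exact Continuous.matrix_mulVec continuous_const continuous_snd
  obtain ⟨i₀⟩ := ‹Nonempty n›
  have hKn : K.Nonempty := by
    refine ⟨(0, Pi.single i₀ 1), ⟨⟨⟨le_rfl, ?_⟩, single_mem_stdSimplex ℝ i₀⟩, ?_⟩⟩
    · exact Finset.sum_nonneg fun i _ => Finset.sum_nonneg fun j _ => hN i j
    · change (0 : ℝ) • (Pi.single i₀ 1 : n → ℝ) ≤ _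
      rw [zero_smul]
      exact mulVec_nonneg _ (single_mem_stdSimplex ℝ i₀).1
  obtain ⟨⟨r, v⟩, ⟨⟨⟨hr0, -⟩, hv⟩, hrv⟩, hmax⟩ := hKc.exists_isMaxOn hKn continuous_fst.continuousOn
  change r • v ≤ N.mulVec v at hrv
  have hv0 : v ≠ 0 := by
    rintro rfl
    simpa using hv.2
  have hpos : ∀ i, 0 < ((N ^ k).mulVec v) i := hk v hv.1 hv0
  -- A non-zero slack becomes strictly positive under `N ^ k`, which commutes with `N`; then `r`
  -- could be raised by the least ratio of the new slack to `v'`, against maximality.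
  have key : N.mulVec v - r • v = 0 := by
    by_contra hz
    have hz' := hk _ (sub_nonneg.2 hrv) hz
    set v' := (N ^ k).mulVec v with hv'
    have hcomm : (N ^ k).mulVec (N.mulVec v - r • v) = N.mulVec v' - r • v' := by
      rw [Matrix.mulVec_sub, Matrix.mulVec_smul, hv', Matrix.mulVec_mulVec, Matrix.mulVec_mulVec,
        ← pow_succ, ← pow_succ']
    rw [hcomm] at hz'
    set z' := N.mulVec v' - r • v' with hz'def
    have : Nonempty n := ⟨i₀⟩
    obtain ⟨i₁, hi₁⟩ := Finite.exists_min fun i => z' i / v' i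
    set ε := z' i₁ / v' i₁ with hε
    have hεpos : 0 < ε := div_pos (hz' i₁) (hpos i₁)
    set s := ∑ i, v' i with hs
    have hspos : 0 < s := Finset.sum_pos (fun i _ => hpos i) Finset.univ_nonempty
    have hmem : s⁻¹ • v' ∈ stdSimplex ℝ n := by
      refine ⟨fun i => mul_nonneg (inv_nonneg.2 hspos.le) (hpos i).le, ?_⟩
      simp only [Pi.smul_apply, smul_eq_mul]
      rw [← Finset.mul_sum, ← hs, inv_mul_cancel₀ hspos.ne']
    have hle : (r + ε) • (s⁻¹ • v') ≤ N.mulVec (s⁻¹ • v') := by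
      rw [Matrix.mulVec_smul, smul_comm]
      intro i
      refine mul_le_mul_of_nonneg_left ?_ (inv_nonneg.2 hspos.le)
      have h1 : ε * v' i ≤ z' i := by
        rw [← le_div_iff₀ (hpos i)]
        exact hi₁ i
      have h2 : z' i = (N.mulVec v') i - r * v' i := rfl
      change (r + ε) * v' i ≤ _
      linarith [add_mul r ε (v' i)]
    have h3 : r + ε ≤ r :=
      hmax (show (r + ε, s⁻¹ • v') ∈ K from ⟨⟨⟨by positivity, bound _ _ hmem hle⟩, hmem⟩, hle⟩)
    linarith
  have heig : N.mulVec v = r • v := sub_eq_zero.1 key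
  have hpow : ∀ m : ℕ, (N ^ m).mulVec v = r ^ m • v := by
    intro m
    induction m with
    | zero => simp
    | succ m ih => rw [pow_succ, ← Matrix.mulVec_mulVec, heig, Matrix.mulVec_smul, ih, smul_smul,
        pow_succ, mul_comm]
  refine ⟨r, v, fun i => ?_, heig⟩
  have h4 : 0 < r ^ k * v i := by
    have := hpos i
    rwa [hpow] at this
  exact (pos_of_mul_pos_right h4 (pow_nonneg hr0 k))

/-! ### A criterion for the signs of the characteristic polynomial at `1` and `-1` -/

theorem charpoly_eval_fin_three (A : Matrix (Fin 3) (Fin 3) ℝ) (x : ℝ) :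
    A.charpoly.eval x = (!![x - A 0 0, -A 0 1, -A 0 2; -A 1 0, x - A 1 1, -A 1 2;
      -A 2 0, -A 2 1, x - A 2 2] : Matrix (Fin 3) (Fin 3) ℝ).det := by
  rw [Matrix.eval_charpoly]
  congr 1
  ext i j
  fin_cases i <;> fin_cases j <;> simp

theorem exists_cubic_bound (t s d : ℝ) :
    ∃ X : ℝ, ∀ x : ℝ, X ≤ |x| → |t * x ^ 2 + s * x + d| < |x| ^ 3 := by
  refine ⟨1 + |t| + |s| + |d|, fun x hx => ?_⟩
  have ht := abs_nonneg t
  have hs := abs_nonneg s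
  have hd := abs_nonneg d
  have h1 : 1 ≤ |x| := by linarith
  have h2 : |t * x ^ 2 + s * x + d| ≤ |t| * |x| ^ 2 + |s| * |x| + |d| := by
    refine (abs_add_le _ _).trans (add_le_add ((abs_add_le _ _).trans ?_) le_rfl)
    rw [abs_mul, abs_mul, abs_pow]
  have h3 : |x| ≤ |x| ^ 2 := by nlinarith
  have h4 : 1 ≤ |x| ^ 2 := by nlinarith
  nlinarith [mul_le_mul_of_nonneg_left h3 hs, mul_le_mul_of_nonneg_left h4 hd,
    mul_le_mul_of_nonneg_right hx (sq_nonneg |x|)]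

/-- Dividing the characteristic polynomial by `x - β` leaves, up to the factor `v 0`, a determinant
that vanishes only at eigenvalues on the plane orthogonal to `v`. It has no zero with `|x| ≥ 1` and
is positive far out on both sides, hence positive at `1` and `-1`, where `x - β` is negative. -/
theorem charpoly_eval_neg_of_no_eigenvector (A : Matrix (Fin 3) (Fin 3) ℝ) (v : Fin 3 → ℝ)
    (β : ℝ) (hv : 0 < v 0) (hβ : 1 < β) (hAv : Matrix.vecMul v A = β • v)
    (h : ∀ (l : ℝ) (w : Fin 3 → ℝ), 1 ≤ |l| → A.mulVec w = l • w → v ⬝ᵥ w = 0 → w = 0) :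
    A.charpoly.eval 1 < 0 ∧ A.charpoly.eval (-1) < 0 := by
  -- This is `x - A` with first row replaced by `v`. The combination of the rows of `x - A` with
  -- coefficients `v` is `(x - β) • v`, which gives the factorization `hfac`.
  set S : ℝ → Matrix (Fin 3) (Fin 3) ℝ := fun x =>
    !![v 0, v 1, v 2; -A 1 0, x - A 1 1, -A 1 2; -A 2 0, -A 2 1, x - A 2 2] with hS
  have e0 : v 0 * A 0 0 + v 1 * A 1 0 + v 2 * A 2 0 = β * v 0 := by
    simpa [Matrix.vecMul, dotProduct, Fin.sum_univ_three] using congrFun hAv 0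
  have e1 : v 0 * A 0 1 + v 1 * A 1 1 + v 2 * A 2 1 = β * v 1 := by
    simpa [Matrix.vecMul, dotProduct, Fin.sum_univ_three] using congrFun hAv 1
  have e2 : v 0 * A 0 2 + v 1 * A 1 2 + v 2 * A 2 2 = β * v 2 := by
    simpa [Matrix.vecMul, dotProduct, Fin.sum_univ_three] using congrFun hAv 2
  have hfac : ∀ x, v 0 * A.charpoly.eval x = (x - β) * (S x).det := by
    intro x
    rw [charpoly_eval_fin_three]
    simp only [hS, Matrix.det_fin_three, Matrix.of_apply, Matrix.cons_val', Matrix.cons_val_zero,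
      Matrix.cons_val_one, Matrix.cons_val]
    linear_combination (-((x - A 1 1) * (x - A 2 2) - A 1 2 * A 2 1)) * e0
      - (A 1 0 * (x - A 2 2) + A 1 2 * A 2 0) * e1 - (A 1 0 * A 2 1 + (x - A 1 1) * A 2 0) * e2
  have hroot : ∀ x, 1 ≤ |x| → (S x).det ≠ 0 := by
    intro x hx h0
    obtain ⟨w, hw0, hw⟩ := Matrix.exists_mulVec_eq_zero_iff.2 h0
    refine hw0 (h x w hx ?_ ?_)
    · have r0 : v 0 * w 0 + v 1 * w 1 + v 2 * w 2 = 0 := by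
        simpa [hS, Matrix.mulVec, dotProduct, Fin.sum_univ_three] using congrFun hw 0
      have r1 : -A 1 0 * w 0 + (x - A 1 1) * w 1 + -A 1 2 * w 2 = 0 := by
        simpa [hS, Matrix.mulVec, dotProduct, Fin.sum_univ_three] using congrFun hw 1
      have r2 : -A 2 0 * w 0 + -A 2 1 * w 1 + (x - A 2 2) * w 2 = 0 := by
        simpa [hS, Matrix.mulVec, dotProduct, Fin.sum_univ_three] using congrFun hw 2
      -- The first row of the eigenvector equation, lost in `S`, is recovered from orthogonality to
      -- the left eigenvector and the other two rows.
      have r3 : v 0 * (A 0 0 * w 0 + A 0 1 * w 1 + A 0 2 * w 2 - x * w 0) = 0 := by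
        linear_combination w 0 * e0 + w 1 * e1 + w 2 * e2 + (β - x) * r0 + v 1 * r1 + v 2 * r2
      have r4 := (mul_eq_zero.1 r3).resolve_left hv.ne'
      funext i
      fin_cases i
      · simp [Matrix.mulVec, dotProduct, Fin.sum_univ_three]; linarith
      · simp [Matrix.mulVec, dotProduct, Fin.sum_univ_three]; linarith
      · simp [Matrix.mulVec, dotProduct, Fin.sum_univ_three]; linarith
    · simpa [hS, Matrix.mulVec, dotProduct, Fin.sum_univ_three] using congrFun hw 0
  have hcont : Continuous fun x => (S x).det := by
    simp only [hS, Matrix.det_fin_three, Matrix.of_apply, Matrix.cons_val', Matrix.cons_val_zero,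
      Matrix.cons_val_one, Matrix.cons_val]
    fun_prop
  obtain ⟨t, s, d, hcub⟩ : ∃ t s d : ℝ, ∀ x, A.charpoly.eval x = x ^ 3 + (t * x ^ 2 + s * x + d) := by
    refine ⟨-(A 0 0 + A 1 1 + A 2 2), A 0 0 * A 1 1 - A 0 1 * A 1 0 + A 0 0 * A 2 2 - A 0 2 * A 2 0
      + A 1 1 * A 2 2 - A 1 2 * A 2 1, -A.det, fun x => ?_⟩
    rw [charpoly_eval_fin_three, Matrix.det_fin_three, Matrix.det_fin_three]
    simp only [Matrix.of_apply, Matrix.cons_val', Matrix.cons_val_zero,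
      Matrix.cons_val_one, Matrix.cons_val]
    ring
  obtain ⟨X, hX⟩ := exists_cubic_bound t s d
  set Y := max (max X β) 1 + 1 with hY
  have hYX : X ≤ Y := (le_max_left _ _).trans ((le_max_left _ _).trans (by linarith))
  have hYβ : β < Y := lt_of_le_of_lt ((le_max_right _ _).trans (le_max_left _ _)) (lt_add_one _)
  have hY1 : 1 ≤ Y := (le_max_right _ _).trans (by linarith)
  have hposY : 0 < (S Y).det := by
    have h1 := hX Y (by rwa [abs_of_pos (by linarith)])
    rw [abs_of_pos (by linarith : 0 < Y)] at h1
    have h2 : 0 < A.charpoly.eval Y := by rw [hcub]; linarith [neg_abs_le (t * Y ^ 2 + s * Y + d)]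
    have h3 := mul_pos hv h2
    rw [hfac] at h3
    exact pos_of_mul_pos_right h3 (by linarith)
  have hposY' : 0 < (S (-Y)).det := by
    have h1 := hX (-Y) (by rwa [abs_neg, abs_of_pos (by linarith)])
    rw [abs_neg, abs_of_pos (by linarith : 0 < Y)] at h1
    have h2 : A.charpoly.eval (-Y) < 0 := by
      rw [hcub]; linarith [le_abs_self (t * (-Y) ^ 2 + s * (-Y) + d), Odd.neg_pow (by decide : Odd 3) Y]
    have h3 := mul_neg_of_pos_of_neg hv h2
    rw [hfac] at h3
    by_contra h4
    have := mul_nonneg_of_nonpos_of_nonpos (by linarith : -Y - β ≤ 0) (not_lt.1 h4)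
    linarith
  have hpos1 : 0 < (S 1).det := by
    by_contra h1
    obtain ⟨x, hx, hx0⟩ := intermediate_value_Icc hY1 hcont.continuousOn
      (show (0 : ℝ) ∈ Set.Icc _ _ from ⟨not_lt.1 h1, hposY.le⟩)
    exact hroot x (hx.1.trans (le_abs_self x)) hx0
  have hpos2 : 0 < (S (-1)).det := by
    by_contra h1
    obtain ⟨x, hx, hx0⟩ := intermediate_value_Icc' (by linarith : -Y ≤ -1) hcont.continuousOn
      (show (0 : ℝ) ∈ Set.Icc _ _ from ⟨not_lt.1 h1, hposY'.le⟩)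
    exact hroot x ((by linarith [hx.2] : 1 ≤ -x).trans (neg_le_abs x)) hx0
  constructor
  · by_contra h1
    have h2 := mul_nonneg hv.le (not_lt.1 h1)
    rw [hfac] at h2
    nlinarith
  · by_contra h1
    have h2 := mul_nonneg hv.le (not_lt.1 h1)
    rw [hfac] at h2
    nlinarith

/-! ### Products of Brun matrices -/

theorem realMatrix_prod_map {ι : Type*} (f : ι → Substitution) (l : List ι) :
    realMatrix (l.map f).prod = (l.map fun i => realMatrix (f i)).prod := by
  induction l with
  | nil => simpa using realMatrix_one
  | cons a l ih => simp [realMatrix_mul, ih]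

/-- Powers of a product are products over repeated lists, so the stage-counting lemmas apply to
them. -/
theorem map_flatten_replicate_prod {ι M : Type*} [Monoid M] (f : ι → M) (l : List ι) (k : ℕ) :
    ((List.replicate k l).flatten.map f).prod = (l.map f).prod ^ k := by
  induction k with
  | zero => simp
  | succ k ih => simp [List.replicate_succ, pow_succ']

/-- The Brun matrices in the coordinates `t` of the ordered cone,
`v = (t₁, t₁ + t₂, t₁ + t₂ + t₃)`. -/
def brunConeMatrix : Fin 3 → Matrix (Fin 3) (Fin 3) ℝ :=
  ![!![1, 0, 1; 0, 1, 1; 0, 0, 1], !![1, 0, 1; 0, 1, 1; 0, 1, 0], !![1, 0, 1; 1, 0, 0; 0, 1, 0]]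

def orderedConeMatrix : Matrix (Fin 3) (Fin 3) ℝ := !![1, 1, 1; 0, 1, 1; 0, 0, 1]

/-- The cone matrices are the Brun matrices conjugated so that positivity of `t` means strict
ordering of `v`; they remain non-negative, so Perron's argument yields an ordered eigenvector. -/
theorem orderedConeMatrix_mul_brun (i : Fin 3) :
    orderedConeMatrix * realMatrix (brun i) = brunConeMatrix i * orderedConeMatrix := by
  have h3 : i = 0 ∨ i = 1 ∨ i = 2 := by fin_cases i <;> simp
  rcases h3 with rfl | rfl | rfl
  · rw [realMatrix_brun_zero]
    ext a b; fin_cases a <;> fin_cases b <;>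
      simp [brunConeMatrix, orderedConeMatrix, Matrix.mul_apply, Fin.sum_univ_three]
  · rw [realMatrix_brun_one]
    ext a b; fin_cases a <;> fin_cases b <;>
      simp [brunConeMatrix, orderedConeMatrix, Matrix.mul_apply, Fin.sum_univ_three]
  · rw [realMatrix_brun_two]
    ext a b; fin_cases a <;> fin_cases b <;>
      simp [brunConeMatrix, orderedConeMatrix, Matrix.mul_apply, Fin.sum_univ_three]

theorem orderedConeMatrix_mul_brun_prod (l : List (Fin 3)) :
    orderedConeMatrix * realMatrix (l.map brun).prod =
      (l.map brunConeMatrix).prod * orderedConeMatrix := by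
  induction l with
  | nil => simp [realMatrix_one]
  | cons i l ih =>
    rw [List.map_cons, List.map_cons, List.prod_cons, List.prod_cons, realMatrix_mul, ← mul_assoc,
      orderedConeMatrix_mul_brun, mul_assoc, ih, mul_assoc]

theorem brunConeMatrix_nonneg (i : Fin 3) : ∀ a b, 0 ≤ brunConeMatrix i a b := by
  intro a b
  fin_cases i <;> fin_cases a <;> fin_cases b <;> simp [brunConeMatrix]

theorem matrix_prod_nonneg {l : List (Matrix (Fin 3) (Fin 3) ℝ)}
    (h : ∀ A ∈ l, ∀ i j, 0 ≤ A i j) (i j : Fin 3) : 0 ≤ l.prod i j := by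
  induction l generalizing i j with
  | nil =>
    rw [List.prod_nil, Matrix.one_apply]
    split_ifs <;> norm_num
  | cons A l ih =>
    rw [List.prod_cons, Matrix.mul_apply]
    exact Finset.sum_nonneg fun k _ =>
      mul_nonneg (h A (by simp) i k) (ih (fun B hB => h B (by simp [hB])) k j)

theorem vecMul_brunConeMatrix_zero (z : Fin 3 → ℝ) :
    Matrix.vecMul z (brunConeMatrix 0) = ![z 0, z 1, z 0 + z 1 + z 2] := by
  ext i; fin_cases i <;> simp [brunConeMatrix, Matrix.vecMul, dotProduct, Fin.sum_univ_three]

theorem vecMul_brunConeMatrix_one (z : Fin 3 → ℝ) :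
    Matrix.vecMul z (brunConeMatrix 1) = ![z 0, z 1 + z 2, z 0 + z 1] := by
  ext i; fin_cases i <;> simp [brunConeMatrix, Matrix.vecMul, dotProduct, Fin.sum_univ_three]

theorem vecMul_brunConeMatrix_two (z : Fin 3 → ℝ) :
    Matrix.vecMul z (brunConeMatrix 2) = ![z 0 + z 1, z 2, z 0] := by
  ext i; fin_cases i <;> simp [brunConeMatrix, Matrix.vecMul, dotProduct, Fin.sum_univ_three]

/-- Stages of positivity of a non-negative vector: each occurrence of the third Brun matrix leads
to the next stage, and the other matrices preserve every stage. -/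
def BrunPositive : ℕ → (Fin 3 → ℝ) → Prop
  | 0, z => 0 ≤ z ∧ (0 < z 0 ∨ 0 < z 1 ∨ 0 < z 2)
  | 1, z => 0 ≤ z ∧ (0 < z 0 ∨ 0 < z 1)
  | 2, z => 0 ≤ z ∧ 0 < z 0
  | 3, z => 0 ≤ z ∧ 0 < z 0 ∧ 0 < z 2
  | _, z => 0 < z 0 ∧ 0 < z 1 ∧ 0 < z 2

theorem nonneg_fin_three {z : Fin 3 → ℝ} : 0 ≤ z ↔ 0 ≤ z 0 ∧ 0 ≤ z 1 ∧ 0 ≤ z 2 := by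
  rw [Pi.le_def, Fin.forall_fin_succ, Fin.forall_fin_two]
  rfl

theorem BrunPositive.vecMul {p : ℕ} {z : Fin 3 → ℝ} (h : BrunPositive p z) (i : Fin 3) :
    BrunPositive (p + if i = 2 then 1 else 0) (Matrix.vecMul z (brunConeMatrix i)) := by
  have h3 : i = 0 ∨ i = 1 ∨ i = 2 := by fin_cases i <;> simp
  rcases h3 with rfl | rfl | rfl
  · rw [vecMul_brunConeMatrix_zero]
    match p, h with
    | 0, h | 1, h | 2, h | 3, h | _ + 4, h =>
      simp [BrunPositive, nonneg_fin_three] at h ⊢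
      grind
  · rw [vecMul_brunConeMatrix_one]
    match p, h with
    | 0, h | 1, h | 2, h | 3, h | _ + 4, h =>
      simp [BrunPositive, nonneg_fin_three] at h ⊢
      grind
  · rw [vecMul_brunConeMatrix_two]
    match p, h with
    | 0, h | 1, h | 2, h | 3, h | _ + 4, h =>
      simp [BrunPositive, nonneg_fin_three] at h ⊢
      grind

theorem BrunPositive.vecMul_prod {p : ℕ} {z : Fin 3 → ℝ} (h : BrunPositive p z)
    (l : List (Fin 3)) :
    BrunPositive (p + l.count 2) (Matrix.vecMul z (l.map brunConeMatrix).prod) := by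
  induction l generalizing p z with
  | nil => simpa using h
  | cons i l ih =>
    have := ih (h.vecMul i)
    rw [List.map_cons, List.prod_cons, ← Matrix.vecMul_vecMul, List.count_cons]
    convert this using 1
    simp only [beq_iff_eq]
    omega

theorem BrunPositive.pos {p : ℕ} {z : Fin 3 → ℝ} (h : BrunPositive p z) (hp : 4 ≤ p) (i : Fin 3) :
    0 < z i := by
  obtain ⟨p, rfl⟩ := Nat.exists_eq_add_of_le' hp
  obtain ⟨h0, h1, h2⟩ := h
  fin_cases i <;> assumption

/-! ### Brun matrices acting on ordered rows and on columns orthogonal to them -/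

theorem vecMul_brun_zero (v : Fin 3 → ℝ) :
    Matrix.vecMul v (realMatrix (brun 0)) = ![v 0, v 1, v 1 + v 2] := by
  rw [realMatrix_brun_zero]
  ext i; fin_cases i <;> simp [Matrix.vecMul, dotProduct, Fin.sum_univ_three]

theorem vecMul_brun_one (v : Fin 3 → ℝ) :
    Matrix.vecMul v (realMatrix (brun 1)) = ![v 0, v 2, v 1 + v 2] := by
  rw [realMatrix_brun_one]
  ext i; fin_cases i <;> simp [Matrix.vecMul, dotProduct, Fin.sum_univ_three]

theorem vecMul_brun_two (v : Fin 3 → ℝ) :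
    Matrix.vecMul v (realMatrix (brun 2)) = ![v 1, v 2, v 0 + v 2] := by
  rw [realMatrix_brun_two]
  ext i; fin_cases i <;> simp [Matrix.vecMul, dotProduct, Fin.sum_univ_three]

theorem brun_zero_mulVec (w : Fin 3 → ℝ) :
    (realMatrix (brun 0)).mulVec w = ![w 0, w 1 + w 2, w 2] := by
  rw [realMatrix_brun_zero]
  ext i; fin_cases i <;> simp [Matrix.mulVec, dotProduct, Fin.sum_univ_three]

theorem brun_one_mulVec (w : Fin 3 → ℝ) :
    (realMatrix (brun 1)).mulVec w = ![w 0, w 2, w 1 + w 2] := by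
  rw [realMatrix_brun_one]
  ext i; fin_cases i <;> simp [Matrix.mulVec, dotProduct, Fin.sum_univ_three]

theorem brun_two_mulVec (w : Fin 3 → ℝ) :
    (realMatrix (brun 2)).mulVec w = ![w 2, w 0, w 1 + w 2] := by
  rw [realMatrix_brun_two]
  ext i; fin_cases i <;> simp [Matrix.mulVec, dotProduct, Fin.sum_univ_three]

/-- The open cone of strictly ordered positive vectors. -/
def StrictlyOrdered (v : Fin 3 → ℝ) : Prop := 0 < v 0 ∧ v 0 < v 1 ∧ v 1 < v 2

theorem StrictlyOrdered.vecMul_brun {v : Fin 3 → ℝ} (h : StrictlyOrdered v) (i : Fin 3) :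
    StrictlyOrdered (Matrix.vecMul v (realMatrix (brun i))) ∧
      v 2 < Matrix.vecMul v (realMatrix (brun i)) 2 := by
  obtain ⟨h0, h1, h2⟩ := h
  have h3 : i = 0 ∨ i = 1 ∨ i = 2 := by fin_cases i <;> simp
  rcases h3 with rfl | rfl | rfl
  · simp only [vecMul_brun_zero, StrictlyOrdered, Matrix.cons_val]
    refine ⟨⟨?_, ?_, ?_⟩, ?_⟩ <;> linarith
  · simp only [vecMul_brun_one, StrictlyOrdered, Matrix.cons_val]
    refine ⟨⟨?_, ?_, ?_⟩, ?_⟩ <;> linarith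
  · simp only [vecMul_brun_two, StrictlyOrdered, Matrix.cons_val]
    refine ⟨⟨?_, ?_, ?_⟩, ?_⟩ <;> linarith

theorem StrictlyOrdered.vecMul_brun_prod {v : Fin 3 → ℝ} (h : StrictlyOrdered v)
    (l : List (Fin 3)) : v 2 ≤ Matrix.vecMul v (realMatrix (l.map brun).prod) 2 := by
  induction l generalizing v with
  | nil => simp [realMatrix_one]
  | cons i l ih =>
    rw [List.map_cons, List.prod_cons, realMatrix_mul, ← Matrix.vecMul_vecMul]
    exact (h.vecMul_brun i).2.le.trans (ih (h.vecMul_brun i).1)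

/-- If `w 1 + w 2 ≥ m`, then `w 2 ≥ 0`, so `u 1 * w 1 + u 2 * w 2 ≥ u 1 * m > u 0 * m`, too large to
be cancelled by `u 0 * w 0`. The other sign is symmetric. -/
theorem abs_add_lt_of_orthogonal {u w : Fin 3 → ℝ} {m : ℝ} (hm : 0 < m) (hu : StrictlyOrdered u)
    (hw : ∀ i, |w i| ≤ m) (huw : u ⬝ᵥ w = 0) : |w 1 + w 2| < m := by
  obtain ⟨h0, h1, h2⟩ := hu
  have h : u 0 * w 0 + u 1 * w 1 + u 2 * w 2 = 0 := by
    simpa [dotProduct, Fin.sum_univ_three] using huw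
  have a0 := abs_le.1 (hw 0)
  have a1 := abs_le.1 (hw 1)
  have a2 := abs_le.1 (hw 2)
  have b1 : -(u 0 * m) ≤ u 0 * w 0 := by nlinarith
  have b2 : u 0 * w 0 ≤ u 0 * m := by nlinarith
  have b3 : u 0 * m < u 1 * m := by nlinarith
  have b4 : u 1 * m < u 2 * m := by nlinarith
  rw [abs_lt]
  constructor
  · by_contra hc
    have hc' : w 1 + w 2 ≤ -m := not_lt.1 hc
    nlinarith [mul_nonneg (sub_nonneg.2 h2.le) (by linarith : 0 ≤ -w 2)]
  · by_contra hc
    have hc' : m ≤ w 1 + w 2 := not_lt.1 hc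
    nlinarith [mul_nonneg (sub_nonneg.2 h2.le) (by linarith : 0 ≤ w 2)]

/-- Stages of contraction of the supremum norm: each occurrence of the third Brun matrix leads to
the next stage, and the other matrices preserve every stage. -/
def BrunContracted : ℕ → ℝ → (Fin 3 → ℝ) → Prop
  | 0, m, w => |w 0| ≤ m ∧ |w 1| ≤ m ∧ |w 2| ≤ m
  | 1, m, w => |w 0| ≤ m ∧ |w 1| ≤ m ∧ |w 2| < m
  | 2, m, w => |w 0| < m ∧ |w 1| ≤ m ∧ |w 2| < m
  | _, m, w => |w 0| < m ∧ |w 1| < m ∧ |w 2| < m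

theorem BrunContracted.le {p : ℕ} {m : ℝ} {w : Fin 3 → ℝ} (h : BrunContracted p m w) (i : Fin 3) :
    |w i| ≤ m := by
  match p, h with
  | 0, h | 1, h | 2, h | _ + 3, h =>
    obtain ⟨h0, h1, h2⟩ := h
    fin_cases i <;> simp <;> linarith

/-- Each Brun matrix produces one new coordinate, `w 1 + w 2`, which is strictly below `m` by
orthogonality; the other two are old ones. Only the third matrix cycles the positions so that a
further coordinate becomes strict. -/
theorem BrunContracted.mulVec {p : ℕ} {m : ℝ} {v w : Fin 3 → ℝ} (hm : 0 < m)
    (hv : StrictlyOrdered v) (h : BrunContracted p m w) (i : Fin 3)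
    (hvw : Matrix.vecMul v (realMatrix (brun i)) ⬝ᵥ w = 0) :
    BrunContracted (p + if i = 2 then 1 else 0) m ((realMatrix (brun i)).mulVec w) := by
  have key := abs_add_lt_of_orthogonal hm (hv.vecMul_brun i).1 h.le hvw
  have h3 : i = 0 ∨ i = 1 ∨ i = 2 := by fin_cases i <;> simp
  rcases h3 with rfl | rfl | rfl
  · rw [brun_zero_mulVec]
    match p, h with
    | 0, h | 1, h | 2, h | _ + 3, h =>
      simp [BrunContracted] at h ⊢
      grind
  · rw [brun_one_mulVec]
    match p, h with
    | 0, h | 1, h | 2, h | _ + 3, h =>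
      simp [BrunContracted] at h ⊢
      grind
  · rw [brun_two_mulVec]
    match p, h with
    | 0, h | 1, h | 2, h | _ + 3, h =>
      simp [BrunContracted] at h ⊢
      grind

theorem BrunContracted.mulVec_prod {p : ℕ} {m : ℝ} {v w : Fin 3 → ℝ} (hm : 0 < m)
    (hv : StrictlyOrdered v) (h : BrunContracted p m w) (l : List (Fin 3))
    (hvw : Matrix.vecMul v (realMatrix (l.map brun).prod) ⬝ᵥ w = 0) :
    BrunContracted (p + l.count 2) m ((realMatrix (l.map brun).prod).mulVec w) := by
  induction l generalizing v with
  | nil => simpa [realMatrix_one] using h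
  | cons i l ih =>
    rw [List.map_cons, List.prod_cons, realMatrix_mul, ← Matrix.vecMul_vecMul] at hvw
    have h1 := ih (hv.vecMul_brun i).1 hvw
    rw [← Matrix.dotProduct_mulVec] at hvw
    have h2 := h1.mulVec hm hv i hvw
    rw [List.map_cons, List.prod_cons, realMatrix_mul, ← Matrix.mulVec_mulVec, List.count_cons]
    convert h2 using 1
    simp only [beq_iff_eq]
    omega

theorem exists_eigenvector_brun {l : List (Fin 3)} (hl : BrunAdmissible l) :
    ∃ (β : ℝ) (v : Fin 3 → ℝ), 1 < β ∧ StrictlyOrdered v ∧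
      Matrix.vecMul v (realMatrix (l.map brun).prod) = β • v := by
  have hcount : 1 ≤ l.count 2 := List.one_le_count_iff.2 hl
  set B := (l.map brunConeMatrix).prod with hB
  have hBn : ∀ i j, 0 ≤ B i j := matrix_prod_nonneg fun A hA => by
    obtain ⟨i, -, rfl⟩ := List.mem_map.1 hA
    exact brunConeMatrix_nonneg i
  -- The fourth power contains the third matrix at least four times, enough to pass through all
  -- stages of `BrunPositive`. The transpose turns left eigenvectors into right ones.
  obtain ⟨β, t, ht, htB⟩ := exists_pos_eigenvector B.transpose (fun i j => hBn j i) 4 (by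
    intro z hz hz0 i
    rw [← Matrix.transpose_pow, Matrix.mulVec_transpose, hB, ← map_flatten_replicate_prod]
    have h0 : BrunPositive 0 z := by
      refine ⟨hz, ?_⟩
      by_contra hc
      push Not at hc
      refine hz0 (funext fun j => le_antisymm ?_ (hz j))
      fin_cases j
      exacts [hc.1, hc.2.1, hc.2.2]
    refine (h0.vecMul_prod _).pos ?_ i
    simp
    omega)
  rw [Matrix.mulVec_transpose] at htB
  set v := Matrix.vecMul t orderedConeMatrix with hv
  have hv' : v = ![t 0, t 0 + t 1, t 0 + t 1 + t 2] := by
    ext i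
    fin_cases i <;>
      simp [hv, orderedConeMatrix, Matrix.vecHead, Matrix.vecTail, add_assoc]
  have hvo : StrictlyOrdered v := by
    have h0 := ht 0
    have h1 := ht 1
    have h2 := ht 2
    rw [hv']
    simp only [StrictlyOrdered, Matrix.cons_val]
    refine ⟨?_, ?_, ?_⟩ <;> linarith
  have heig : Matrix.vecMul v (realMatrix (l.map brun).prod) = β • v := by
    rw [hv, Matrix.vecMul_vecMul, orderedConeMatrix_mul_brun_prod, ← Matrix.vecMul_vecMul, htB,
      Matrix.smul_vecMul]
  refine ⟨β, v, ?_, hvo, heig⟩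
  -- The first factor strictly increases the last coordinate of an ordered row and the remaining
  -- factors do not decrease it, so `β > 1`.
  obtain ⟨i, l', rfl⟩ := List.exists_cons_of_ne_nil (List.ne_nil_of_mem hl)
  have h1 := (hvo.vecMul_brun i).2
  have h2 := (hvo.vecMul_brun i).1.vecMul_brun_prod l'
  rw [Matrix.vecMul_vecMul v, ← realMatrix_mul, ← List.prod_cons, ← List.map_cons, heig] at h2
  have h3 : v 2 < β * v 2 := h1.trans_le h2
  have h4 : 0 < v 2 := by linarith [hvo.1, hvo.2.1, hvo.2.2]
  nlinarith

theorem brun_charpoly_eval_neg {l : List (Fin 3)} (hl : BrunAdmissible l) :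
    (realMatrix (l.map brun).prod).charpoly.eval 1 < 0 ∧
      (realMatrix (l.map brun).prod).charpoly.eval (-1) < 0 := by
  obtain ⟨β, v, hβ, hv, hvM⟩ := exists_eigenvector_brun hl
  refine charpoly_eval_neg_of_no_eigenvector _ v β hv.1 hβ hvM ?_
  intro c w hc hw hvw
  have hcount : 1 ≤ l.count 2 := List.one_le_count_iff.2 hl
  by_contra hw0
  obtain ⟨i, hi⟩ := Finite.exists_max fun i => |w i|
  have hm : 0 < |w i| := by
    obtain ⟨j, hj⟩ := Function.ne_iff.1 hw0
    exact (abs_pos.2 hj).trans_le (hi j)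
  set M := realMatrix (l.map brun).prod with hM
  -- The cube contains the third matrix at least three times, so `M ^ 3` makes every coordinate of
  -- `w` strictly smaller than its largest one, whereas `c ^ 3` does not shrink that largest
  -- coordinate.
  have hpow : realMatrix ((List.replicate 3 l).flatten.map brun).prod = M ^ 3 := by
    rw [hM, realMatrix_prod_map, realMatrix_prod_map, map_flatten_replicate_prod]
  have hv3 : Matrix.vecMul v (M ^ 3) = β ^ 3 • v := by
    rw [pow_three, ← Matrix.vecMul_vecMul, ← Matrix.vecMul_vecMul, hvM, Matrix.smul_vecMul,
      Matrix.smul_vecMul, hvM, Matrix.smul_vecMul, hvM, smul_smul, smul_smul, pow_three']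
  have hw3 : (M ^ 3).mulVec w = c ^ 3 • w := by
    rw [pow_three, ← Matrix.mulVec_mulVec, ← Matrix.mulVec_mulVec, hw, Matrix.mulVec_smul, hw,
      Matrix.mulVec_smul, Matrix.mulVec_smul, hw, smul_smul, smul_smul, pow_three']
  have h0 : BrunContracted 0 |w i| w := ⟨hi 0, hi 1, hi 2⟩
  have h1 := h0.mulVec_prod hm hv (List.replicate 3 l).flatten
    (by rw [hpow, hv3, smul_dotProduct, hvw, smul_zero])
  rw [hpow, hw3] at h1
  obtain ⟨p, hp⟩ : ∃ p, 0 + (List.replicate 3 l).flatten.count 2 = p + 3 := by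
    refine Nat.exists_eq_add_of_le' ?_
    simp
    omega
  rw [hp] at h1
  obtain ⟨a0, a1, a2⟩ := h1
  have h2 : |(c ^ 3 • w) i| < |w i| := by fin_cases i <;> assumption
  rw [Pi.smul_apply, smul_eq_mul, abs_mul, abs_pow] at h2
  have h3 : 1 ≤ |c| ^ 3 := one_le_pow₀ hc
  nlinarith

/-! ### Products of Jacobi-Perron matrices -/

/-- If `z₁` and `z₂` have the same sign, orthogonality gives `z₃` the opposite sign while the
recurrence pushes it the other way, so it stays within `m`. With opposite signs, orthogonality
bounds `z₃` by a difference of the two contributions, which reaches `m` only if `Y` exceeds `Z`. -/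
theorem abs_lt_or_spike {z₀ z₁ z₂ z₃ a b X Y Z m : ℝ} (hm : 0 < m) (h0 : |z₀| ≤ m)
    (h1 : |z₁| ≤ m) (h2 : |z₂| ≤ m) (ha : 0 ≤ a) (hb : 1 ≤ b) (hX : 0 < X) (hXZ : X < Z)
    (hY : 0 < Y) (hrec : z₃ = z₀ + a * z₁ + b * z₂) (horth : X * z₁ + Y * z₂ + Z * z₃ = 0) :
    |z₃| < m ∨ (z₁ * z₂ < 0 ∧ m ≤ |z₃| ∧ Z < Y) := by
  wlog h : 0 ≤ z₁ generalizing z₀ z₁ z₂ z₃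
  · have := this (z₀ := -z₀) (z₁ := -z₁) (z₂ := -z₂) (z₃ := -z₃) (by rwa [abs_neg])
      (by rwa [abs_neg]) (by rwa [abs_neg]) (by linarith) (by linarith) (by linarith)
    simpa using this
  have hZ : 0 < Z := hX.trans hXZ
  have a0 := abs_le.1 h0
  have a1 := abs_le.1 h1
  have a2 := abs_le.1 h2
  by_cases h4 : 0 ≤ z₂
  · left
    have hz3 : z₃ ≤ 0 := by
      by_contra hc
      nlinarith [mul_nonneg hX.le h, mul_nonneg hY.le h4]
    rw [abs_lt]
    refine ⟨?_, by linarith⟩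
    rcases h4.eq_or_lt with h5 | h5
    · rw [← h5] at horth
      by_contra hc
      nlinarith
    · nlinarith [mul_nonneg ha h]
  · push Not at h4
    have hlow : -m < z₃ := by
      by_contra hc
      have : Z * z₃ ≤ Z * (-m) := mul_le_mul_of_nonneg_left (not_lt.1 hc) hZ.le
      nlinarith [mul_neg_of_pos_of_neg hY h4]
    by_cases h5 : z₃ < m
    · left
      exact abs_lt.2 ⟨hlow, h5⟩
    · push Not at h5
      right
      rcases h.eq_or_lt with h6 | h6
      · exfalso
        subst h6
        nlinarith
      · refine ⟨mul_neg_of_pos_of_neg h6 h4, h5.trans (le_abs_self _), ?_⟩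
        by_contra hc
        nlinarith [mul_pos hX h6]

/-- Take the spike `z₂` positive. Orthogonality forces `z₁ < 0 < z₀`. Equal partial quotients give
`z₃ = z₀ + a (z₁ + z₂) > 0`; the next two orthogonality relations give `z₃ < m` and `z₄ < 0`. As
`z₂` does not enter `z₄ = z₁ + b z₃`, also `z₄ > -m`. -/
theorem spike_decay {z₀ z₁ z₂ z₃ z₄ a b X₀ Y₀ Z₀ X₁ Y₁ Z₁ X₂ Y₂ Z₂ m : ℝ} (hm : 0 < m)
    (h0 : |z₀| ≤ m) (h1 : |z₁| ≤ m) (h01 : z₀ * z₁ < 0) (h2 : m ≤ |z₂|) (ha : 0 ≤ a) (hb : 1 ≤ b)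
    (hX₀ : 0 < X₀) (hXZ₀ : X₀ < Z₀) (hY₀ : 0 < Y₀)
    (hX₁ : 0 < X₁) (hXZ₁ : X₁ < Z₁) (hY₁ : 0 < Y₁) (hX₂ : 0 < X₂) (hY₂ : 0 < Y₂) (hZ₂ : 0 < Z₂)
    (horth₀ : X₀ * z₀ + Y₀ * z₁ + Z₀ * z₂ = 0) (horth₁ : X₁ * z₁ + Y₁ * z₂ + Z₁ * z₃ = 0)
    (horth₂ : X₂ * z₂ + Y₂ * z₃ + Z₂ * z₄ = 0)
    (hrec₀ : z₃ = z₀ + a * z₁ + a * z₂) (hrec₁ : z₄ = z₁ + b * z₃) :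
    |z₃| < m ∧ |z₄| < m ∧ z₃ * z₄ < 0 := by
  wlog h : 0 ≤ z₂ generalizing z₀ z₁ z₂ z₃ z₄
  · have := this (z₀ := -z₀) (z₁ := -z₁) (z₂ := -z₂) (z₃ := -z₃) (z₄ := -z₄) (by rwa [abs_neg])
      (by rwa [abs_neg]) (by linarith) (by rwa [abs_neg]) (by linarith) (by linarith)
      (by linarith) (by linarith) (by linarith) (by linarith)
    simpa using this
  rw [abs_of_nonneg h] at h2
  have a0 := abs_le.1 h0
  have a1 := abs_le.1 h1
  have hz1 : z₁ < 0 := by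
    by_contra hc
    have hz0 : z₀ < 0 := by
      by_contra hc'
      nlinarith [mul_nonneg (not_lt.1 hc') (not_lt.1 hc)]
    nlinarith [mul_nonneg hY₀.le (not_lt.1 hc), mul_pos hX₀ hm]
  have hz0 : 0 < z₀ := by
    by_contra hc
    nlinarith [mul_nonneg_of_nonpos_of_nonpos (not_lt.1 hc) hz1.le]
  have hz3 : 0 < z₃ := by nlinarith
  have hz3m : z₃ < m := by
    by_contra hc
    nlinarith [mul_pos hY₁ (hm.trans_le h2)]
  have hz4 : z₄ < 0 := by
    by_contra hc
    nlinarith [mul_pos hY₂ hz3, mul_pos hX₂ (hm.trans_le h2), mul_nonneg hZ₂.le (not_lt.1 hc)]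
  refine ⟨abs_lt.2 ⟨by linarith, hz3m⟩, abs_lt.2 ⟨?_, by linarith⟩, mul_neg_of_pos_of_neg hz3 hz4⟩
  nlinarith

/-- The data of a Jacobi-Perron expansion with partial quotients `a`, `b`: a solution `z` of the
linear recurrence, orthogonal to the positive vectors `(X k, Y k, Z k)`. -/
structure IsJacobiPerronOrbit (a b : ℕ → ℕ) (z X Y Z : ℕ → ℝ) : Prop where
  le : ∀ k, a k ≤ b k
  ne_zero : ∀ k, b k ≠ 0
  eq_z : ∀ k, z (k + 3) = z k + a k * z (k + 1) + b k * z (k + 2)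
  pos_X : ∀ k, 0 < X k
  pos_Y : ∀ k, 0 < Y k
  pos_Z : ∀ k, 0 < Z k
  eq_X : ∀ k, X k = Z (k + 1)
  eq_Y : ∀ k, Y k = X (k + 1) + a k * Z (k + 1)
  eq_Z : ∀ k, Z k = Y (k + 1) + b k * Z (k + 1)
  orth : ∀ k, X k * z k + Y k * z (k + 1) + Z k * z (k + 2) = 0

/-- A size function that decreases infinitely often along a Jacobi-Perron orbit. -/
noncomputable def orbitSize (z : ℕ → ℝ) (k : ℕ) : ℝ :=
  max (max |z k| |z (k + 1)|) (if z k * z (k + 1) < 0 then 0 else |z (k + 2)|)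

theorem orbitSize_nonneg (z : ℕ → ℝ) (k : ℕ) : 0 ≤ orbitSize z k :=
  (abs_nonneg _).trans ((le_max_left _ _).trans (le_max_left _ _))

theorem orbitSize_lt_of_mul_neg {z : ℕ → ℝ} {k : ℕ} {m : ℝ} (h0 : |z k| < m)
    (h1 : |z (k + 1)| < m) (h : z k * z (k + 1) < 0) : orbitSize z k < m := by
  rw [orbitSize, if_pos h]
  exact max_lt (max_lt h0 h1) ((abs_nonneg _).trans_lt h0)

theorem orbitSize_lt {z : ℕ → ℝ} {k : ℕ} {m : ℝ} (h0 : |z k| < m)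
    (h1 : |z (k + 1)| < m) (h2 : |z (k + 2)| < m) : orbitSize z k < m := by
  rw [orbitSize]
  refine max_lt (max_lt h0 h1) ?_
  split_ifs
  exacts [(abs_nonneg _).trans_lt h0, h2]

namespace IsJacobiPerronOrbit

variable {a b : ℕ → ℕ} {z X Y Z : ℕ → ℝ}

theorem one_le (h : IsJacobiPerronOrbit a b z X Y Z) (k : ℕ) : (1 : ℝ) ≤ b k := by
  exact_mod_cast Nat.one_le_iff_ne_zero.2 (h.ne_zero k)

theorem X_lt_Z (h : IsJacobiPerronOrbit a b z X Y Z) (k : ℕ) : X k < Z k := by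
  rw [h.eq_X, h.eq_Z k]
  nlinarith [h.pos_Y (k + 1), h.pos_Z (k + 1), h.one_le k]

/-- If `a k < b k`, the term `b k * Z (k + 1)` alone exceeds `Y k`, because `X (k + 1) < Z (k + 1)`.
If they are equal, `Y k - Z k = X (k + 1) - Y (k + 1)`, and `a (k + 1) ≥ 1` would make this
negative. -/
theorem eq_of_Z_lt_Y (h : IsJacobiPerronOrbit a b z X Y Z) {k : ℕ} (hk : Z k < Y k) :
    a k = b k ∧ a (k + 1) = 0 := by
  have hX := h.X_lt_Z (k + 1)
  have hY := h.pos_Y (k + 1)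
  have hZ := h.pos_Z (k + 1)
  have hab : a k = b k := by
    by_contra hne
    have h1 : (a k : ℝ) + 1 ≤ b k := by exact_mod_cast lt_of_le_of_ne (h.le k) hne
    rw [h.eq_Y, h.eq_Z] at hk
    nlinarith
  refine ⟨hab, ?_⟩
  by_contra hne
  have h1 : (1 : ℝ) ≤ a (k + 1) := by exact_mod_cast Nat.one_le_iff_ne_zero.2 hne
  rw [h.eq_Y k, h.eq_Z k, hab] at hk
  have h2 := h.eq_X (k + 1)
  have h3 := h.eq_Y (k + 1)
  nlinarith [h.pos_X (k + 1 + 1), h.pos_Z (k + 1 + 1)]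

/-- The two terms after the spike are small and of opposite signs, so `orbitSize` does not look at
the term following them, which may be the next spike. -/
theorem orbitSize_lt_of_spike (h : IsJacobiPerronOrbit a b z X Y Z) {k : ℕ} {m : ℝ} (hm : 0 < m)
    (h0 : |z k| ≤ m) (h1 : |z (k + 1)| ≤ m) (h01 : z k * z (k + 1) < 0) (h2 : m ≤ |z (k + 2)|)
    (hk : Z k < Y k) : orbitSize z (k + 3) < m := by
  obtain ⟨hab, ha⟩ := h.eq_of_Z_lt_Y hk
  have r0 := h.eq_z k
  have r1 := h.eq_z (k + 1)
  rw [← hab] at r0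
  rw [ha] at r1
  obtain ⟨c1, c2, c3⟩ := spike_decay hm h0 h1 h01 h2 (Nat.cast_nonneg (a k))
    (h.one_le (k + 1)) (h.pos_X k) (h.X_lt_Z k) (h.pos_Y k) (h.pos_X (k + 1))
    (h.X_lt_Z (k + 1)) (h.pos_Y (k + 1)) (h.pos_X (k + 2)) (h.pos_Y (k + 2)) (h.pos_Z (k + 2))
    (h.orth k) (h.orth (k + 1)) (h.orth (k + 2)) r0 (by simpa using r1)
  exact orbitSize_lt_of_mul_neg c1 c2 c3

theorem abs_lt_or_orbitSize_lt (h : IsJacobiPerronOrbit a b z X Y Z) {k : ℕ} {m : ℝ} (hm : 0 < m)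
    (h0 : |z k| ≤ m) (h1 : |z (k + 1)| ≤ m) (h2 : |z (k + 2)| ≤ m) :
    |z (k + 3)| < m ∨ orbitSize z (k + 4) < m := by
  rcases abs_lt_or_spike hm h0 h1 h2 (Nat.cast_nonneg (a k)) (h.one_le k) (h.pos_X (k + 1))
    (h.X_lt_Z (k + 1)) (h.pos_Y (k + 1)) (h.eq_z k) (h.orth (k + 1)) with h3 | ⟨h3, h4, h5⟩
  · exact Or.inl h3
  · exact Or.inr (h.orbitSize_lt_of_spike hm h1 h2 h3 h4 h5)

/-- Either three consecutive new terms are strictly below the current size, or a spike occurs and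
its aftermath is. -/
theorem exists_orbitSize_lt (h : IsJacobiPerronOrbit a b z X Y Z) (k : ℕ)
    (hk : 0 < orbitSize z k) : ∃ j, orbitSize z (k + j) < orbitSize z k := by
  set m := orbitSize z k with hm
  have h0 : |z k| ≤ m := (le_max_left _ _).trans (le_max_left _ _)
  have h1 : |z (k + 1)| ≤ m := (le_max_right _ _).trans (le_max_left _ _)
  by_cases h2 : |z (k + 2)| ≤ m
  · rcases h.abs_lt_or_orbitSize_lt hk h0 h1 h2 with h3 | h3
    swap
    · exact ⟨4, h3⟩
    rcases h.abs_lt_or_orbitSize_lt hk h1 h2 h3.le with h4 | h4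
    swap
    · exact ⟨5, h4⟩
    rcases h.abs_lt_or_orbitSize_lt hk h2 h3.le h4.le with h5 | h5
    swap
    · exact ⟨6, h5⟩
    exact ⟨3, orbitSize_lt h3 h4 h5⟩
  · push Not at h2
    have h01 : z k * z (k + 1) < 0 := by
      by_contra hc
      have : |z (k + 2)| ≤ m := by
        rw [hm, orbitSize, if_neg hc]
        exact le_max_right _ _
      linarith
    refine ⟨3, h.orbitSize_lt_of_spike hk h0 h1 h01 h2.le ?_⟩
    -- With opposite signs of `z k` and `z (k + 1)`, orthogonality bounds `Z k * |z (k + 2)|` by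
    -- `max (X k) (Y k) * m`; as `X k < Z k`, the assumption `Y k ≤ Z k` contradicts `m < |z (k +
    -- 2)|`.
    by_contra hc
    have hX := h.pos_X k
    have hXZ := h.X_lt_Z k
    have hY := h.pos_Y k
    have hZ := h.pos_Z k
    have a0 := abs_le.1 h0
    have a1 := abs_le.1 h1
    have ho := h.orth k
    have hlt : Z k * m < Z k * |z (k + 2)| := mul_lt_mul_of_pos_left h2 hZ
    rcases mul_neg_iff.1 h01 with ⟨p, q⟩ | ⟨p, q⟩ <;>
      rcases abs_cases (z (k + 2)) with ⟨e, -⟩ | ⟨e, -⟩ <;> rw [e] at hlt <;>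
      nlinarith [mul_pos hX hk]

/-- One period multiplies the size by `|c| ≥ 1`, so the least size over one period is a global
minimum. By `exists_orbitSize_lt` a minimum cannot be positive, and a vanishing size kills the whole
orbit. -/
theorem eq_zero (h : IsJacobiPerronOrbit a b z X Y Z) {n : ℕ} (hn : n ≠ 0) {c : ℝ}
    (hc : 1 ≤ |c|) (hz : ∀ k, z (k + n) = c * z k) (k : ℕ) : z k = 0 := by
  have hc0 : c ≠ 0 := by
    rintro rfl
    norm_num at hc
  have hsize : ∀ k, orbitSize z (k + n) = |c| * orbitSize z k := by
    intro k
    have e : ∀ i, z (k + n + i) = c * z (k + i) := fun i => by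
      rw [← hz, add_right_comm]
    have e0 := e 0
    rw [add_zero, add_zero] at e0
    have hsign : c * z k * (c * z (k + 1)) < 0 ↔ z k * z (k + 1) < 0 := by
      rw [show c * z k * (c * z (k + 1)) = c ^ 2 * (z k * z (k + 1)) by ring]
      exact smul_neg_iff_of_pos_left (by positivity : 0 < c ^ 2)
    rw [orbitSize, orbitSize, e, e, e0, mul_max_of_nonneg _ _ (abs_nonneg c),
      mul_max_of_nonneg _ _ (abs_nonneg c), abs_mul, abs_mul, abs_mul]
    simp only [hsign, mul_ite, mul_zero]
  have hsize' : ∀ q k, orbitSize z k ≤ orbitSize z (k + q * n) := by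
    intro q k
    induction q with
    | zero => simp
    | succ q ih =>
      rw [Nat.succ_mul, ← add_assoc, hsize]
      nlinarith [orbitSize_nonneg z (k + q * n)]
  obtain ⟨k₀, -, hmin⟩ := Finset.exists_min_image (Finset.range n) (orbitSize z)
    ⟨0, Finset.mem_range.2 (Nat.pos_of_ne_zero hn)⟩
  have hmin' : ∀ k, orbitSize z k₀ ≤ orbitSize z k := by
    intro k
    have h1 := hmin (k % n) (Finset.mem_range.2 (Nat.mod_lt _ (Nat.pos_of_ne_zero hn)))
    refine h1.trans ?_
    conv_rhs => rw [← Nat.mod_add_div' k n]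
    exact hsize' _ _
  have hzero : orbitSize z k₀ = 0 := by
    by_contra hne
    obtain ⟨j, hj⟩ := h.exists_orbitSize_lt k₀ (lt_of_le_of_ne (orbitSize_nonneg _ _) (Ne.symm hne))
    exact absurd hj (not_lt.2 (hmin' _))
  have a0 : z k₀ = 0 := by
    have : |z k₀| ≤ 0 := hzero ▸ (le_max_left _ _).trans (le_max_left _ _)
    exact abs_nonpos_iff.1 this
  have a1 : z (k₀ + 1) = 0 := by
    have : |z (k₀ + 1)| ≤ 0 := hzero ▸ (le_max_right _ _).trans (le_max_left _ _)
    exact abs_nonpos_iff.1 this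
  have a2 : z (k₀ + 2) = 0 := by
    have := h.orth k₀
    rw [a0, a1] at this
    simpa [(h.pos_Z k₀).ne'] using this
  have hfwd : ∀ i, z (k₀ + i) = 0 ∧ z (k₀ + i + 1) = 0 ∧ z (k₀ + i + 2) = 0 := by
    intro i
    induction i with
    | zero => exact ⟨a0, a1, a2⟩
    | succ i ih =>
      refine ⟨ih.2.1, ih.2.2, ?_⟩
      have := h.eq_z (k₀ + i)
      rw [ih.1, ih.2.1, ih.2.2] at this
      rw [show k₀ + (i + 1) + 2 = k₀ + i + 3 by ring]
      simpa using this
  have hper : ∀ q, z (k + q * n) = c ^ q * z k := by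
    intro q
    induction q with
    | zero => simp
    | succ q ih => rw [Nat.succ_mul, ← add_assoc, hz, ih, pow_succ]; ring
  have h1 := hper k₀
  -- Vanishing is known only from `k₀` onwards; shifting `k` by `k₀` periods lands there, and `c ≠
  -- 0` brings it back to `k`.
  have h2 : k₀ ≤ k + k₀ * n := by nlinarith [Nat.pos_of_ne_zero hn]
  obtain ⟨i, hi⟩ := Nat.exists_eq_add_of_le h2
  rw [hi, (hfwd i).1] at h1
  exact (mul_eq_zero.1 h1.symm).resolve_left (pow_ne_zero _ hc0)

end IsJacobiPerronOrbit

/-! ### Eigenvectors of Jacobi-Perron products and their periodic orbits -/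

theorem vecMul_jacobiPerron (v : Fin 3 → ℝ) (a b : ℕ) :
    Matrix.vecMul v (realMatrix (jacobiPerron a b)) = ![v 2, v 0 + a * v 2, v 1 + b * v 2] := by
  rw [realMatrix_jacobiPerron]
  ext i; fin_cases i <;> simp [Matrix.vecMul, dotProduct, Fin.sum_univ_three, mul_comm]

theorem jacobiPerron_mulVec (w : Fin 3 → ℝ) (a b : ℕ) :
    (realMatrix (jacobiPerron a b)).mulVec w = ![w 1, w 2, w 0 + a * w 1 + b * w 2] := by
  rw [realMatrix_jacobiPerron]
  ext i; fin_cases i <;> simp [Matrix.mulVec, dotProduct, Fin.sum_univ_three]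

theorem det_realMatrix_jacobiPerron (a b : ℕ) : (realMatrix (jacobiPerron a b)).det = 1 := by
  rw [realMatrix_jacobiPerron]
  simp [Matrix.det_fin_three]

theorem realMatrix_jacobiPerron_nonneg (a b : ℕ) (i j : Fin 3) :
    0 ≤ realMatrix (jacobiPerron a b) i j := by
  rw [realMatrix_jacobiPerron]
  fin_cases i <;> fin_cases j <;> simp

/-- Stages of positivity of a non-negative vector: every Jacobi-Perron matrix leads to the next
stage. -/
def JacobiPerronPositive : ℕ → (Fin 3 → ℝ) → Prop
  | 0, z => 0 ≤ z ∧ (0 < z 0 ∨ 0 < z 1 ∨ 0 < z 2)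
  | 1, z => 0 ≤ z ∧ (0 < z 1 ∨ 0 < z 2)
  | 2, z => 0 ≤ z ∧ 0 < z 2
  | 3, z => 0 ≤ z ∧ 0 < z 0 ∧ 0 < z 2
  | _, z => 0 < z 0 ∧ 0 < z 1 ∧ 0 < z 2

theorem JacobiPerronPositive.vecMul {p : ℕ} {z : Fin 3 → ℝ} (h : JacobiPerronPositive p z)
    (a : ℕ) {b : ℕ} (hb : b ≠ 0) :
    JacobiPerronPositive (p + 1) (Matrix.vecMul z (realMatrix (jacobiPerron a b))) := by
  rw [vecMul_jacobiPerron]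
  have hb1 : (1 : ℝ) ≤ b := by exact_mod_cast Nat.one_le_iff_ne_zero.2 hb
  have ha : (0 : ℝ) ≤ a := Nat.cast_nonneg a
  have key : ∀ (x y c : ℝ), 0 ≤ x → 0 ≤ y → 0 ≤ c → 0 ≤ x + c * y := fun x y c hx hy hc => by
    positivity
  match p, h with
  | 0, h =>
    obtain ⟨h, h'⟩ := h
    rw [nonneg_fin_three] at h
    obtain ⟨h0, h1, h2⟩ := h
    refine ⟨nonneg_fin_three.2 ⟨h2, key _ _ _ h0 h2 ha, key _ _ _ h1 h2 (by linarith)⟩, ?_⟩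
    change 0 < z 0 + a * z 2 ∨ 0 < z 1 + b * z 2
    rcases h' with h' | h' | h'
    · left; positivity
    · right; positivity
    · right; positivity
  | 1, h =>
    obtain ⟨h, h'⟩ := h
    rw [nonneg_fin_three] at h
    obtain ⟨h0, h1, h2⟩ := h
    refine ⟨nonneg_fin_three.2 ⟨h2, key _ _ _ h0 h2 ha, key _ _ _ h1 h2 (by linarith)⟩, ?_⟩
    change 0 < z 1 + b * z 2
    rcases h' with h' | h' <;> positivity
  | 2, h =>
    obtain ⟨h, h'⟩ := h
    rw [nonneg_fin_three] at h
    obtain ⟨h0, h1, h2⟩ := h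
    refine ⟨nonneg_fin_three.2 ⟨h2, key _ _ _ h0 h2 ha, key _ _ _ h1 h2 (by linarith)⟩, h', ?_⟩
    change 0 < z 1 + b * z 2
    positivity
  | 3, h =>
    obtain ⟨h, h', h''⟩ := h
    rw [nonneg_fin_three] at h
    obtain ⟨h0, h1, h2⟩ := h
    refine ⟨h'', ?_, ?_⟩
    · change 0 < z 0 + a * z 2
      positivity
    · change 0 < z 1 + b * z 2
      positivity
  | _ + 4, h =>
    obtain ⟨h0, h1, h2⟩ := h
    refine ⟨h2, ?_, ?_⟩
    · change 0 < z 0 + a * z 2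
      positivity
    · change 0 < z 1 + b * z 2
      positivity

theorem JacobiPerronPositive.vecMul_prod {p : ℕ} {z : Fin 3 → ℝ} (h : JacobiPerronPositive p z)
    (l : List (ℕ × ℕ)) (hl : ∀ q ∈ l, q.2 ≠ 0) :
    JacobiPerronPositive (p + l.length)
      (Matrix.vecMul z (realMatrix (l.map fun q => jacobiPerron q.1 q.2).prod)) := by
  induction l generalizing p z with
  | nil => simpa [realMatrix_one] using h
  | cons q l ih =>
    have := ih (h.vecMul q.1 (hl q (by simp))) fun r hr => hl r (by simp [hr])
    rw [List.map_cons, List.prod_cons, realMatrix_mul, ← Matrix.vecMul_vecMul, List.length_cons]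
    convert this using 1
    omega

theorem JacobiPerronPositive.pos {p : ℕ} {z : Fin 3 → ℝ} (h : JacobiPerronPositive p z)
    (hp : 4 ≤ p) (i : Fin 3) : 0 < z i := by
  obtain ⟨p, rfl⟩ := Nat.exists_eq_add_of_le' hp
  obtain ⟨h0, h1, h2⟩ := h
  fin_cases i <;> assumption

theorem vecMul_jacobiPerron_pos {v : Fin 3 → ℝ} (hv : ∀ i, 0 < v i) (a : ℕ) {b : ℕ} (hb : b ≠ 0) :
    (∀ i, 0 < Matrix.vecMul v (realMatrix (jacobiPerron a b)) i) ∧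
      v 2 < Matrix.vecMul v (realMatrix (jacobiPerron a b)) 2 := by
  have h : JacobiPerronPositive 4 v := ⟨hv 0, hv 1, hv 2⟩
  refine ⟨(h.vecMul a hb).pos (by norm_num), ?_⟩
  rw [vecMul_jacobiPerron]
  change v 2 < v 1 + b * v 2
  have hb1 : (1 : ℝ) ≤ b := by exact_mod_cast Nat.one_le_iff_ne_zero.2 hb
  nlinarith [hv 1, hv 2]

theorem vecMul_jacobiPerron_prod_le {v : Fin 3 → ℝ} (hv : ∀ i, 0 < v i) (l : List (ℕ × ℕ))
    (hl : ∀ q ∈ l, q.2 ≠ 0) :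
    v 2 ≤ Matrix.vecMul v (realMatrix (l.map fun q => jacobiPerron q.1 q.2).prod) 2 := by
  induction l generalizing v with
  | nil => simp [realMatrix_one]
  | cons q l ih =>
    rw [List.map_cons, List.prod_cons, realMatrix_mul, ← Matrix.vecMul_vecMul]
    have h := vecMul_jacobiPerron_pos hv q.1 (hl q (by simp))
    exact h.2.le.trans (ih h.1 fun r hr => hl r (by simp [hr]))

theorem exists_eigenvector_jacobiPerron {l : List (ℕ × ℕ)} (hl0 : l ≠ [])
    (hl : ∀ q ∈ l, q.2 ≠ 0) :
    ∃ (β : ℝ) (v : Fin 3 → ℝ), 1 < β ∧ (∀ i, 0 < v i) ∧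
      Matrix.vecMul v (realMatrix (l.map fun q => jacobiPerron q.1 q.2).prod) = β • v := by
  have hlen : 1 ≤ l.length := List.length_pos_iff.2 hl0
  set B := realMatrix (l.map fun q => jacobiPerron q.1 q.2).prod with hB
  have hBn : ∀ i j, 0 ≤ B i j := by
    rw [hB, realMatrix_prod_map]
    refine matrix_prod_nonneg fun A hA => ?_
    obtain ⟨q, -, rfl⟩ := List.mem_map.1 hA
    exact realMatrix_jacobiPerron_nonneg q.1 q.2
  obtain ⟨β, v, hv, hvB⟩ := exists_pos_eigenvector B.transpose (fun i j => hBn j i) 4 (by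
    intro z hz hz0 i
    rw [← Matrix.transpose_pow, Matrix.mulVec_transpose, hB, realMatrix_prod_map,
      ← map_flatten_replicate_prod, ← realMatrix_prod_map]
    have h0 : JacobiPerronPositive 0 z := by
      refine ⟨hz, ?_⟩
      by_contra hc
      push Not at hc
      refine hz0 (funext fun j => le_antisymm ?_ (hz j))
      fin_cases j
      exacts [hc.1, hc.2.1, hc.2.2]
    refine (h0.vecMul_prod _ ?_).pos ?_ i
    · intro q hq
      obtain ⟨l', hl', hq⟩ := List.mem_flatten.1 hq
      rw [List.eq_of_mem_replicate hl'] at hq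
      exact hl q hq
    · simp
      omega)
  rw [Matrix.mulVec_transpose] at hvB
  refine ⟨β, v, ?_, hv, hvB⟩
  obtain ⟨q, l', rfl⟩ := List.exists_cons_of_ne_nil hl0
  have h1 := vecMul_jacobiPerron_pos hv q.1 (hl q (by simp))
  have h2 := vecMul_jacobiPerron_prod_le h1.1 l' fun r hr => hl r (by simp [hr])
  rw [Matrix.vecMul_vecMul v, ← realMatrix_mul, ← List.prod_cons] at h2
  have h3 : v 2 < β * v 2 := by
    have : Matrix.vecMul v B 2 = β * v 2 := by rw [hvB]; rfl
    rw [← this]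
    exact h1.2.trans_le h2
  nlinarith [hv 2]

/-- The products `J_{k-1} ⋯ J_0` of Jacobi-Perron matrices. -/
noncomputable def partialProduct (c : ℕ → ℕ × ℕ) : ℕ → Matrix (Fin 3) (Fin 3) ℝ
  | 0 => 1
  | k + 1 => realMatrix (jacobiPerron (c k).1 (c k).2) * partialProduct c k

theorem det_partialProduct (c : ℕ → ℕ × ℕ) (k : ℕ) : (partialProduct c k).det = 1 := by
  induction k with
  | zero => simp [partialProduct]
  | succ k ih => rw [partialProduct, Matrix.det_mul, ih, det_realMatrix_jacobiPerron, one_mul]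

theorem partialProduct_add {c : ℕ → ℕ × ℕ} {n : ℕ} (hc : ∀ k, c (k + n) = c k) (k : ℕ) :
    partialProduct c (k + n) = partialProduct c k * partialProduct c n := by
  induction k with
  | zero => simp [partialProduct]
  | succ k ih =>
    rw [add_right_comm, partialProduct, partialProduct, ih, hc, mul_assoc]

theorem partialProduct_take (l : List (ℕ × ℕ)) (c : ℕ → ℕ × ℕ)
    (hc : ∀ k (hk : k < l.length), c k = l[k]) (k : ℕ) (hk : k ≤ l.length) :
    partialProduct c k =
      realMatrix ((l.take k).reverse.map fun q => jacobiPerron q.1 q.2).prod := by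
  induction k with
  | zero => simp [partialProduct, realMatrix_one]
  | succ k ih =>
    rw [partialProduct, ih (by omega), List.take_succ_eq_append_getElem (by omega),
      List.reverse_append, List.reverse_singleton, List.singleton_append, List.map_cons,
      List.prod_cons, realMatrix_mul, hc k (by omega)]

/-- The rows `v * P_k⁻¹` stay orthogonal to the columns `P_k w`, where `P_k` is the partial product.
They are positive despite the inverse: at multiples of the period they are positive multiples of
`v`, and every row is its successor times a Jacobi-Perron matrix, which preserves positivity. The
three coordinates of `P_k w` are consecutive terms of the sequence `z`. -/
theorem isJacobiPerronOrbit_partialProduct {c : ℕ → ℕ × ℕ} {n : ℕ} (hn : n ≠ 0)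
    (hc : ∀ k, c (k + n) = c k) (hle : ∀ k, (c k).1 ≤ (c k).2) (hne : ∀ k, (c k).2 ≠ 0)
    {v w : Fin 3 → ℝ} {β : ℝ} (hβ : 0 < β) (hv : ∀ i, 0 < v i)
    (hvM : Matrix.vecMul v (partialProduct c n) = β • v) (hvw : v ⬝ᵥ w = 0) :
    IsJacobiPerronOrbit (fun k => (c k).1) (fun k => (c k).2)
      (fun k => (partialProduct c k).mulVec w 0)
      (fun k => Matrix.vecMul v (partialProduct c k)⁻¹ 0)
      (fun k => Matrix.vecMul v (partialProduct c k)⁻¹ 1)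
      (fun k => Matrix.vecMul v (partialProduct c k)⁻¹ 2) := by
  have hunit : ∀ k, IsUnit (partialProduct c k).det := fun k => by
    rw [det_partialProduct]
    exact isUnit_one
  set V : ℕ → Fin 3 → ℝ := fun k => Matrix.vecMul v (partialProduct c k)⁻¹ with hV
  set W : ℕ → Fin 3 → ℝ := fun k => (partialProduct c k).mulVec w with hW
  have hVP : ∀ k, Matrix.vecMul (V k) (partialProduct c k) = v := fun k => by
    rw [hV, Matrix.vecMul_vecMul, Matrix.nonsing_inv_mul _ (hunit k), Matrix.vecMul_one]
  have hVrec : ∀ k, V k = ![V (k + 1) 2, V (k + 1) 0 + (c k).1 * V (k + 1) 2,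
      V (k + 1) 1 + (c k).2 * V (k + 1) 2] := by
    intro k
    rw [← vecMul_jacobiPerron]
    have h1 := hVP (k + 1)
    rw [partialProduct, ← Matrix.vecMul_vecMul] at h1
    rw [hV]
    change Matrix.vecMul v _ = _
    conv_lhs => rw [← h1]
    rw [Matrix.vecMul_vecMul _ (partialProduct c k), Matrix.mul_nonsing_inv _ (hunit k),
      Matrix.vecMul_one]
  have hWrec : ∀ k, W (k + 1) = ![W k 1, W k 2, W k 0 + (c k).1 * W k 1 + (c k).2 * W k 2] := by
    intro k
    rw [← jacobiPerron_mulVec, hW]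
    change (partialProduct c (k + 1)).mulVec w = _
    rw [partialProduct, ← Matrix.mulVec_mulVec]
  have hW1 : ∀ k, W (k + 1) 0 = W k 1 := fun k => by rw [hWrec]; rfl
  have hW2 : ∀ k, W (k + 2) 0 = W k 2 := fun k => by rw [hW1, hWrec]; rfl
  have hpos : ∀ k i, 0 < V k i := by
    have hmul : ∀ q, ∃ s : ℝ, 0 < s ∧ V (q * n) = s • v := by
      intro q
      induction q with
      | zero => exact ⟨1, one_pos, by simp [hV, partialProduct]⟩
      | succ q ih =>
        obtain ⟨s, hs, hsV⟩ := ih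
        refine ⟨s * β⁻¹, by positivity, ?_⟩
        have h1 := hVP (q * n)
        have h2 : v = β⁻¹ • Matrix.vecMul v (partialProduct c n) := by
          rw [hvM, smul_smul, inv_mul_cancel₀ hβ.ne', one_smul]
        have h3 : Matrix.vecMul v (partialProduct c n)⁻¹ = β⁻¹ • v := by
          conv_lhs => rw [h2]
          rw [Matrix.smul_vecMul, Matrix.vecMul_vecMul, Matrix.mul_nonsing_inv _ (hunit n),
            Matrix.vecMul_one]
        rw [Nat.succ_mul, hV]
        change Matrix.vecMul v (partialProduct c (q * n + n))⁻¹ = _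
        rw [partialProduct_add hc, Matrix.mul_inv_rev, ← Matrix.vecMul_vecMul, h3,
          Matrix.smul_vecMul, mul_comm s, mul_smul, ← hsV]
    have hdown : ∀ j k, (∀ i, 0 < V (k + j) i) → ∀ i, 0 < V k i := by
      intro j
      induction j with
      | zero => exact fun k h => h
      | succ j ih =>
        intro k h
        refine ih k ?_
        have h1 := (vecMul_jacobiPerron_pos h (c (k + j)).1 (hne (k + j))).1
        rw [vecMul_jacobiPerron] at h1
        rw [hVrec]
        exact h1
    intro k
    obtain ⟨s, hs, hsV⟩ := hmul k
    have hkn : k ≤ k * n := Nat.le_mul_of_pos_right k (Nat.pos_of_ne_zero hn)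
    obtain ⟨j, hj⟩ := Nat.exists_eq_add_of_le hkn
    refine hdown j k fun i => ?_
    rw [← hj, hsV]
    exact mul_pos hs (hv i)
  have horth : ∀ k, V k 0 * W k 0 + V k 1 * W k 1 + V k 2 * W k 2 = 0 := by
    intro k
    have h1 : V k ⬝ᵥ W k = 0 := by
      rw [hW, Matrix.dotProduct_mulVec, hVP, hvw]
    simpa [dotProduct, Fin.sum_univ_three] using h1
  refine ⟨hle, hne, fun k => ?_, fun k => hpos k 0, fun k => hpos k 1, fun k => hpos k 2,
    fun k => ?_, fun k => ?_, fun k => ?_, fun k => ?_⟩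
  · change W (k + 3) 0 = W k 0 + (c k).1 * W (k + 1) 0 + (c k).2 * W (k + 2) 0
    rw [show k + 3 = (k + 1) + 2 by ring, hW2, hW1, hW2, hWrec]
    rfl
  · change V k 0 = V (k + 1) 2
    rw [hVrec]; rfl
  · change V k 1 = V (k + 1) 0 + (c k).1 * V (k + 1) 2
    rw [hVrec]; rfl
  · change V k 2 = V (k + 1) 1 + (c k).2 * V (k + 1) 2
    rw [hVrec]; rfl
  · change V k 0 * W k 0 + V k 1 * W (k + 1) 0 + V k 2 * W (k + 2) 0 = 0
    rw [hW1, hW2, horth]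

theorem jacobiPerron_charpoly_eval_neg {l : List (ℕ × ℕ)} (hl0 : l ≠ [])
    (hl : ∀ q ∈ l, q.1 ≤ q.2 ∧ q.2 ≠ 0) :
    (realMatrix (l.map fun q => jacobiPerron q.1 q.2).prod).charpoly.eval 1 < 0 ∧
      (realMatrix (l.map fun q => jacobiPerron q.1 q.2).prod).charpoly.eval (-1) < 0 := by
  obtain ⟨β, v, hβ, hv, hvM⟩ := exists_eigenvector_jacobiPerron hl0 fun q hq => (hl q hq).2
  refine charpoly_eval_neg_of_no_eigenvector _ v β (hv 0) hβ hvM ?_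
  intro r w hr hw hvw
  set M := realMatrix (l.map fun q => jacobiPerron q.1 q.2).prod with hM
  set n := l.length with hn
  have hn0 : n ≠ 0 := by simpa [hn] using hl0
  have hmod : ∀ k, k % n < l.reverse.length := fun k => by
    rw [List.length_reverse]
    exact Nat.mod_lt _ (Nat.pos_of_ne_zero hn0)
  -- Partial products grow on the left, so the list is read backwards for one period to give `M`.
  set c : ℕ → ℕ × ℕ := fun k => l.reverse[k % n]'(hmod k) with hc
  have hper : ∀ k, c (k + n) = c k := fun k => by simp [hc]
  have hmem : ∀ k, c k ∈ l := fun k => List.mem_reverse.1 (List.getElem_mem _)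
  have hPn : partialProduct c n = M := by
    rw [partialProduct_take l.reverse c _ n (by simp [hn]), hM, List.take_of_length_le (by simp [hn]),
      List.reverse_reverse]
    intro k hk
    have : k % n = k := Nat.mod_eq_of_lt (by simpa using hk)
    simp [hc, this]
  have horb := isJacobiPerronOrbit_partialProduct hn0 hper (fun k => (hl _ (hmem k)).1)
    (fun k => (hl _ (hmem k)).2) (zero_lt_one.trans hβ) hv (by rw [hPn]; exact hvM) hvw
  have hz := horb.eq_zero hn0 hr (fun k => by
    rw [partialProduct_add hper, hPn, ← Matrix.mulVec_mulVec, hw, Matrix.mulVec_smul]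
    rfl)
  have h0 := hz 0
  have h1 := hz 1
  have h2 := hz 2
  -- The first three terms of the orbit are the coordinates of `w`.
  simp only [partialProduct, ← Matrix.mulVec_mulVec, Matrix.one_mulVec, jacobiPerron_mulVec] at h0 h1 h2
  funext i
  fin_cases i
  exacts [h0, h1, h2]

theorem IsAdmissibleProduct.charpoly_eval_neg {σ : Substitution} (hσ : IsAdmissibleProduct σ) :
    (realMatrix σ).charpoly.eval 1 < 0 ∧ (realMatrix σ).charpoly.eval (-1) < 0 := by
  rcases hσ with ⟨w, hw, rfl⟩ | ⟨w, hw, rfl⟩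
  · exact brun_charpoly_eval_neg hw
  · exact jacobiPerron_charpoly_eval_neg hw.1 hw.2.1

section CubicPolynomials

open Polynomial

/-! ### Pisot numbers from the signs of a cubic polynomial at `1` and `-1` -/

/-- A non-real root has squared modulus `q`. For a real root, the quadratic is positive at `1` and
`-1`, and a root beyond them is excluded by `|q| < 1`. -/
theorem norm_lt_one_of_quadratic {p q : ℝ} (hq : |q| < 1) (hp : |p| < 1 + q) {z : ℂ}
    (hz : z ^ 2 + p * z + q = 0) : ‖z‖ < 1 := by
  obtain ⟨x, y⟩ := z
  have hre : x ^ 2 - y ^ 2 + p * x + q = 0 := by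
    have := congrArg Complex.re hz
    simp [pow_two] at this
    linarith
  have him : 2 * x * y + p * y = 0 := by
    have := congrArg Complex.im hz
    simp [pow_two] at this
    linarith
  have hq' := abs_lt.1 hq
  have hp' := abs_lt.1 hp
  have hnorm : ‖(⟨x, y⟩ : ℂ)‖ ^ 2 = x ^ 2 + y ^ 2 := by
    rw [Complex.sq_norm, Complex.normSq_mk]
    ring
  suffices h : x ^ 2 + y ^ 2 < 1 by
    rw [← hnorm] at h
    exact (sq_lt_one_iff₀ (norm_nonneg _)).1 h
  have h1 : y * (2 * x + p) = 0 := by linarith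
  rcases mul_eq_zero.1 h1 with hy | hy
  · subst hy
    by_contra hc
    have hx1 : 1 ≤ |x| := by
      rw [← one_le_sq_iff_one_le_abs]
      nlinarith
    rcases abs_cases x with ⟨e, -⟩ | ⟨e, -⟩ <;> rw [e] at hx1 <;> nlinarith
  · have : p = -2 * x := by linarith
    subst this
    nlinarith

theorem exists_factorization {f : ℝ[X]} (hf : f.Monic) (hdeg : f.natDegree = 3)
    (h0 : |f.eval 0| = 1) (h1 : f.eval 1 < 0) (h2 : f.eval (-1) < 0) :
    ∃ β p q : ℝ, 1 < β ∧ |q| < 1 ∧ |p| < 1 + q ∧ f = (X - C β) * (X ^ 2 + C p * X + C q) := by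
  obtain ⟨β, hβ1, hβ⟩ : ∃ β : ℝ, 1 < β ∧ f.eval β = 0 := by
    have ht : Tendsto (fun x => f.eval x) atTop atTop := by
      refine f.tendsto_atTop_of_leadingCoeff_nonneg ?_ (by rw [hf.leadingCoeff]; norm_num)
      rw [degree_eq_natDegree hf.ne_zero, hdeg]
      norm_num
    obtain ⟨x, hx1, hx⟩ := ((eventually_gt_atTop (1 : ℝ)).and (ht.eventually_gt_atTop 0)).exists
    obtain ⟨β, hβ, hβ0⟩ := intermediate_value_Icc hx1.le f.continuous.continuousOn
      (show (0 : ℝ) ∈ Set.Icc _ _ from ⟨h1.le, hx.le⟩)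
    refine ⟨β, lt_of_le_of_ne hβ.1 ?_, hβ0⟩
    rintro rfl
    exact h1.ne hβ0
  obtain ⟨g, hg⟩ := dvd_iff_isRoot.2 (show f.IsRoot β from hβ)
  have hgm : g.Monic := (monic_X_sub_C β).of_mul_monic_left (hg ▸ hf)
  have hgd : g.natDegree = 2 := by
    have := hdeg
    rw [hg, (monic_X_sub_C β).natDegree_mul hgm, natDegree_X_sub_C] at this
    omega
  have hg' : g = X ^ 2 + C (g.coeff 1) * X + C (g.coeff 0) := by
    have h3 := eq_quadratic_of_degree_le_two (p := g)
      (by rw [degree_eq_natDegree hgm.ne_zero, hgd]; norm_num)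
    have h4 : g.coeff 2 = 1 := by rw [← hgd]; exact hgm
    rwa [h4, C_1, one_mul] at h3
  set p := g.coeff 1
  set q := g.coeff 0
  have hev : ∀ x, f.eval x = (x - β) * (x ^ 2 + p * x + q) := by
    intro x
    rw [hg, hg']
    simp
  refine ⟨β, p, q, hβ1, ?_, ?_, by rw [hg, ← hg']⟩
  · rw [hev] at h0
    have : |q| * β = 1 := by
      rw [← h0, abs_mul, zero_sub, abs_neg, abs_of_pos (by linarith : 0 < β)]
      simp [mul_comm]
    nlinarith [abs_nonneg q]
  · rw [hev] at h1 h2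
    rw [abs_lt]
    constructor <;> nlinarith

theorem charpoly_realMatrix (σ : Substitution) :
    (realMatrix σ).charpoly = (incidenceMatrix σ).charpoly.map (Int.castRingHom ℝ) :=
  Matrix.charpoly_map _ (Int.castRingHom ℝ)

theorem IsUnimodular.isUnit_charpoly_eval_zero {σ : Substitution} (hσ : IsUnimodular σ) :
    IsUnit ((incidenceMatrix σ).charpoly.eval 0) := by
  have h : (incidenceMatrix σ).charpoly.eval 0 = -(incidenceMatrix σ).det := by
    rw [Matrix.eval_charpoly, map_zero, zero_sub, Matrix.det_neg]
    simp
  rw [h, IsUnit.neg_iff]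
  exact isUnimodular_iff_isUnit.1 hσ

theorem charpoly_realMatrix_eval (σ : Substitution) (n : ℤ) :
    (realMatrix σ).charpoly.eval (n : ℝ) = (((incidenceMatrix σ).charpoly.eval n : ℤ) : ℝ) := by
  rw [charpoly_realMatrix]
  exact eval_map_apply (Int.castRingHom ℝ) n

theorem exists_charpoly_factorization {σ : Substitution} (hσ : IsUnimodular σ)
    (h1 : (realMatrix σ).charpoly.eval 1 < 0) (h2 : (realMatrix σ).charpoly.eval (-1) < 0) :
    ∃ β p q : ℝ, 1 < β ∧ |q| < 1 ∧ |p| < 1 + q ∧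
      (realMatrix σ).charpoly = (X - C β) * (X ^ 2 + C p * X + C q) := by
  refine exists_factorization (Matrix.charpoly_monic _)
    (by rw [Matrix.charpoly_natDegree_eq_dim]; rfl) ?_ h1 h2
  have h3 := charpoly_realMatrix_eval σ 0
  rw [Int.cast_zero] at h3
  rw [h3, ← Int.cast_abs, Int.isUnit_iff_abs_eq.1 hσ.isUnit_charpoly_eval_zero, Int.cast_one]

/-- A reducible monic integer cubic has an integer root; it divides the constant term `±1`, hence is
`1` or `-1`, where the value is negative. -/
theorem irreducible_charpoly {σ : Substitution} (hσ : IsUnimodular σ)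
    (h1 : (realMatrix σ).charpoly.eval 1 < 0) (h2 : (realMatrix σ).charpoly.eval (-1) < 0) :
    Irreducible (incidenceMatrix σ).charpoly := by
  have hm := Matrix.charpoly_monic (incidenceMatrix σ)
  have hd : (incidenceMatrix σ).charpoly.natDegree = 3 := by
    rw [Matrix.charpoly_natDegree_eq_dim]; rfl
  rw [hm.irreducible_iff_roots_eq_zero_of_degree_le_three (by omega) (by omega),
    Multiset.eq_zero_iff_forall_notMem]
  intro r hr
  have hr0 : (incidenceMatrix σ).charpoly.eval r = 0 := (mem_roots hm.ne_zero).1 hr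
  have hdvd : r ∣ (incidenceMatrix σ).charpoly.eval 0 := by
    have := sub_dvd_eval_sub r 0 (incidenceMatrix σ).charpoly
    rwa [sub_zero, hr0, zero_sub, dvd_neg] at this
  have hr1 : (realMatrix σ).charpoly.eval (r : ℝ) = 0 := by
    rw [charpoly_realMatrix_eval, hr0, Int.cast_zero]
  rcases Int.isUnit_iff.1 (isUnit_of_dvd_unit hdvd hσ.isUnit_charpoly_eval_zero) with rfl | rfl
  · rw [Int.cast_one] at hr1
    exact h1.ne hr1
  · rw [Int.cast_neg, Int.cast_one] at hr1
    exact h2.ne hr1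

theorem isIrreduciblePisot_of_eval_neg {σ : Substitution} (hσ : IsUnimodular σ)
    (h1 : (realMatrix σ).charpoly.eval 1 < 0) (h2 : (realMatrix σ).charpoly.eval (-1) < 0) :
    IsIrreduciblePisot σ := by
  obtain ⟨β, p, q, hβ, hq, hp, hf⟩ := exists_charpoly_factorization hσ h1 h2
  have hm := Matrix.charpoly_monic (incidenceMatrix σ)
  have hev : ∀ {S : Type} [CommRing S] [Algebra ℚ S] (x : S),
      aeval x ((incidenceMatrix σ).charpoly.map (Int.castRingHom ℚ)) =
        (incidenceMatrix σ).charpoly.eval₂ (Int.castRingHom S) x := by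
    intro S _ _ x
    rw [aeval_def, eval₂_map]
    congr 1
    exact RingHom.ext_int _ _
  have hβ0 : (incidenceMatrix σ).charpoly.eval₂ (Int.castRingHom ℝ) β = 0 := by
    rw [← eval_map, ← charpoly_realMatrix, hf]
    simp
  have hirr : Irreducible ((incidenceMatrix σ).charpoly.map (Int.castRingHom ℚ)) :=
    (hm.irreducible_iff_irreducible_map_fraction_map (K := ℚ)).1 (irreducible_charpoly hσ h1 h2)
  have hmin : (incidenceMatrix σ).charpoly.map (Int.castRingHom ℚ) = minpoly ℚ β :=
    minpoly.eq_of_irreducible_of_monic hirr (by rw [hev, hβ0]) (hm.map _)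
  refine ⟨β, ⟨⟨_, hm, hβ0⟩, hβ, fun z hz hzβ => ?_⟩, hmin⟩
  rw [← hmin, hev] at hz
  have h3 : (incidenceMatrix σ).charpoly.eval₂ (Int.castRingHom ℂ) z =
      ((realMatrix σ).charpoly.map Complex.ofRealHom).eval z := by
    rw [charpoly_realMatrix, Polynomial.map_map, eval_map]
    congr 1
  rw [h3, hf] at hz
  simp only [Polynomial.map_mul, Polynomial.map_sub, Polynomial.map_add, Polynomial.map_pow,
    map_X, map_C, eval_mul, eval_sub, eval_add, eval_pow, eval_X, eval_C, Complex.ofRealHom_eq_coe]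
    at hz
  rcases mul_eq_zero.1 hz with h4 | h4
  · exact absurd (sub_eq_zero.1 h4) hzβ
  · exact norm_lt_one_of_quadratic hq hp h4

/-! ### Exponential decay on the contracting plane -/

theorem exists_decay_complex {p q : ℝ} (hq : |q| < 1) (hp : |p| < 1 + q) :
    ∃ K ρ : ℝ, 0 ≤ K ∧ 0 ≤ ρ ∧ ρ < 1 ∧ ∀ s : ℕ → ℂ,
      (∀ n, s (n + 2) = -p * s (n + 1) - q * s n) →
      ∀ n, ‖s n‖ ≤ K * ρ ^ n * (‖s 0‖ + ‖s 1‖) := by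
  obtain ⟨l, hl⟩ : ∃ l : ℂ, l ^ 2 + p * l + q = 0 := by
    have hd : (X ^ 2 + C (p : ℂ) * X + C (q : ℂ)).natDegree = 2 := by compute_degree!
    obtain ⟨l, hl⟩ := IsAlgClosed.exists_root (X ^ 2 + C (p : ℂ) * X + C (q : ℂ)) (by
      rw [degree_eq_natDegree (by rintro h; rw [h] at hd; simp at hd), hd]
      norm_num)
    exact ⟨l, by simpa using hl⟩
  set l' : ℂ := -p - l with hl'
  have hl'0 : l' ^ 2 + p * l' + q = 0 := by rw [← hl, hl']; ring
  have hn := norm_lt_one_of_quadratic hq hp hl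
  have hn' := norm_lt_one_of_quadratic hq hp hl'0
  obtain ⟨r, hr, hr1⟩ := exists_between (max_lt hn hn')
  have hr0 : 0 ≤ r := ((norm_nonneg l).trans (le_max_left _ _)).trans hr.le
  have hlr : ‖l‖ ≤ r := (le_max_left _ _).trans hr.le
  have hlr' : ‖l'‖ ≤ r := (le_max_right _ _).trans hr.le
  -- The gap between `r` and `ρ` absorbs the linear factor of a double root: with `K = (ρ - r)⁻¹`
  -- one has `r * K + 1 = ρ * K`, which closes the induction below.
  obtain ⟨ρ, hrρ, hρ1⟩ := exists_between hr1
  have hgap : 0 < ρ - r := sub_pos.2 hrρ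
  refine ⟨(ρ - r)⁻¹, ρ, (inv_pos.2 hgap).le, hr0.trans hrρ.le, hρ1, fun s hs => ?_⟩
  have hd : ∀ n, s (n + 1) - l * s n = l' ^ n * (s 1 - l * s 0) := by
    intro n
    induction n with
    | zero => simp
    | succ n ih =>
      rw [pow_succ', mul_assoc, ← ih, hs, hl']
      linear_combination (-s n) * hl
  set S := ‖s 0‖ + ‖s 1‖ with hS
  have hS0 : 0 ≤ S := by positivity
  have hD : ‖s 1 - l * s 0‖ ≤ S := by
    refine (norm_sub_le _ _).trans ?_
    rw [norm_mul, hS, add_comm]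
    gcongr
    exact mul_le_of_le_one_left (norm_nonneg _) hn.le
  have hK : 1 ≤ (ρ - r)⁻¹ := (one_le_inv₀ hgap).2 (by linarith)
  intro n
  induction n with
  | zero =>
    rw [pow_zero, mul_one]
    have : ‖s 0‖ ≤ S := by rw [hS]; linarith [norm_nonneg (s 1)]
    nlinarith
  | succ n ih =>
    have h1 : s (n + 1) = l * s n + l' ^ n * (s 1 - l * s 0) := by rw [← hd]; ring
    have h2 : ‖s (n + 1)‖ ≤ r * ((ρ - r)⁻¹ * ρ ^ n * S) + ρ ^ n * S := by
      rw [h1]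
      refine (norm_add_le _ _).trans ?_
      rw [norm_mul, norm_mul, norm_pow]
      have h3 : ‖l'‖ ^ n ≤ ρ ^ n := pow_le_pow_left₀ (norm_nonneg _) (hlr'.trans hrρ.le) n
      have h4 : 0 ≤ ρ ^ n := (pow_nonneg (norm_nonneg _) n).trans h3
      gcongr
    refine h2.trans (le_of_eq ?_)
    rw [pow_succ]
    field_simp
    ring

theorem exists_decay {p q : ℝ} (hq : |q| < 1) (hp : |p| < 1 + q) :
    ∃ K ρ : ℝ, 0 ≤ K ∧ 0 ≤ ρ ∧ ρ < 1 ∧ ∀ s : ℕ → Fin 3 → ℝ,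
      (∀ n, s (n + 2) = -p • s (n + 1) - q • s n) →
      ∀ n, ‖s n‖ ≤ K * ρ ^ n * (‖s 0‖ + ‖s 1‖) := by
  obtain ⟨K, ρ, hK, hρ, hρ1, h⟩ := exists_decay_complex hq hp
  refine ⟨K, ρ, hK, hρ, hρ1, fun s hs n => ?_⟩
  rw [pi_norm_le_iff_of_nonneg (by positivity)]
  intro i
  have h1 := h (fun m => (s m i : ℂ)) (fun m => by rw [hs]; simp) n
  simp only [Complex.norm_real] at h1
  refine h1.trans ?_
  gcongr
  · exact norm_le_pi_norm (s 0) i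
  · exact norm_le_pi_norm (s 1) i

/-! ### The splitting into contracting plane and expanding line -/

theorem charpoly_incidenceMap (σ : Substitution) :
    (incidenceMap σ).charpoly = (realMatrix σ).charpoly :=
  Matrix.charpoly_toLin' _

/-- The factors `X - β` and `g` are coprime, so by Cayley-Hamilton the space is the direct sum of
their kernels. On the kernel of `g` every orbit satisfies the recurrence of `exists_decay`; on the
other kernel the map is multiplication by `β`. -/
theorem exists_contractingProjection {σ : Substitution} (hσ : IsUnimodular σ)
    (h1 : (realMatrix σ).charpoly.eval 1 < 0) (h2 : (realMatrix σ).charpoly.eval (-1) < 0) :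
    ∃ π : (Fin 3 → ℝ) →ₗ[ℝ] (Fin 3 → ℝ), IsContractingProjection (incidenceMap σ) π ∧
      (∀ x, incidenceMap σ (π x) = π (incidenceMap σ x)) ∧
      ∃ K ρ : ℝ, 0 ≤ K ∧ 0 ≤ ρ ∧ ρ < 1 ∧
        ∀ n x, ‖(incidenceMap σ ^ n) (π x)‖ ≤ K * ρ ^ n * ‖x‖ := by
  obtain ⟨β, p, q, hβ, hq, hp, hf⟩ := exists_charpoly_factorization hσ h1 h2
  set A := incidenceMap σ with hA
  set g : ℝ[X] := X ^ 2 + C p * X + C q with hg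
  have hnoroot : ∀ x : ℝ, 1 < x → g.eval x ≠ 0 := by
    intro x hx h0
    have h3 : ‖(x : ℂ)‖ < 1 := by
      refine norm_lt_one_of_quadratic hq hp ?_
      have : x ^ 2 + p * x + q = 0 := by simpa [hg] using h0
      exact_mod_cast this
    rw [Complex.norm_real, Real.norm_eq_abs, abs_of_pos (by linarith)] at h3
    linarith
  have hcop : IsCoprime (X - C β) g := by
    refine ((irreducible_X_sub_C β).coprime_iff_not_dvd).2 fun h => hnoroot β hβ ?_
    exact dvd_iff_isRoot.1 h
  have hCH : aeval A ((X - C β) * g) = 0 := by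
    rw [← hf, ← charpoly_incidenceMap]
    exact LinearMap.aeval_self_charpoly A
  set Ec := LinearMap.ker (aeval A g) with hEc
  set Ee := LinearMap.ker (aeval A (X - C β)) with hEe
  have hcompl : IsCompl Ec Ee := by
    refine IsCompl.symm ⟨Polynomial.disjoint_ker_aeval_of_isCoprime A hcop, ?_⟩
    rw [codisjoint_iff, Polynomial.sup_ker_aeval_eq_ker_aeval_mul_of_coprime A hcop, hCH,
      LinearMap.ker_zero]
  have hEe_mem : ∀ x, x ∈ Ee ↔ A x = β • x := by
    intro x
    rw [hEe, LinearMap.mem_ker]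
    simp [sub_eq_zero]
  have hEc_mem : ∀ x, x ∈ Ec ↔ A (A x) + p • A x + q • x = 0 := by
    intro x
    rw [hEc, LinearMap.mem_ker]
    simp [hg, pow_two]
  have hAEc : ∀ x ∈ Ec, A x ∈ Ec := by
    intro x hx
    rw [hEc_mem] at hx ⊢
    have h3 := congrArg A hx
    rwa [map_add, map_add, map_smul, map_smul, map_zero] at h3
  have hAEe : ∀ x ∈ Ee, A x ∈ Ee := by
    intro x hx
    rw [hEe_mem] at hx ⊢
    rw [hx, map_smul, hx]
  obtain ⟨K, ρ, hK, hρ, hρ1, hdecay⟩ := exists_decay hq hp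
  have hdec : ∀ x ∈ Ec, ∀ n, ‖(A ^ n) x‖ ≤ K * ρ ^ n * (‖x‖ + ‖A x‖) := by
    intro x hx n
    have := hdecay (fun n => (A ^ n) x) (fun n => by
      have h3 := congrArg (A ^ n) ((hEc_mem x).1 hx)
      rw [map_add, map_add, map_smul, map_smul, map_zero] at h3
      have h4 : (A ^ (n + 2)) x = (A ^ n) (A (A x)) := by rw [pow_add, pow_two]; rfl
      have h5 : (A ^ (n + 1)) x = (A ^ n) (A x) := by rw [pow_succ]; rfl
      simp only [h4, h5]
      rw [eq_sub_iff_add_eq, neg_smul, eq_neg_iff_add_eq_zero, ← h3]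
      abel) n
    simpa using this
  have hpowe : ∀ x ∈ Ee, ∀ n, (A ^ n) x = β ^ n • x := by
    intro x hx n
    induction n with
    | zero => simp
    | succ n ih =>
      rw [pow_succ', Module.End.mul_apply, ih, map_smul, (hEe_mem x).1 hx, smul_smul, pow_succ]
  have hcontr : contractingSpace A = Ec := by
    ext x
    change Tendsto (fun n : ℕ => (A ^ n) x) atTop (𝓝 0) ↔ x ∈ Ec
    have hlim : ∀ y ∈ Ec, Tendsto (fun n : ℕ => (A ^ n) y) atTop (𝓝 0) := by
      intro y hy
      refine squeeze_zero_norm (hdec y hy) ?_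
      have h3 := ((tendsto_pow_atTop_nhds_zero_of_lt_one hρ hρ1).const_mul K).mul_const (‖y‖ + ‖A y‖)
      simpa using h3
    -- The component on the expanding line is multiplied by `β ^ n`, so it tends to zero only if it
    -- vanishes.
    refine ⟨fun hx => ?_, hlim x⟩
    set c := Ec.projection Ee hcompl x with hc
    have hcm : c ∈ Ec := Submodule.projection_apply_mem hcompl x
    have he : x - c ∈ Ee := Submodule.sub_projection_mem hcompl x
    have h3 : Tendsto (fun n : ℕ => (A ^ n) (x - c)) atTop (𝓝 0) := by
      have := hx.sub (hlim c hcm)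
      simpa using this
    have h4 : ‖x - c‖ ≤ 0 := by
      refine ge_of_tendsto' (tendsto_zero_iff_norm_tendsto_zero.1 h3) fun n => ?_
      rw [hpowe _ he, norm_smul, norm_pow, Real.norm_eq_abs, abs_of_pos (by linarith)]
      exact le_mul_of_one_le_left (norm_nonneg _) (one_le_pow₀ hβ.le)
    rw [norm_le_zero_iff, sub_eq_zero] at h4
    rw [h4]
    exact hcm
  have hexp : expandingSpace A = Ee := by
    refine le_antisymm (iSup_le fun b x hx => ?_) fun x hx => ?_
    · rw [Module.End.mem_eigenspace_iff] at hx
      by_cases hb : b.1 = β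
      · rw [hEe_mem, ← hb, hx]
      -- For an eigenvalue `b > 1` other than `β`, Cayley-Hamilton kills `x`, since `g` has no real
      -- root above `1`.
      · have h3 : aeval A ((X - C β) * g) x = ((b.1 - β) * g.eval b.1) • x := by
          rw [mul_comm, map_mul, Module.End.mul_apply]
          have h4 : aeval A (X - C β) x = (b.1 - β) • x := by
            simp [hx, sub_smul]
          have h5 : aeval A g x = g.eval b.1 • x := by
            simp only [hg, map_add, map_mul, aeval_X, aeval_C, LinearMap.add_apply,
              Module.End.mul_apply, pow_two, hx, map_smul, Module.algebraMap_end_apply, eval_add,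
              eval_mul, eval_X, eval_C, add_smul, mul_smul]
            rw [smul_comm p b.1]
          rw [h4, map_smul, h5, smul_smul]
        rw [hCH, LinearMap.zero_apply] at h3
        have h4 := (smul_eq_zero.1 h3.symm).resolve_left
          (mul_ne_zero (sub_ne_zero.2 hb) (hnoroot _ b.2))
        rw [h4]
        exact Ee.zero_mem
    · refine Submodule.mem_iSup_of_mem (⟨β, hβ⟩ : {β : ℝ // 1 < β}) ?_
      rw [Module.End.mem_eigenspace_iff]
      exact (hEe_mem x).1 hx
  set π := Ec.projection Ee hcompl with hπ
  have hπmem : ∀ x, π x ∈ Ec := fun x => Submodule.projection_apply_mem hcompl x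
  refine ⟨π, ⟨?_, ?_⟩, fun x => ?_, ?_⟩
  · rw [hcontr]
    exact ⟨hπmem, fun x hx => Submodule.projection_apply_left hcompl ⟨x, hx⟩⟩
  · rw [hexp]
    exact Submodule.ker_projection hcompl
  · have h3 : π (A (π x)) = A (π x) :=
      Submodule.projection_apply_left hcompl ⟨_, hAEc _ (hπmem x)⟩
    have h4 : π (A (x - π x)) = 0 :=
      (Submodule.projection_apply_eq_zero_iff hcompl).2
        (hAEe _ (Submodule.sub_projection_mem hcompl x))
    rw [map_sub, map_sub, h3, sub_eq_zero] at h4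
    exact h4.symm
  · set L : (Fin 3 → ℝ) →L[ℝ] (Fin 3 → ℝ) := LinearMap.toContinuousLinearMap π with hL
    set L' : (Fin 3 → ℝ) →L[ℝ] (Fin 3 → ℝ) := LinearMap.toContinuousLinearMap (A ∘ₗ π) with hL'
    refine ⟨K * (‖L‖ + ‖L'‖), ρ, by positivity, hρ, hρ1, fun n x => ?_⟩
    refine (hdec _ (hπmem x) n).trans ?_
    have h3 : ‖π x‖ ≤ ‖L‖ * ‖x‖ := L.le_opNorm x
    have h4 : ‖A (π x)‖ ≤ ‖L'‖ * ‖x‖ := L'.le_opNorm x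
    calc K * ρ ^ n * (‖π x‖ + ‖A (π x)‖) ≤ K * ρ ^ n * (‖L‖ * ‖x‖ + ‖L'‖ * ‖x‖) := by gcongr
      _ = _ := by ring

end CubicPolynomials

/-! ### Hausdorff limits -/

/-- The closures form a geometric Cauchy sequence in the complete space of closed sets. Finite
distance to the bounded non-empty `D 0` makes the limit compact and non-empty. -/
theorem exists_isHausdorffLimit {D : ℕ → Set (Fin 3 → ℝ)} (hne : (D 0).Nonempty)
    (hb : Bornology.IsBounded (D 0)) {C ρ : ℝ} (hρ : 0 ≤ ρ) (hρ1 : ρ < 1)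
    (h : ∀ n, Metric.hausdorffEDist (D n) (D (n + 1)) ≤ ENNReal.ofReal (C * ρ ^ n)) :
    ∃ T, IsHausdorffLimit D T := by
  set s : ℕ → TopologicalSpace.Closeds (Fin 3 → ℝ) := fun n => ⟨closure (D n), isClosed_closure⟩
  have hs : ∀ n, edist (s n) (s (n + 1)) ≤ ENNReal.ofReal C * ENNReal.ofReal ρ ^ n := by
    intro n
    rw [TopologicalSpace.Closeds.edist_eq]
    change Metric.hausdorffEDist (closure (D n)) (closure (D (n + 1))) ≤ _
    rw [Metric.hausdorffEDist_closure, ← ENNReal.ofReal_pow hρ,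
      ← ENNReal.ofReal_mul' (pow_nonneg hρ n)]
    exact h n
  have hρ' : ENNReal.ofReal ρ < 1 := by
    rw [← ENNReal.ofReal_one]
    exact (ENNReal.ofReal_lt_ofReal_iff one_pos).2 hρ1
  obtain ⟨T, hT⟩ := cauchySeq_tendsto_of_complete
    (cauchySeq_of_edist_le_geometric _ _ hρ' ENNReal.ofReal_ne_top hs)
  have h0 : Metric.hausdorffEDist (D 0) T ≠ ⊤ := by
    have h1 := edist_le_of_edist_le_geometric_of_tendsto₀ _ _ hs hT
    rw [TopologicalSpace.Closeds.edist_eq] at h1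
    change Metric.hausdorffEDist (closure (D 0)) (T : Set _) ≤ _ at h1
    rw [Metric.hausdorffEDist_closure_left] at h1
    exact ne_top_of_le_ne_top
      (ENNReal.div_ne_top ENNReal.ofReal_ne_top (tsub_pos_iff_lt.2 hρ').ne') h1
  refine ⟨T, ?_, Metric.nonempty_of_hausdorffEDist_ne_top hne h0, ?_⟩
  · refine Metric.isCompact_of_isClosed_isBounded T.isClosed ?_
    set M := Metric.hausdorffEDist (D 0) T + 1
    have hM : M ≠ ⊤ := by finiteness
    refine (hb.thickening (δ := M.toReal)).subset fun x hx => ?_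
    have hlt : Metric.hausdorffEDist (T : Set _) (D 0) < M := by
      rw [Metric.hausdorffEDist_comm]
      exact ENNReal.lt_add_right h0 one_ne_zero
    obtain ⟨y, hy, hxy⟩ := Metric.exists_edist_lt_of_hausdorffEDist_lt hx hlt
    refine Metric.mem_thickening_iff.2 ⟨y, hy, ?_⟩
    rw [dist_edist]
    exact (ENNReal.toReal_lt_toReal (edist_ne_top _ _) hM).2 hxy
  · have h1 := tendsto_iff_edist_tendsto_0.1 hT
    refine h1.congr fun n => ?_
    rw [TopologicalSpace.Closeds.edist_eq]
    exact Metric.hausdorffEDist_closure_left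

/-- If the limit split into two closed pieces, they would be at distance more than some `r > 0`;
their `r / 2`-thickenings would be disjoint, cover a late `D n` and both meet it. -/
theorem IsHausdorffLimit.isPreconnected {D : ℕ → Set (Fin 3 → ℝ)} {T : Set (Fin 3 → ℝ)}
    (h : IsHausdorffLimit D T) (hD : ∀ n, IsPreconnected (D n)) : IsPreconnected T := by
  obtain ⟨hc, -, hlim⟩ := h
  rw [isPreconnected_closed_iff]
  intro t t' ht ht' hsub hne hne'
  by_contra hemp
  have hdisj : Disjoint (T ∩ t) (T ∩ t') := by
    rw [Set.disjoint_iff_inter_eq_empty, ← Set.inter_inter_distrib_left]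
    exact Set.not_nonempty_iff_eq_empty.1 hemp
  obtain ⟨r, hr, hsep⟩ := Metric.exists_pos_forall_lt_edist (hc.inter_right ht)
    (hc.inter_right ht').isClosed hdisj
  have hr2 : (0 : ENNReal) < ENNReal.ofReal (r / 2) := by
    rw [ENNReal.ofReal_pos]
    have : (0 : ℝ) < r := hr
    positivity
  obtain ⟨n, hn⟩ := (hlim.eventually (gt_mem_nhds hr2)).exists
  have hnear : ∀ y ∈ D n, ∃ x ∈ T, dist y x < r / 2 := by
    intro y hy
    obtain ⟨x, hx, hxy⟩ := Metric.exists_edist_lt_of_hausdorffEDist_lt hy hn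
    exact ⟨x, hx, edist_lt_ofReal.1 hxy⟩
  have hnear' : ∀ x ∈ T, ∃ y ∈ D n, dist y x < r / 2 := by
    intro x hx
    rw [Metric.hausdorffEDist_comm] at hn
    obtain ⟨y, hy, hxy⟩ := Metric.exists_edist_lt_of_hausdorffEDist_lt hx hn
    exact ⟨y, hy, by rw [dist_comm]; exact edist_lt_ofReal.1 hxy⟩
  obtain ⟨a, ha⟩ := hne
  obtain ⟨b, hb⟩ := hne'
  obtain ⟨a', ha', haa⟩ := hnear' a ha.1
  obtain ⟨b', hb', hbb⟩ := hnear' b hb.1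
  obtain ⟨y, -, hy1, hy2⟩ := hD n (Metric.thickening (r / 2) (T ∩ t))
    (Metric.thickening (r / 2) (T ∩ t')) Metric.isOpen_thickening Metric.isOpen_thickening
    (fun y hy => by
      obtain ⟨x, hx, hyx⟩ := hnear y hy
      rcases hsub hx with hxt | hxt
      · exact Or.inl (Metric.mem_thickening_iff.2 ⟨x, ⟨hx, hxt⟩, hyx⟩)
      · exact Or.inr (Metric.mem_thickening_iff.2 ⟨x, ⟨hx, hxt⟩, hyx⟩))
    ⟨a', ha', Metric.mem_thickening_iff.2 ⟨a, ha, haa⟩⟩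
    ⟨b', hb', Metric.mem_thickening_iff.2 ⟨b, hb, hbb⟩⟩
  obtain ⟨x, hx, hyx⟩ := Metric.mem_thickening_iff.1 hy1
  obtain ⟨x', hx', hyx'⟩ := Metric.mem_thickening_iff.1 hy2
  have h1 := hsep x hx x' hx'
  rw [edist_dist, ← ENNReal.ofReal_coe_nnreal, ENNReal.ofReal_lt_ofReal_iff'] at h1
  have h2 := dist_triangle_left x x' y
  linarith [h1.1]

/-! ### Approximants -/

theorem Face.toSet_nonempty (f : Face) : f.toSet.Nonempty :=
  ⟨fun k => f.1 k, rfl, fun k _ => ⟨le_rfl, by linarith⟩⟩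

theorem Face.norm_sub_le {f : Face} {y : Fin 3 → ℝ} (hy : y ∈ f.toSet) :
    ‖y - fun k => (f.1 k : ℝ)‖ ≤ 1 := by
  rw [pi_norm_le_iff_of_nonneg zero_le_one]
  intro k
  rw [Pi.sub_apply, Real.norm_eq_abs, abs_le]
  by_cases hk : k = f.2
  · subst hk
    rw [hy.1]
    simp
  · have := hy.2 k hk
    constructor <;> linarith [this.1, this.2]

/-- An invertible matrix has no zero row, so every letter occurs in the image of some letter. -/
theorem dualSubstitution_nonempty_of_mem {σ : Substitution} (hσ : IsUnimodular σ) (f : Face) :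
    ∃ (g : Face) (p s : FreeMonoid (Fin 3)),
      σ (FreeMonoid.of g.2) = p * FreeMonoid.of f.2 * s ∧
      g.1 = (incidenceMatrix σ)⁻¹.mulVec (f.1 + abelianization s) := by
  obtain ⟨j, hj⟩ : ∃ j, incidenceMatrix σ f.2 j ≠ 0 := by
    by_contra hc
    push Not at hc
    have := Matrix.det_eq_zero_of_row_eq_zero f.2 hc
    rcases hσ with h | h <;> rw [this] at h <;> norm_num at h
  have hmem : f.2 ∈ FreeMonoid.toList (σ (FreeMonoid.of j)) := by
    rw [← List.count_pos_iff, Nat.pos_iff_ne_zero]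
    intro h0
    apply hj
    change ((FreeMonoid.toList (σ (FreeMonoid.of j))).count f.2 : ℤ) = 0
    rw [h0]
    rfl
  obtain ⟨p, s, hps⟩ := List.append_of_mem hmem
  refine ⟨(_, j), FreeMonoid.ofList p, FreeMonoid.ofList s, ?_, rfl⟩
  apply FreeMonoid.toList.injective
  rw [hps]
  simp [FreeMonoid.toList_mul]

theorem incidenceMap_intCast (σ : Substitution) (x : Fin 3 → ℤ) :
    incidenceMap σ (fun k => (x k : ℝ)) = fun k => (((incidenceMatrix σ).mulVec x k : ℤ) : ℝ) := by
  funext k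
  simp [incidenceMap, Matrix.mulVec, dotProduct]

/-- The base points satisfy `M g = f + P(s)`, where `s` is a suffix of one of three fixed words; the
faces themselves have bounded diameter. -/
theorem exists_norm_incidenceMap_sub_le {σ : Substitution} (hσ : IsUnimodular σ) :
    ∃ K : ℝ, ∀ (f g : Face) (p s : FreeMonoid (Fin 3)),
      σ (FreeMonoid.of g.2) = p * FreeMonoid.of f.2 * s →
      g.1 = (incidenceMatrix σ)⁻¹.mulVec (f.1 + abelianization s) →
      ∀ x ∈ f.toSet, ∀ y ∈ g.toSet, ‖incidenceMap σ y - x‖ ≤ K := by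
  set A : (Fin 3 → ℝ) →L[ℝ] (Fin 3 → ℝ) := LinearMap.toContinuousLinearMap (incidenceMap σ)
  set L : ℝ := ∑ j, ((FreeMonoid.toList (σ (FreeMonoid.of j))).length : ℝ) with hL
  refine ⟨‖A‖ + L + 1, fun f g p s hps hg x hx y hy => ?_⟩
  set fx : Fin 3 → ℝ := fun k => (f.1 k : ℝ)
  set gx : Fin 3 → ℝ := fun k => (g.1 k : ℝ)
  set sx : Fin 3 → ℝ := fun k => (abelianization s k : ℝ)
  have hM : incidenceMap σ gx = fx + sx := by
    rw [incidenceMap_intCast, hg, Matrix.mulVec_mulVec,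
      Matrix.mul_nonsing_inv _ (isUnimodular_iff_isUnit.1 hσ), Matrix.one_mulVec]
    funext k
    simp [fx, sx]
  have hs : ‖sx‖ ≤ L := by
    rw [pi_norm_le_iff_of_nonneg (by positivity)]
    intro k
    have h1 : (FreeMonoid.toList s).length ≤
        (FreeMonoid.toList (σ (FreeMonoid.of g.2))).length := by
      rw [hps]
      simp [FreeMonoid.toList_mul]
      omega
    have h2 : (FreeMonoid.toList s).count k ≤ (FreeMonoid.toList s).length := List.count_le_length
    have h3 : ((FreeMonoid.toList (σ (FreeMonoid.of g.2))).length : ℝ) ≤ L :=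
      Finset.single_le_sum (f := fun j => ((FreeMonoid.toList (σ (FreeMonoid.of j))).length : ℝ))
        (fun j _ => Nat.cast_nonneg _) (Finset.mem_univ g.2)
    have h4 : sx k = ((FreeMonoid.toList s).count k : ℝ) := by simp [sx, abelianization]
    rw [h4, Real.norm_eq_abs, abs_of_nonneg (Nat.cast_nonneg _)]
    refine le_trans ?_ h3
    exact_mod_cast h2.trans h1
  have hdecomp : incidenceMap σ y - x = A (y - gx) + sx + (fx - x) := by
    have : A (y - gx) = incidenceMap σ y - incidenceMap σ gx := map_sub (incidenceMap σ) _ _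
    rw [this, hM]
    abel
  rw [hdecomp]
  refine (norm_add_le _ _).trans (add_le_add ((norm_add_le _ _).trans (add_le_add ?_ hs)) ?_)
  · exact (A.le_opNorm _).trans (mul_le_of_le_one_right (norm_nonneg _) (Face.norm_sub_le hy))
  · rw [norm_sub_rev]
    exact Face.norm_sub_le hx

/-- The difference of corresponding points is `M^n π (M y - x)`, with `M y - x` bounded uniformly.
Every face has a child and every face of the next stage a parent, so both halves of the Hausdorff
distance are controlled. -/
theorem exists_hausdorffEDist_approximant_le {σ : Substitution} (hσ : IsUnimodular σ)
    {π : (Fin 3 → ℝ) →ₗ[ℝ] (Fin 3 → ℝ)}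
    (hcomm : ∀ x, incidenceMap σ (π x) = π (incidenceMap σ x)) {K ρ : ℝ} (hK : 0 ≤ K) (hρ : 0 ≤ ρ)
    (hdec : ∀ n x, ‖(incidenceMap σ ^ n) (π x)‖ ≤ K * ρ ^ n * ‖x‖) :
    ∃ C : ℝ, ∀ (Q : Set Face) (n : ℕ), Metric.hausdorffEDist (approximant σ π Q n)
      (approximant σ π Q (n + 1)) ≤ ENNReal.ofReal (C * ρ ^ n) := by
  obtain ⟨B, hB⟩ := exists_norm_incidenceMap_sub_le hσ
  refine ⟨K * B, fun Q n => ?_⟩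
  have key : ∀ (f g : Face) (p s : FreeMonoid (Fin 3)),
      σ (FreeMonoid.of g.2) = p * FreeMonoid.of f.2 * s →
      g.1 = (incidenceMatrix σ)⁻¹.mulVec (f.1 + abelianization s) →
      ∀ x ∈ f.toSet, ∀ y ∈ g.toSet, edist ((incidenceMap σ ^ n) (π x))
        ((incidenceMap σ ^ (n + 1)) (π y)) ≤ ENNReal.ofReal (K * B * ρ ^ n) := by
    intro f g p s hps hg x hx y hy
    rw [edist_dist]
    refine ENNReal.ofReal_le_ofReal ?_
    rw [dist_comm, dist_eq_norm, pow_succ, Module.End.mul_apply, hcomm, ← map_sub, ← map_sub]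
    refine (hdec n _).trans ?_
    have := hB f g p s hps hg x hx y hy
    calc K * ρ ^ n * ‖incidenceMap σ y - x‖ ≤ K * ρ ^ n * B := by gcongr
      _ = K * B * ρ ^ n := by ring
  have hsucc : (dualSubstitution σ)^[n + 1] Q = dualSubstitution σ ((dualSubstitution σ)^[n] Q) :=
    Function.iterate_succ_apply' _ _ _
  refine Metric.hausdorffEDist_le_of_mem_edist ?_ ?_
  · rintro _ ⟨_, ⟨x, hx, rfl⟩, rfl⟩
    obtain ⟨f, hf, hxf⟩ := Set.mem_iUnion₂.1 hx
    obtain ⟨g, p, s, hps, hg⟩ := dualSubstitution_nonempty_of_mem hσ f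
    obtain ⟨y, hy⟩ := g.toSet_nonempty
    refine ⟨_, ⟨_, ⟨y, Set.mem_iUnion₂.2 ⟨g, ?_, hy⟩, rfl⟩, rfl⟩, key f g p s hps hg x hxf y hy⟩
    rw [hsucc]
    exact ⟨f, hf, p, s, hps, hg⟩
  · rintro _ ⟨_, ⟨y, hy, rfl⟩, rfl⟩
    obtain ⟨g, hg, hyg⟩ := Set.mem_iUnion₂.1 hy
    rw [hsucc] at hg
    obtain ⟨f, hf, p, s, hps, hgf⟩ := hg
    obtain ⟨x, hx⟩ := f.toSet_nonempty
    refine ⟨_, ⟨_, ⟨x, Set.mem_iUnion₂.2 ⟨f, hf, hx⟩, rfl⟩, rfl⟩, ?_⟩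
    rw [edist_comm]
    exact key f g p s hps hgf x hx y hyg

theorem isBounded_approximant_zero (σ : Substitution) (π : (Fin 3 → ℝ) →ₗ[ℝ] (Fin 3 → ℝ))
    {Q : Set Face} (hQ : Q ⊆ unitPattern) : Bornology.IsBounded (approximant σ π Q 0) := by
  have h1 : (⋃ f ∈ Q, Face.toSet f) ⊆ Metric.closedBall 0 1 := by
    intro x hx
    obtain ⟨f, hf, hxf⟩ := Set.mem_iUnion₂.1 hx
    have h2 := Face.norm_sub_le hxf
    have h3 : f.1 = 0 := hQ hf
    rw [mem_closedBall_zero_iff]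
    have h4 : (fun k => (f.1 k : ℝ)) = 0 := by
      rw [h3]
      funext k
      simp
    rwa [h4, sub_zero] at h2
  have h2 : approximant σ π Q 0 = LinearMap.toContinuousLinearMap π '' (⋃ f ∈ Q, Face.toSet f) := by
    simp [approximant]
  rw [h2]
  exact (LinearMap.toContinuousLinearMap π).lipschitz.isBounded_image
    (Metric.isBounded_closedBall.subset h1)

theorem approximant_zero_nonempty (σ : Substitution) (π : (Fin 3 → ℝ) →ₗ[ℝ] (Fin 3 → ℝ))
    {Q : Set Face} (hQ : Q.Nonempty) : (approximant σ π Q 0).Nonempty := by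
  obtain ⟨f, hf⟩ := hQ
  obtain ⟨x, hx⟩ := f.toSet_nonempty
  exact ⟨_, _, ⟨x, Set.mem_iUnion₂.2 ⟨f, hf, hx⟩, rfl⟩, rfl⟩

/-! ### Dual substitutions -/

/-- The list `s` is what follows some occurrence of `i` in `l`. -/
def Follows (l : List (Fin 3)) (i : Fin 3) (s : List (Fin 3)) : Prop := ∃ p, l = p ++ i :: s

@[simp] theorem not_follows_nil (i : Fin 3) (s : List (Fin 3)) : ¬ Follows [] i s := by
  rintro ⟨p, hp⟩
  simp at hp

@[simp] theorem follows_cons (a : Fin 3) (l : List (Fin 3)) (i : Fin 3) (s : List (Fin 3)) :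
    Follows (a :: l) i s ↔ (a = i ∧ l = s) ∨ Follows l i s := by
  constructor
  · rintro ⟨p, hp⟩
    cases p with
    | nil =>
      left
      simpa using hp
    | cons b p =>
      right
      simp only [List.cons_append, List.cons.injEq] at hp
      exact ⟨p, hp.2⟩
  · rintro (⟨rfl, rfl⟩ | ⟨p, rfl⟩)
    · exact ⟨[], rfl⟩
    · exact ⟨a :: p, rfl⟩

theorem follows_append (l l' : List (Fin 3)) (i : Fin 3) (s : List (Fin 3)) :
    Follows (l ++ l') i s ↔ (∃ t, Follows l i t ∧ s = t ++ l') ∨ Follows l' i s := by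
  induction l with
  | nil => simp
  | cons a l ih =>
    rw [List.cons_append, follows_cons, ih]
    constructor
    · rintro (⟨rfl, rfl⟩ | ⟨t, ht, rfl⟩ | h)
      · exact Or.inl ⟨l, by simp, rfl⟩
      · exact Or.inl ⟨t, by simp [ht], rfl⟩
      · exact Or.inr h
    · rintro (⟨t, ht, rfl⟩ | h)
      · rcases (follows_cons _ _ _ _).1 ht with ⟨rfl, rfl⟩ | ht
        · exact Or.inl ⟨rfl, rfl⟩
        · exact Or.inr (Or.inl ⟨t, ht, rfl⟩)
      · exact Or.inr (Or.inr h)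

@[simp] theorem follows_replicate (n : ℕ) (a i : Fin 3) (s : List (Fin 3)) :
    Follows (List.replicate n a) i s ↔ a = i ∧ ∃ k < n, s = List.replicate k a := by
  induction n with
  | zero => simp
  | succ n ih =>
    rw [List.replicate_succ, follows_cons, ih]
    constructor
    · rintro (⟨h, rfl⟩ | ⟨h, k, hk, rfl⟩)
      · exact ⟨h, n, by omega, rfl⟩
      · exact ⟨h, k, by omega, rfl⟩
    · rintro ⟨h, k, hk, rfl⟩
      by_cases hkn : k = n
      · subst hkn
        exact Or.inl ⟨h, rfl⟩
      · exact Or.inr ⟨h, k, by omega, rfl⟩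

/-- Moving the inverse matrix to the other side leaves linear equations over the integers. -/
theorem mem_dualSubstitution_iff {σ : Substitution} (hσ : IsUnimodular σ) (S : Set Face) (g : Face) :
    g ∈ dualSubstitution σ S ↔ ∃ f ∈ S, ∃ s,
      Follows (FreeMonoid.toList (σ (FreeMonoid.of g.2))) f.2 s ∧
      (incidenceMatrix σ).mulVec g.1 = f.1 + abelianization (FreeMonoid.ofList s) := by
  have hM := isUnimodular_iff_isUnit.1 hσ
  have hinv : ∀ x : Fin 3 → ℤ,
      g.1 = (incidenceMatrix σ)⁻¹.mulVec x ↔ (incidenceMatrix σ).mulVec g.1 = x := by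
    intro x
    constructor
    · intro h
      rw [h, Matrix.mulVec_mulVec, Matrix.mul_nonsing_inv _ hM, Matrix.one_mulVec]
    · rintro rfl
      rw [Matrix.mulVec_mulVec, Matrix.nonsing_inv_mul _ hM, Matrix.one_mulVec]
  constructor
  · rintro ⟨f, hf, p, s, hps, hg⟩
    refine ⟨f, hf, FreeMonoid.toList s, ⟨FreeMonoid.toList p, ?_⟩, (hinv _).1 hg⟩
    rw [hps]
    simp [FreeMonoid.toList_mul]
  · rintro ⟨f, hf, s, ⟨p, hp⟩, hg⟩
    refine ⟨f, hf, FreeMonoid.ofList p, FreeMonoid.ofList s, ?_, (hinv _).2 hg⟩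
    apply FreeMonoid.toList.injective
    rw [hp]
    simp [FreeMonoid.toList_mul]

/-- An occurrence in `σ(w)` lies in the image of exactly one occurrence of a letter of `w`. -/
theorem follows_apply_iff (σ : Substitution) (w : List (Fin 3)) (i : Fin 3) (s : List (Fin 3)) :
    Follows (FreeMonoid.toList (σ (FreeMonoid.ofList w))) i s ↔ ∃ k t, Follows w k t ∧ ∃ u,
      Follows (FreeMonoid.toList (σ (FreeMonoid.of k))) i u ∧
      s = u ++ FreeMonoid.toList (σ (FreeMonoid.ofList t)) := by
  induction w with
  | nil => simp
  | cons j w ih =>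
    rw [FreeMonoid.ofList_cons, map_mul, FreeMonoid.toList_mul, follows_append, ih]
    constructor
    · rintro (⟨u, hu, rfl⟩ | ⟨k, t, hk, u, hu, rfl⟩)
      · exact ⟨j, w, by simp, u, hu, rfl⟩
      · exact ⟨k, t, by simp [hk], u, hu, rfl⟩
    · rintro ⟨k, t, hk, u, hu, rfl⟩
      rcases (follows_cons _ _ _ _).1 hk with ⟨rfl, rfl⟩ | hk
      · exact Or.inl ⟨u, hu, rfl⟩
      · exact Or.inr ⟨k, t, hk, u, hu, rfl⟩

/-- Duality reverses composition: what follows an occurrence in `σ(τ(j))` is `u σ(t)`, and its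
abelianization is `P(u) + M_σ P(t)`. This reduces products to the generators. -/
theorem dualSubstitution_mul {σ τ : Substitution} (hσ : IsUnimodular σ) (hτ : IsUnimodular τ)
    (S : Set Face) :
    dualSubstitution (σ * τ) S = dualSubstitution τ (dualSubstitution σ S) := by
  ext g
  rw [mem_dualSubstitution_iff (hσ.mul hτ), mem_dualSubstitution_iff hτ]
  have happ : (σ * τ) (FreeMonoid.of g.2) =
      σ (FreeMonoid.ofList (FreeMonoid.toList (τ (FreeMonoid.of g.2)))) := rfl
  constructor
  · rintro ⟨f, hf, s, hs, hg⟩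
    rw [happ, follows_apply_iff] at hs
    obtain ⟨k, t, ht, u, hu, rfl⟩ := hs
    refine ⟨((incidenceMatrix τ).mulVec g.1 - abelianization (FreeMonoid.ofList t), k), ?_, t, ht,
      by simp⟩
    rw [mem_dualSubstitution_iff hσ]
    refine ⟨f, hf, u, hu, ?_⟩
    rw [incidenceMatrix_mul, ← Matrix.mulVec_mulVec, FreeMonoid.ofList_append, abelianization_mul,
      FreeMonoid.ofList_toList, abelianization_apply] at hg
    rw [Matrix.mulVec_sub, hg]
    abel
  · rintro ⟨h, hh, t, ht, hg⟩
    rw [mem_dualSubstitution_iff hσ] at hh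
    obtain ⟨f, hf, u, hu, hh⟩ := hh
    refine ⟨f, hf, u ++ FreeMonoid.toList (σ (FreeMonoid.ofList t)), ?_, ?_⟩
    · rw [happ, follows_apply_iff]
      exact ⟨h.2, t, ht, u, hu, rfl⟩
    · rw [incidenceMatrix_mul, ← Matrix.mulVec_mulVec, hg, Matrix.mulVec_add, hh,
        FreeMonoid.ofList_append, abelianization_mul, FreeMonoid.ofList_toList,
        abelianization_apply]
      abel

theorem dualSubstitution_one (S : Set Face) : dualSubstitution 1 S = S := by
  ext g
  rw [mem_dualSubstitution_iff isUnimodular_one]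
  constructor
  · rintro ⟨f, hf, s, hs, hg⟩
    have h1 : g.2 = f.2 ∧ [] = s := by simpa using hs
    rw [incidenceMatrix_one, Matrix.one_mulVec, ← h1.2] at hg
    have h2 : g = f := Prod.ext (by simpa using hg) h1.1
    rwa [h2]
  · intro hg
    exact ⟨g, hg, [], by simp, by simp [incidenceMatrix_one]⟩

theorem dualSubstitution_mono (σ : Substitution) {S T : Set Face} (h : S ⊆ T) :
    dualSubstitution σ S ⊆ dualSubstitution σ T :=
  fun _ ⟨f, hf, H⟩ => ⟨f, h hf, H⟩

theorem dualSubstitution_insert (σ : Substitution) (f : Face) (S : Set Face) :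
    dualSubstitution σ (insert f S) = dualSubstitution σ {f} ∪ dualSubstitution σ S := by
  ext g
  constructor
  · rintro ⟨h, rfl | hh, H⟩
    · exact Or.inl ⟨h, rfl, H⟩
    · exact Or.inr ⟨h, hh, H⟩
  · rintro (⟨h, hh, H⟩ | ⟨h, hh, H⟩)
    · exact ⟨h, Or.inl hh, H⟩
    · exact ⟨h, Or.inr hh, H⟩

/-! ### Sets of faces connected by patterns -/

/-- Two faces lie in a common pattern of the family `L` that is contained in `S`. -/
def Linked (L : Set Face → Prop) (S : Set Face) (f g : Face) : Prop :=
  ∃ P, L P ∧ P ⊆ S ∧ f ∈ P ∧ g ∈ P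

/-- Two faces are connected by a chain of patterns of the family `L` contained in `S`. -/
def Reach (L : Set Face → Prop) (S : Set Face) : Face → Face → Prop :=
  Relation.ReflTransGen (Linked L S)

/-- Any two faces of `S` are connected by a chain of patterns of `L` contained in `S`. -/
def PatternConnected (L : Set Face → Prop) (S : Set Face) : Prop :=
  ∀ f ∈ S, ∀ g ∈ S, Reach L S f g

section

variable {L : Set Face → Prop} {S T : Set Face}

theorem Reach.symm {f g : Face} (h : Reach L S f g) : Reach L S g f := by
  have : Std.Symm (Linked L S) := ⟨fun _ _ ⟨P, hP, hS, hf, hg⟩ => ⟨P, hP, hS, hg, hf⟩⟩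
  exact (Relation.ReflTransGen.stdSymm (r := Linked L S)).symm _ _ h

theorem Reach.trans {f g h : Face} (h1 : Reach L S f g) (h2 : Reach L S g h) : Reach L S f h :=
  Relation.ReflTransGen.trans h1 h2

theorem Reach.mono (hST : S ⊆ T) {f g : Face} (h : Reach L S f g) : Reach L T f g :=
  Relation.ReflTransGen.mono (fun _ _ ⟨P, hP, hS, hf, hg⟩ => ⟨P, hP, hS.trans hST, hf, hg⟩) _ _ h

theorem Reach.of_pattern {P : Set Face} (hP : L P) (hS : P ⊆ S) {f g : Face} (hf : f ∈ P)
    (hg : g ∈ P) : Reach L S f g :=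
  Relation.ReflTransGen.single ⟨P, hP, hS, hf, hg⟩

theorem PatternConnected.of_base {f : Face} (h : ∀ g ∈ S, Reach L S f g) : PatternConnected L S :=
  fun a ha b hb => (h a ha).symm.trans (h b hb)

theorem patternConnected_singleton (f : Face) : PatternConnected L {f} := by
  rintro a rfl b rfl
  exact Relation.ReflTransGen.refl

theorem PatternConnected.of_pattern (h : L S) : PatternConnected L S :=
  fun _ hf _ hg => Reach.of_pattern h subset_rfl hf hg

theorem PatternConnected.union (hS : PatternConnected L S) (hT : PatternConnected L T) {f g : Face}
    (hf : f ∈ S) (hg : g ∈ T) (h : Reach L (S ∪ T) f g) : PatternConnected L (S ∪ T) := by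
  refine PatternConnected.of_base (f := f) ?_
  rintro a (ha | ha)
  · exact (hS f hf a ha).mono Set.subset_union_left
  · exact h.trans ((hT g hg a ha).mono Set.subset_union_right)

/-- A chain of patterns in `S` is mapped to a chain of connected sets, two successive ones
overlapping in the image of a shared face. It is therefore enough to check single faces and single
patterns. -/
theorem PatternConnected.dualSubstitution {σ : Substitution} (hσ : IsUnimodular σ)
    (hL : ∀ f, PatternConnected L (dualSubstitution σ {f}))
    (hL' : ∀ P, L P → PatternConnected L (dualSubstitution σ P)) (hS : PatternConnected L S) :
    PatternConnected L (dualSubstitution σ S) := by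
  have key : ∀ f ∈ S, ∀ g, Reach L S f g → g ∈ S →
      ∀ f' ∈ RauzyFractal.dualSubstitution σ {f}, ∀ g' ∈ RauzyFractal.dualSubstitution σ {g},
        Reach L (RauzyFractal.dualSubstitution σ S) f' g' := by
    intro f hf g hfg
    induction hfg with
    | refl =>
      intro _ f' hf' g' hg'
      exact (hL f f' hf' g' hg').mono (dualSubstitution_mono σ (Set.singleton_subset_iff.2 hf))
    | tail _ hst ih =>
      rename_i h g _
      intro _ f' hf' g' hg'
      obtain ⟨P, hP, hPS, hh, hg⟩ := hst
      -- The chain passes through the image of `h`, which must therefore be non-empty.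
      obtain ⟨h', p, s, hps, hh'⟩ := dualSubstitution_nonempty_of_mem hσ h
      have hmem : h' ∈ RauzyFractal.dualSubstitution σ {h} := ⟨h, rfl, p, s, hps, hh'⟩
      refine (ih (hPS hh) f' hf' h' hmem).trans ?_
      exact (hL' P hP h' (dualSubstitution_mono σ (Set.singleton_subset_iff.2 hh) hmem) g'
        (dualSubstitution_mono σ (Set.singleton_subset_iff.2 hg) hg')).mono
        (dualSubstitution_mono σ hPS)
  rintro f' ⟨f, hf, Hf⟩ g' ⟨g, hg, Hg⟩
  exact key f hf g (hS f hf g hg) hg f' ⟨f, rfl, Hf⟩ g' ⟨g, rfl, Hg⟩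

/-- Each face is a box, hence convex, and linked faces share the common point of their pattern. -/
theorem PatternConnected.isPreconnected
    (hL : ∀ P, L P → ∃ y : Fin 3 → ℝ, ∀ f ∈ P, y ∈ Face.toSet f) (hS : PatternConnected L S) :
    IsPreconnected (⋃ f ∈ S, Face.toSet f) := by
  refine IsPreconnected.biUnion_of_reflTransGen (fun f _ => ?_) fun f hf g hg => ?_
  · have h : f.toSet = Set.Icc (fun k => (f.1 k : ℝ))
        (fun k => f.1 k + if k = f.2 then 0 else 1) := by
      ext y
      rw [Set.mem_Icc, Pi.le_def, Pi.le_def]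
      constructor
      · rintro ⟨h1, h2⟩
        refine ⟨fun k => ?_, fun k => ?_⟩ <;> by_cases hk : k = f.2
        · rw [hk, h1]
        · exact (h2 k hk).1
        · rw [if_pos hk, hk, h1, add_zero]
        · rw [if_neg hk]
          exact (h2 k hk).2
      · rintro ⟨h1, h2⟩
        refine ⟨le_antisymm ?_ (h1 _), fun k hk => ⟨h1 k, ?_⟩⟩
        · simpa using h2 f.2
        · simpa [hk] using h2 k
    rw [h]
    exact (convex_Icc _ _).isPreconnected
  · refine Relation.ReflTransGen.mono ?_ _ _ (hS f hf g hg)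
    rintro a b ⟨P, hP, hPS, ha, hb⟩
    obtain ⟨y, hy⟩ := hL P hP
    exact ⟨⟨y, hy a ha, hy b hb⟩, hPS ha⟩

end

/-! ### Images of faces under the dual Brun and Jacobi-Perron substitutions -/

/-- The face of type `i` at the point `(a, b, c)`. -/
def face (a b c : ℤ) (i : Fin 3) : Face := (![a, b, c], i)

theorem face_eta (f : Face) : face (f.1 0) (f.1 1) (f.1 2) f.2 = f := by
  refine Prod.ext (funext fun k => ?_) rfl
  fin_cases k <;> rfl

theorem forall_fin_three {p : Fin 3 → Prop} : (∀ i, p i) ↔ p 0 ∧ p 1 ∧ p 2 := by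
  rw [Fin.forall_fin_succ, Fin.forall_fin_two]
  rfl

theorem mk_eq_face_iff (y : Fin 3 → ℤ) (j : Fin 3) (a b c : ℤ) (i : Fin 3) :
    ((y, j) : Face) = face a b c i ↔ (y 0 = a ∧ y 1 = b ∧ y 2 = c) ∧ j = i := by
  rw [face, Prod.mk.injEq, funext_iff, forall_fin_three]
  rfl

theorem mem_dualSubstitution_face_iff {σ : Substitution} (hσ : IsUnimodular σ) (a b c : ℤ)
    (i : Fin 3) (y : Fin 3 → ℤ) (j : Fin 3) :
    ((y, j) : Face) ∈ dualSubstitution σ {face a b c i} ↔ ∃ s,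
      Follows (FreeMonoid.toList (σ (FreeMonoid.of j))) i s ∧
      (incidenceMatrix σ).mulVec y 0 = a + s.count 0 ∧
      (incidenceMatrix σ).mulVec y 1 = b + s.count 1 ∧
      (incidenceMatrix σ).mulVec y 2 = c + s.count 2 := by
  rw [mem_dualSubstitution_iff hσ]
  simp only [Set.mem_singleton_iff, exists_eq_left, funext_iff, forall_fin_three]
  rfl

theorem brun_zero_of (j : Fin 3) :
    brun 0 (FreeMonoid.of j) = FreeMonoid.ofList (![[0], [1], [2, 1]] j) :=
  ofWords_of _ _ _ _

theorem brun_one_of (j : Fin 3) :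
    brun 1 (FreeMonoid.of j) = FreeMonoid.ofList (![[0], [2], [1, 2]] j) :=
  ofWords_of _ _ _ _

theorem brun_two_of (j : Fin 3) :
    brun 2 (FreeMonoid.of j) = FreeMonoid.ofList (![[1], [2], [0, 2]] j) :=
  ofWords_of _ _ _ _

theorem dualSubstitution_brun_zero_zero (a b c : ℤ) :
    dualSubstitution (brun 0) {face a b c 0} = {face a (b - c) c 0} := by
  ext ⟨y, j⟩
  rw [mem_dualSubstitution_face_iff (isUnimodular_brun 0), Set.mem_singleton_iff, mk_eq_face_iff,
    incidenceMatrix_brun_zero, brun_zero_of]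
  fin_cases j <;> simp [Matrix.mulVec, dotProduct, Fin.sum_univ_three]
  omega

theorem dualSubstitution_brun_zero_one (a b c : ℤ) :
    dualSubstitution (brun 0) {face a b c 1} = {face a (b - c) c 1, face a (b - c) c 2} := by
  ext ⟨y, j⟩
  rw [mem_dualSubstitution_face_iff (isUnimodular_brun 0), Set.mem_insert_iff,
    Set.mem_singleton_iff, mk_eq_face_iff, mk_eq_face_iff,
    incidenceMatrix_brun_zero, brun_zero_of]
  fin_cases j <;> simp [Matrix.mulVec, dotProduct, Fin.sum_univ_three] <;> omega

theorem dualSubstitution_brun_zero_two (a b c : ℤ) :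
    dualSubstitution (brun 0) {face a b c 2} = {face a (b - c + 1) c 2} := by
  ext ⟨y, j⟩
  rw [mem_dualSubstitution_face_iff (isUnimodular_brun 0), Set.mem_singleton_iff, mk_eq_face_iff,
    incidenceMatrix_brun_zero, brun_zero_of]
  fin_cases j <;> simp [Matrix.mulVec, dotProduct, Fin.sum_univ_three]
  omega

theorem dualSubstitution_brun_one_zero (a b c : ℤ) :
    dualSubstitution (brun 1) {face a b c 0} = {face a (c - b) b 0} := by
  ext ⟨y, j⟩
  rw [mem_dualSubstitution_face_iff (isUnimodular_brun 1), Set.mem_singleton_iff, mk_eq_face_iff,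
    incidenceMatrix_brun_one, brun_one_of]
  fin_cases j <;> simp [Matrix.mulVec, dotProduct, Fin.sum_univ_three]
  omega

theorem dualSubstitution_brun_one_one (a b c : ℤ) :
    dualSubstitution (brun 1) {face a b c 1} = {face a (c - b + 1) b 2} := by
  ext ⟨y, j⟩
  rw [mem_dualSubstitution_face_iff (isUnimodular_brun 1), Set.mem_singleton_iff, mk_eq_face_iff,
    incidenceMatrix_brun_one, brun_one_of]
  fin_cases j <;> simp [Matrix.mulVec, dotProduct, Fin.sum_univ_three]
  omega

theorem dualSubstitution_brun_one_two (a b c : ℤ) :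
    dualSubstitution (brun 1) {face a b c 2} = {face a (c - b) b 1, face a (c - b) b 2} := by
  ext ⟨y, j⟩
  rw [mem_dualSubstitution_face_iff (isUnimodular_brun 1), Set.mem_insert_iff,
    Set.mem_singleton_iff, mk_eq_face_iff, mk_eq_face_iff,
    incidenceMatrix_brun_one, brun_one_of]
  fin_cases j <;> simp [Matrix.mulVec, dotProduct, Fin.sum_univ_three] <;> omega

theorem dualSubstitution_brun_two_zero (a b c : ℤ) :
    dualSubstitution (brun 2) {face a b c 0} = {face b (c - a + 1) a 2} := by
  ext ⟨y, j⟩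
  rw [mem_dualSubstitution_face_iff (isUnimodular_brun 2), Set.mem_singleton_iff, mk_eq_face_iff,
    incidenceMatrix_brun_two, brun_two_of]
  fin_cases j <;> simp [Matrix.mulVec, dotProduct, Fin.sum_univ_three]
  omega

theorem dualSubstitution_brun_two_one (a b c : ℤ) :
    dualSubstitution (brun 2) {face a b c 1} = {face b (c - a) a 0} := by
  ext ⟨y, j⟩
  rw [mem_dualSubstitution_face_iff (isUnimodular_brun 2), Set.mem_singleton_iff, mk_eq_face_iff,
    incidenceMatrix_brun_two, brun_two_of]
  fin_cases j <;> simp [Matrix.mulVec, dotProduct, Fin.sum_univ_three]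
  omega

theorem dualSubstitution_brun_two_two (a b c : ℤ) :
    dualSubstitution (brun 2) {face a b c 2} = {face b (c - a) a 1, face b (c - a) a 2} := by
  ext ⟨y, j⟩
  rw [mem_dualSubstitution_face_iff (isUnimodular_brun 2), Set.mem_insert_iff,
    Set.mem_singleton_iff, mk_eq_face_iff, mk_eq_face_iff,
    incidenceMatrix_brun_two, brun_two_of]
  fin_cases j <;> simp [Matrix.mulVec, dotProduct, Fin.sum_univ_three] <;> omega

theorem jacobiPerron_of (a b : ℕ) (j : Fin 3) :
    jacobiPerron a b (FreeMonoid.of j) =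
      FreeMonoid.ofList (![[2], 0 :: List.replicate a 2, 1 :: List.replicate b 2] j) :=
  ofWords_of _ _ _ _

theorem dualSubstitution_jacobiPerron_zero (a b : ℕ) (x y z : ℤ) :
    dualSubstitution (jacobiPerron a b) {face x y z 0} =
      {face (z - a * x - b * y + a) x y 1} := by
  ext ⟨u, j⟩
  rw [mem_dualSubstitution_face_iff (isUnimodular_jacobiPerron a b), Set.mem_singleton_iff,
    mk_eq_face_iff, incidenceMatrix_jacobiPerron, jacobiPerron_of]
  fin_cases j
  · simp
  · simp [Matrix.mulVec, dotProduct, Fin.sum_univ_three, List.count_replicate]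
    constructor
    · rintro ⟨h1, h2, h3⟩
      rw [h1, h2] at h3
      exact ⟨by linarith, h1, h2⟩
    · rintro ⟨h1, h2, h3⟩
      rw [h1, h2, h3]
      exact ⟨rfl, rfl, by ring⟩
  · simp

theorem dualSubstitution_jacobiPerron_one (a b : ℕ) (x y z : ℤ) :
    dualSubstitution (jacobiPerron a b) {face x y z 1} =
      {face (z - a * x - b * y + b) x y 2} := by
  ext ⟨u, j⟩
  rw [mem_dualSubstitution_face_iff (isUnimodular_jacobiPerron a b), Set.mem_singleton_iff,
    mk_eq_face_iff, incidenceMatrix_jacobiPerron, jacobiPerron_of]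
  fin_cases j
  · simp
  · simp
  · simp [Matrix.mulVec, dotProduct, Fin.sum_univ_three, List.count_replicate]
    constructor
    · rintro ⟨h1, h2, h3⟩
      rw [h1, h2] at h3
      exact ⟨by linarith, h1, h2⟩
    · rintro ⟨h1, h2, h3⟩
      rw [h1, h2, h3]
      exact ⟨rfl, rfl, by ring⟩

/-- The image of a face of type `2` under the dual of a Jacobi-Perron substitution. -/
def column (a b : ℕ) (m x y : ℤ) : Set Face :=
  {g | g = face m x y 0 ∨ (∃ k < a, g = face (m + (k : ℕ)) x y 1) ∨
    ∃ k < b, g = face (m + (k : ℕ)) x y 2}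

theorem dualSubstitution_jacobiPerron_two (a b : ℕ) (x y z : ℤ) :
    dualSubstitution (jacobiPerron a b) {face x y z 2} = column a b (z - a * x - b * y) x y := by
  ext ⟨u, j⟩
  rw [mem_dualSubstitution_face_iff (isUnimodular_jacobiPerron a b), column, Set.mem_ofPred_eq,
    incidenceMatrix_jacobiPerron, jacobiPerron_of]
  simp only [mk_eq_face_iff]
  fin_cases j
  · simp [Matrix.mulVec, dotProduct, Fin.sum_univ_three]
    constructor
    · rintro ⟨h1, h2, h3⟩
      rw [h1, h2] at h3
      exact ⟨by linarith, h1, h2⟩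
    · rintro ⟨h1, h2, h3⟩
      rw [h1, h2, h3]
      exact ⟨rfl, rfl, by ring⟩
  · simp [Matrix.mulVec, dotProduct, Fin.sum_univ_three, List.count_replicate]
    constructor
    · rintro ⟨k, hk, h1, h2, h3⟩
      rw [h1, h2] at h3
      exact ⟨k, hk, by linarith, h1, h2⟩
    · rintro ⟨k, hk, h1, h2, h3⟩
      refine ⟨k, hk, h2, h3, ?_⟩
      rw [h1, h2, h3]
      ring
  · simp [Matrix.mulVec, dotProduct, Fin.sum_univ_three, List.count_replicate]
    constructor
    · rintro ⟨k, hk, h1, h2, h3⟩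
      rw [h1, h2] at h3
      exact ⟨k, hk, by linarith, h1, h2⟩
    · rintro ⟨k, hk, h1, h2, h3⟩
      refine ⟨k, hk, h2, h3, ?_⟩
      rw [h1, h2, h3]
      ring

theorem zero_mem_column (a b : ℕ) (m x y : ℤ) : face m x y 0 ∈ column a b m x y := Or.inl rfl

theorem one_mem_column {a b : ℕ} {m x y k : ℤ} (h : m ≤ k) (h' : k < m + a) :
    face k x y 1 ∈ column a b m x y :=
  Or.inr (Or.inl ⟨(k - m).toNat, by omega, congrArg (face · x y 1) (by omega)⟩)

theorem two_mem_column {a b : ℕ} {m x y k : ℤ} (h : m ≤ k) (h' : k < m + b) :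
    face k x y 2 ∈ column a b m x y :=
  Or.inr (Or.inr ⟨(k - m).toNat, by omega, congrArg (face · x y 2) (by omega)⟩)

/-! ### Patterns -/

/-- The connecting patterns for the Brun (`jp = False`) and the Jacobi-Perron (`jp = True`)
substitutions. -/
inductive IsPattern (jp : Prop) : Set Face → Prop
  | corner (a b c : ℤ) : IsPattern jp {face a b c 0, face a b c 1, face a b c 2}
  | edge₂₃ (a b c : ℤ) : IsPattern jp {face a b c 1, face a b c 2}
  | flat₁₂ (a b c : ℤ) : IsPattern jp {face a b c 0, face (a - 1) (b + 1) c 1}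
  | flat₁₃ (a b c : ℤ) : IsPattern jp {face a b c 0, face (a - 1) b (c + 1) 2}
  | flat₂₃ (a b c : ℤ) : IsPattern jp {face a b c 1, face a (b - 1) (c + 1) 2}
  | shift₁ (a b c : ℤ) : IsPattern jp {face a b c 2, face (a + 1) b c 2}
  | shift₂ (a b c : ℤ) : IsPattern jp {face a b c 2, face a (b + 1) c 2}
  | edge₁₃ (h : jp) (a b c : ℤ) : IsPattern jp {face a b c 0, face a b c 2}
  | step (h : jp) (a b c : ℤ) : IsPattern jp {face a b c 1, face a b c 2, face (a + 1) b c 1}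

theorem mem_toSet_face_iff (a b c : ℤ) (i : Fin 3) (y : Fin 3 → ℝ) :
    y ∈ (face a b c i).toSet ↔ y i = (![a, b, c] : Fin 3 → ℤ) i ∧
      (0 ≠ i → a ≤ y 0 ∧ y 0 ≤ a + 1) ∧ (1 ≠ i → b ≤ y 1 ∧ y 1 ≤ b + 1) ∧
      (2 ≠ i → c ≤ y 2 ∧ y 2 ≤ c + 1) := by
  change _ ∧ (∀ k, _) ↔ _
  rw [forall_fin_three]
  rfl

theorem IsPattern.exists_mem {jp : Prop} {P : Set Face} (h : IsPattern jp P) :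
    ∃ y : Fin 3 → ℝ, ∀ f ∈ P, y ∈ f.toSet := by
  cases h with
  | corner a b c => exact ⟨![a, b, c], by simp [mem_toSet_face_iff]⟩
  | edge₂₃ a b c => exact ⟨![a, b, c], by simp [mem_toSet_face_iff]⟩
  | flat₁₂ a b c => exact ⟨![a, b + 1, c], by simp [mem_toSet_face_iff]⟩
  | flat₁₃ a b c => exact ⟨![a, b, c + 1], by simp [mem_toSet_face_iff]⟩
  | flat₂₃ a b c => exact ⟨![a, b, c + 1], by simp [mem_toSet_face_iff]⟩
  | shift₁ a b c => exact ⟨![a + 1, b, c], by simp [mem_toSet_face_iff]⟩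
  | shift₂ a b c => exact ⟨![a, b + 1, c], by simp [mem_toSet_face_iff]⟩
  | edge₁₃ h a b c => exact ⟨![a, b, c], by simp [mem_toSet_face_iff]⟩
  | step h a b c => exact ⟨![a + 1, b, c], by simp [mem_toSet_face_iff]⟩

/-- The second face has free coordinates, matched by the default `ring` proofs, so that coordinates
can be used in the form in which the dual substitutions produce them. The next four lemmas do the
same. -/
theorem isPattern_flat₁₂ {jp : Prop} {a b c a' b' c' : ℤ} (ha : a' = a - 1 := by ring)
    (hb : b' = b + 1 := by ring) (hc : c' = c := by ring) :
    IsPattern jp {face a b c 0, face a' b' c' 1} := by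
  rw [ha, hb, hc]
  exact IsPattern.flat₁₂ a b c

theorem isPattern_flat₁₃ {jp : Prop} {a b c a' b' c' : ℤ} (ha : a' = a - 1 := by ring)
    (hb : b' = b := by ring) (hc : c' = c + 1 := by ring) :
    IsPattern jp {face a b c 0, face a' b' c' 2} := by
  rw [ha, hb, hc]
  exact IsPattern.flat₁₃ a b c

theorem isPattern_flat₂₃ {jp : Prop} {a b c a' b' c' : ℤ} (ha : a' = a := by ring)
    (hb : b' = b - 1 := by ring) (hc : c' = c + 1 := by ring) :
    IsPattern jp {face a b c 1, face a' b' c' 2} := by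
  rw [ha, hb, hc]
  exact IsPattern.flat₂₃ a b c

theorem isPattern_shift₁ {jp : Prop} {a b c a' b' c' : ℤ} (ha : a' = a + 1 := by ring)
    (hb : b' = b := by ring) (hc : c' = c := by ring) :
    IsPattern jp {face a b c 2, face a' b' c' 2} := by
  rw [ha, hb, hc]
  exact IsPattern.shift₁ a b c

theorem isPattern_shift₂ {jp : Prop} {a b c a' b' c' : ℤ} (ha : a' = a := by ring)
    (hb : b' = b + 1 := by ring) (hc : c' = c := by ring) :
    IsPattern jp {face a b c 2, face a' b' c' 2} := by
  rw [ha, hb, hc]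
  exact IsPattern.shift₂ a b c

theorem PatternConnected.union_pair {L : Set Face → Prop} {S T : Set Face}
    (hS : PatternConnected L S) (hT : PatternConnected L T) {f g : Face} (hf : f ∈ S) (hg : g ∈ T)
    (h : L {f, g}) : PatternConnected L (S ∪ T) :=
  hS.union hT hf hg (Reach.of_pattern h (Set.pair_subset (Or.inl hf) (Or.inr hg))
    (Set.mem_insert _ _) (Set.mem_insert_of_mem _ rfl))

theorem PatternConnected.union_pair' {L : Set Face → Prop} {S T : Set Face}
    (hS : PatternConnected L S) (hT : PatternConnected L T) {f g : Face} (hf : f ∈ S) (hg : g ∈ T)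
    (h : L {g, f}) : PatternConnected L (S ∪ T) :=
  hS.union_pair hT hf hg (Set.pair_comm g f ▸ h)

theorem patternConnected_edge₂₃ {jp : Prop} (a b c : ℤ) :
    PatternConnected (IsPattern jp) {face a b c 1, face a b c 2} :=
  PatternConnected.of_pattern (IsPattern.edge₂₃ a b c)

theorem dualSubstitution_pair (σ : Substitution) (f g : Face) :
    dualSubstitution σ {f, g} = dualSubstitution σ {f} ∪ dualSubstitution σ {g} :=
  dualSubstitution_insert σ f {g}

theorem dualSubstitution_triple (σ : Substitution) (f g h : Face) :
    dualSubstitution σ {f, g, h} =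
      dualSubstitution σ {f} ∪ (dualSubstitution σ {g} ∪ dualSubstitution σ {h}) := by
  rw [dualSubstitution_insert, dualSubstitution_pair]

/-! ### Brun substitutions preserve connectedness by patterns -/

theorem patternConnected_brun_zero (f : Face) :
    PatternConnected (IsPattern False) (dualSubstitution (brun 0) {f}) := by
  obtain ⟨a, b, c, i, rfl⟩ : ∃ a b c i, f = face a b c i := ⟨_, _, _, _, (face_eta f).symm⟩
  fin_cases i
  · exact dualSubstitution_brun_zero_zero a b c ▸ patternConnected_singleton _
  · exact dualSubstitution_brun_zero_one a b c ▸ patternConnected_edge₂₃ _ _ _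
  · exact dualSubstitution_brun_zero_two a b c ▸ patternConnected_singleton _

theorem patternConnected_brun_one (f : Face) :
    PatternConnected (IsPattern False) (dualSubstitution (brun 1) {f}) := by
  obtain ⟨a, b, c, i, rfl⟩ : ∃ a b c i, f = face a b c i := ⟨_, _, _, _, (face_eta f).symm⟩
  fin_cases i
  · exact dualSubstitution_brun_one_zero a b c ▸ patternConnected_singleton _
  · exact dualSubstitution_brun_one_one a b c ▸ patternConnected_singleton _
  · exact dualSubstitution_brun_one_two a b c ▸ patternConnected_edge₂₃ _ _ _

theorem patternConnected_brun_two (f : Face) :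
    PatternConnected (IsPattern False) (dualSubstitution (brun 2) {f}) := by
  obtain ⟨a, b, c, i, rfl⟩ : ∃ a b c i, f = face a b c i := ⟨_, _, _, _, (face_eta f).symm⟩
  fin_cases i
  · exact dualSubstitution_brun_two_zero a b c ▸ patternConnected_singleton _
  · exact dualSubstitution_brun_two_one a b c ▸ patternConnected_singleton _
  · exact dualSubstitution_brun_two_two a b c ▸ patternConnected_edge₂₃ _ _ _

theorem patternConnected_brun_zero_of_isPattern {P : Set Face} (hP : IsPattern False P) :
    PatternConnected (IsPattern False) (dualSubstitution (brun 0) P) := by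
  have h := patternConnected_brun_zero
  cases hP with
  | corner a b c =>
    -- The images of the faces of types `0` and `1` together form a corner; the image of the third
    -- face is attached by a `shift₂`.
    have h12 := (h (face a b c 1)).union_pair (h (face a b c 2)) (f := face a (b - c) c 2)
      (g := face a (b - c + 1) c 2) (by simp [dualSubstitution_brun_zero_one])
      (by simp [dualSubstitution_brun_zero_two]) isPattern_shift₂
    rw [dualSubstitution_triple]
    refine (h (face a b c 0)).union h12 (f := face a (b - c) c 0) (g := face a (b - c) c 1)
      (by simp [dualSubstitution_brun_zero_zero])
      (Or.inl (by simp [dualSubstitution_brun_zero_one]))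
      (Reach.of_pattern (IsPattern.corner a (b - c) c) ?_ (by simp) (by simp))
    rintro _ (rfl | rfl | rfl)
    · exact Or.inl (by simp [dualSubstitution_brun_zero_zero])
    · exact Or.inr (Or.inl (by simp [dualSubstitution_brun_zero_one]))
    · exact Or.inr (Or.inl (by simp [dualSubstitution_brun_zero_one]))
  | edge₂₃ a b c =>
    rw [dualSubstitution_pair]
    exact (h _).union_pair (h _) (f := face a (b - c) c 2)
      (g := face a (b - c + 1) c 2) (by simp [dualSubstitution_brun_zero_one])
      (by simp [dualSubstitution_brun_zero_two]) isPattern_shift₂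
  | flat₁₂ a b c =>
    rw [dualSubstitution_pair]
    exact (h _).union_pair (h _) (f := face a (b - c) c 0)
      (g := face (a - 1) (b + 1 - c) c 1) (by simp [dualSubstitution_brun_zero_zero])
      (by simp [dualSubstitution_brun_zero_one]) isPattern_flat₁₂
  | flat₁₃ a b c =>
    rw [dualSubstitution_pair]
    exact (h _).union_pair (h _) (f := face a (b - c) c 0)
      (g := face (a - 1) (b - (c + 1) + 1) (c + 1) 2) (by simp [dualSubstitution_brun_zero_zero])
      (by simp [dualSubstitution_brun_zero_two]) isPattern_flat₁₃
  | flat₂₃ a b c =>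
    rw [dualSubstitution_pair]
    exact (h _).union_pair (h _) (f := face a (b - c) c 1)
      (g := face a (b - 1 - (c + 1) + 1) (c + 1) 2) (by simp [dualSubstitution_brun_zero_one])
      (by simp [dualSubstitution_brun_zero_two]) isPattern_flat₂₃
  | shift₁ a b c =>
    rw [dualSubstitution_pair]
    exact (h _).union_pair (h _) (f := face a (b - c + 1) c 2)
      (g := face (a + 1) (b - c + 1) c 2) (by simp [dualSubstitution_brun_zero_two])
      (by simp [dualSubstitution_brun_zero_two]) isPattern_shift₁
  | shift₂ a b c =>
    rw [dualSubstitution_pair]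
    exact (h _).union_pair (h _) (f := face a (b - c + 1) c 2)
      (g := face a (b + 1 - c + 1) c 2) (by simp [dualSubstitution_brun_zero_two])
      (by simp [dualSubstitution_brun_zero_two]) isPattern_shift₂
  | edge₁₃ h => exact h.elim
  | step h => exact h.elim

theorem patternConnected_brun_one_of_isPattern {P : Set Face} (hP : IsPattern False P) :
    PatternConnected (IsPattern False) (dualSubstitution (brun 1) P) := by
  have h := patternConnected_brun_one
  cases hP with
  | corner a b c =>
    have h12 := (h (face a b c 1)).union_pair' (h (face a b c 2)) (f := face a (c - b + 1) b 2)
      (g := face a (c - b) b 2) (by simp [dualSubstitution_brun_one_one])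
      (by simp [dualSubstitution_brun_one_two]) isPattern_shift₂
    rw [dualSubstitution_triple]
    refine (h (face a b c 0)).union h12 (f := face a (c - b) b 0) (g := face a (c - b) b 1)
      (by simp [dualSubstitution_brun_one_zero])
      (Or.inr (by simp [dualSubstitution_brun_one_two]))
      (Reach.of_pattern (IsPattern.corner a (c - b) b) ?_ (by simp) (by simp))
    rintro _ (rfl | rfl | rfl)
    · exact Or.inl (by simp [dualSubstitution_brun_one_zero])
    · exact Or.inr (Or.inr (by simp [dualSubstitution_brun_one_two]))
    · exact Or.inr (Or.inr (by simp [dualSubstitution_brun_one_two]))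
  | edge₂₃ a b c =>
    rw [dualSubstitution_pair]
    exact (h _).union_pair' (h _) (f := face a (c - b + 1) b 2)
      (g := face a (c - b) b 2) (by simp [dualSubstitution_brun_one_one])
      (by simp [dualSubstitution_brun_one_two]) isPattern_shift₂
  | flat₁₂ a b c =>
    rw [dualSubstitution_pair]
    exact (h _).union_pair (h _) (f := face a (c - b) b 0)
      (g := face (a - 1) (c - (b + 1) + 1) (b + 1) 2) (by simp [dualSubstitution_brun_one_zero])
      (by simp [dualSubstitution_brun_one_one]) isPattern_flat₁₃
  | flat₁₃ a b c =>
    rw [dualSubstitution_pair]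
    exact (h _).union_pair (h _) (f := face a (c - b) b 0)
      (g := face (a - 1) (c + 1 - b) b 1) (by simp [dualSubstitution_brun_one_zero])
      (by simp [dualSubstitution_brun_one_two]) isPattern_flat₁₂
  | flat₂₃ a b c =>
    rw [dualSubstitution_pair]
    exact (h _).union_pair' (h _) (f := face a (c - b + 1) b 2)
      (g := face a (c + 1 - (b - 1)) (b - 1) 1) (by simp [dualSubstitution_brun_one_one])
      (by simp [dualSubstitution_brun_one_two]) isPattern_flat₂₃
  | shift₁ a b c =>
    rw [dualSubstitution_pair]
    exact (h _).union_pair (h _) (f := face a (c - b) b 2)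
      (g := face (a + 1) (c - b) b 2) (by simp [dualSubstitution_brun_one_two])
      (by simp [dualSubstitution_brun_one_two]) isPattern_shift₁
  | shift₂ a b c =>
    rw [dualSubstitution_pair]
    exact (h _).union_pair (h _) (f := face a (c - b) b 1)
      (g := face a (c - (b + 1)) (b + 1) 2) (by simp [dualSubstitution_brun_one_two])
      (by simp [dualSubstitution_brun_one_two]) isPattern_flat₂₃
  | edge₁₃ h => exact h.elim
  | step h => exact h.elim

theorem patternConnected_brun_two_of_isPattern {P : Set Face} (hP : IsPattern False P) :
    PatternConnected (IsPattern False) (dualSubstitution (brun 2) P) := by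
  have h := patternConnected_brun_two
  -- The images of the two faces of an `edge₂₃` make up exactly one corner.
  have key : ∀ a b c, PatternConnected (IsPattern False)
      (dualSubstitution (brun 2) {face a b c 1} ∪ dualSubstitution (brun 2) {face a b c 2}) := by
    intro a b c
    rw [dualSubstitution_brun_two_one, dualSubstitution_brun_two_two, Set.singleton_union]
    exact PatternConnected.of_pattern (IsPattern.corner _ _ _)
  cases hP with
  | corner a b c =>
    rw [dualSubstitution_triple]
    exact (h (face a b c 0)).union_pair' (key a b c) (f := face b (c - a + 1) a 2)
      (g := face b (c - a) a 2) (by simp [dualSubstitution_brun_two_zero])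
      (Or.inr (by simp [dualSubstitution_brun_two_two])) isPattern_shift₂
  | edge₂₃ a b c =>
    rw [dualSubstitution_pair]
    exact key a b c
  | flat₁₂ a b c =>
    rw [dualSubstitution_pair]
    exact (h _).union_pair' (h _) (f := face b (c - a + 1) a 2)
      (g := face (b + 1) (c - (a - 1)) (a - 1) 0) (by simp [dualSubstitution_brun_two_zero])
      (by simp [dualSubstitution_brun_two_one]) isPattern_flat₁₃
  | flat₁₃ a b c =>
    rw [dualSubstitution_pair]
    exact (h _).union_pair' (h _) (f := face b (c - a + 1) a 2)
      (g := face b (c + 1 - (a - 1)) (a - 1) 1) (by simp [dualSubstitution_brun_two_zero])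
      (by simp [dualSubstitution_brun_two_two]) isPattern_flat₂₃
  | flat₂₃ a b c =>
    rw [dualSubstitution_pair]
    exact (h _).union_pair (h _) (f := face b (c - a) a 0)
      (g := face (b - 1) (c + 1 - a) a 1) (by simp [dualSubstitution_brun_two_one])
      (by simp [dualSubstitution_brun_two_two]) isPattern_flat₁₂
  | shift₁ a b c =>
    rw [dualSubstitution_pair]
    exact (h _).union_pair (h _) (f := face b (c - a) a 1)
      (g := face b (c - (a + 1)) (a + 1) 2) (by simp [dualSubstitution_brun_two_two])
      (by simp [dualSubstitution_brun_two_two]) isPattern_flat₂₃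
  | shift₂ a b c =>
    rw [dualSubstitution_pair]
    exact (h _).union_pair (h _) (f := face b (c - a) a 2)
      (g := face (b + 1) (c - a) a 2) (by simp [dualSubstitution_brun_two_two])
      (by simp [dualSubstitution_brun_two_two]) isPattern_shift₁
  | edge₁₃ h => exact h.elim
  | step h => exact h.elim

theorem PatternConnected.brun (i : Fin 3) {S : Set Face} (hS : PatternConnected (IsPattern False) S) :
    PatternConnected (IsPattern False) (RauzyFractal.dualSubstitution (brun i) S) := by
  fin_cases i
  · exact hS.dualSubstitution (isUnimodular_brun 0) patternConnected_brun_zero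
      fun _ => patternConnected_brun_zero_of_isPattern
  · exact hS.dualSubstitution (isUnimodular_brun 1) patternConnected_brun_one
      fun _ => patternConnected_brun_one_of_isPattern
  · exact hS.dualSubstitution (isUnimodular_brun 2) patternConnected_brun_two
      fun _ => patternConnected_brun_two_of_isPattern

/-! ### Jacobi-Perron substitutions preserve connectedness by patterns -/

section

variable {a b : ℕ}

theorem Reach.of_pair {L : Set Face → Prop} {S : Set Face} {f g : Face} (hf : f ∈ S) (hg : g ∈ S)
    (h : L {f, g}) : Reach L S f g :=
  Reach.of_pattern h (Set.pair_subset hf hg) (Set.mem_insert _ _) (Set.mem_insert_of_mem _ rfl)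

/-- The faces of type `2` form a non-empty row linked by `shift₁` and joined to the face of type `0`
at its start. Since `a ≤ b`, each face of type `1` has a face of type `2` at the same point. -/
theorem patternConnected_column (hab : a ≤ b) (hb : b ≠ 0) (m x y : ℤ) :
    PatternConnected (IsPattern True) (column a b m x y) := by
  have hb' : 0 < b := Nat.pos_of_ne_zero hb
  have two : ∀ k : ℕ, k < b →
      Reach (IsPattern True) (column a b m x y) (face m x y 0) (face (m + k) x y 2) := by
    intro k
    induction k with
    | zero =>
      intro _
      refine Reach.of_pair (zero_mem_column _ _ _ _ _) (two_mem_column (by omega) (by omega)) ?_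
      rw [Nat.cast_zero, add_zero]
      exact IsPattern.edge₁₃ trivial _ _ _
    | succ k ih =>
      intro hk
      refine (ih (by omega)).trans (Reach.of_pair (two_mem_column (by omega) (by omega))
        (two_mem_column (by omega) (by omega)) (isPattern_shift₁ ?_))
      push_cast
      ring
  refine PatternConnected.of_base (f := face m x y 0) ?_
  rintro g (rfl | ⟨k, hk, rfl⟩ | ⟨k, hk, rfl⟩)
  · exact Relation.ReflTransGen.refl
  · exact (two k (by omega)).trans (Reach.of_pair (one_mem_column (by omega) (by omega))
      (two_mem_column (by omega) (by omega)) (IsPattern.edge₂₃ _ _ _)).symm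
  · exact two k hk

theorem patternConnected_jacobiPerron (hab : a ≤ b) (hb : b ≠ 0) (f : Face) :
    PatternConnected (IsPattern True) (dualSubstitution (jacobiPerron a b) {f}) := by
  obtain ⟨x, y, z, i, rfl⟩ : ∃ x y z i, f = face x y z i := ⟨_, _, _, _, (face_eta f).symm⟩
  fin_cases i
  · exact dualSubstitution_jacobiPerron_zero a b x y z ▸ patternConnected_singleton _
  · exact dualSubstitution_jacobiPerron_one a b x y z ▸ patternConnected_singleton _
  · exact dualSubstitution_jacobiPerron_two a b x y z ▸ patternConnected_column hab hb _ _ _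

/-- The extra face continues the row of type `2` by one step; this union is the image of an
`edge₂₃`. -/
theorem patternConnected_singleton_union_column (hab : a ≤ b) (hb : b ≠ 0) (m x y : ℤ) :
    PatternConnected (IsPattern True) ({face (m + b) x y 2} ∪ column a b m x y) :=
  (patternConnected_singleton _).union_pair' (patternConnected_column hab hb m x y)
    (f := face (m + b) x y 2) (g := face (m + b - 1) x y 2) rfl
    (two_mem_column (by omega) (by omega)) isPattern_shift₁

theorem patternConnected_jacobiPerron_of_isPattern (hab : a ≤ b) (hb : b ≠ 0) {P : Set Face}
    (hP : IsPattern True P) :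
    PatternConnected (IsPattern True) (dualSubstitution (jacobiPerron a b) P) := by
  have hs := patternConnected_singleton (L := IsPattern True)
  have hc := patternConnected_column hab hb
  have hu := patternConnected_singleton_union_column hab hb
  cases hP with
  | corner x y z =>
    rw [dualSubstitution_triple, dualSubstitution_jacobiPerron_zero,
      dualSubstitution_jacobiPerron_one, dualSubstitution_jacobiPerron_two]
    generalize z - a * x - b * y = m
    refine (hs _).union_pair (hu m x y) (f := face (m + a) x y 1) (g := face (m + a) x y 2) rfl ?_
      (IsPattern.edge₂₃ _ _ _)
    rcases hab.eq_or_lt with rfl | h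
    · exact Or.inl rfl
    · exact Or.inr (two_mem_column (by omega) (by omega))
  | edge₂₃ x y z =>
    rw [dualSubstitution_pair, dualSubstitution_jacobiPerron_one,
      dualSubstitution_jacobiPerron_two]
    exact hu _ x y
  | flat₁₂ x y z =>
    rw [dualSubstitution_pair, dualSubstitution_jacobiPerron_zero,
      dualSubstitution_jacobiPerron_one]
    exact (hs _).union_pair (hs _) rfl rfl isPattern_flat₂₃
  | flat₁₃ x y z =>
    rw [dualSubstitution_pair, dualSubstitution_jacobiPerron_zero,
      dualSubstitution_jacobiPerron_two]
    exact (hs _).union_pair' (hc _ _ _) rfl (zero_mem_column _ _ _ _ _) isPattern_flat₁₂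
  | flat₂₃ x y z =>
    rw [dualSubstitution_pair, dualSubstitution_jacobiPerron_one,
      dualSubstitution_jacobiPerron_two]
    exact (hs _).union_pair' (hc _ _ _) rfl (zero_mem_column _ _ _ _ _) isPattern_flat₁₃
  | shift₁ x y z =>
    rw [dualSubstitution_pair, dualSubstitution_jacobiPerron_two,
      dualSubstitution_jacobiPerron_two,
      show z - a * (x + 1) - b * y = z - a * x - b * y - a by ring]
    generalize z - a * x - b * y = m
    -- The two columns are offset by `a`: when `a = 0` their type `2` rows lie side by side,
    -- otherwise the second contains a type `1` face next to the start of the first.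
    rcases Nat.eq_zero_or_pos a with h | h
    · exact (hc _ _ _).union_pair (hc _ _ _) (f := face m x y 2) (g := face m (x + 1) y 2)
        (two_mem_column (by omega) (by omega)) (two_mem_column (by omega) (by omega))
        isPattern_shift₂
    · exact (hc _ _ _).union_pair (hc _ _ _) (f := face m x y 0) (g := face (m - 1) (x + 1) y 1)
        (zero_mem_column _ _ _ _ _) (one_mem_column (by omega) (by omega)) isPattern_flat₁₂
  | shift₂ x y z =>
    rw [dualSubstitution_pair, dualSubstitution_jacobiPerron_two,
      dualSubstitution_jacobiPerron_two,
      show z - a * x - b * (y + 1) = z - a * x - b * y - b by ring]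
    generalize z - a * x - b * y = m
    exact (hc _ _ _).union_pair (hc _ _ _) (f := face m x y 0) (g := face (m - 1) x (y + 1) 2)
      (zero_mem_column _ _ _ _ _) (two_mem_column (by omega) (by omega)) isPattern_flat₁₃
  | edge₁₃ _ x y z =>
    rw [dualSubstitution_pair, dualSubstitution_jacobiPerron_zero,
      dualSubstitution_jacobiPerron_two]
    generalize z - a * x - b * y = m
    -- The face of type `1` sits at `m + a`. When `a = b` the column stops just before that point,
    -- and the pattern `step` bridges the gap; this case is what makes `step` necessary alongside
    -- `edge₁₃`.
    rcases hab.eq_or_lt with h | h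
    · have h1 : face (m + a - 1) x y 1 ∈ column a b m x y := one_mem_column (by omega) (by omega)
      refine (hs _).union (hc _ _ _) (f := face (m + a) x y 1) rfl h1
        (Reach.of_pattern (IsPattern.step trivial (m + a - 1) x y) ?_ ?_ (by simp))
      · rintro _ (rfl | rfl | rfl)
        · exact Or.inr h1
        · exact Or.inr (two_mem_column (by omega) (by omega))
        · exact Or.inl (by simp)
      · simp
    · exact (hs _).union_pair (hc _ _ _) (f := face (m + a) x y 1) rfl
        (two_mem_column (by omega) (by omega)) (IsPattern.edge₂₃ _ _ _)
  | step _ x y z =>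
    rw [dualSubstitution_triple, dualSubstitution_jacobiPerron_one,
      dualSubstitution_jacobiPerron_two, dualSubstitution_jacobiPerron_one, ← Set.union_assoc,
      show z - a * (x + 1) - b * y + b = z - a * x - b * y + b - a by ring]
    generalize z - a * x - b * y = m
    refine (hu m x y).union_pair (hs _) (f := face (m + b - a) x y 2) ?_ rfl isPattern_shift₂
    -- The neighbour at `m + b - a` is the added end face if `a = 0`, and a face of the column
    -- otherwise.
    rcases Nat.eq_zero_or_pos a with rfl | h
    · exact Or.inl (by simp)
    · exact Or.inr (two_mem_column (by omega) (by omega))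

theorem PatternConnected.jacobiPerron (hab : a ≤ b) (hb : b ≠ 0) {S : Set Face}
    (hS : PatternConnected (IsPattern True) S) :
    PatternConnected (IsPattern True) (RauzyFractal.dualSubstitution (jacobiPerron a b) S) :=
  hS.dualSubstitution (isUnimodular_jacobiPerron a b) (patternConnected_jacobiPerron hab hb)
    fun _ => patternConnected_jacobiPerron_of_isPattern hab hb

end

/-! ### Products -/

/-- The dual of a product of Brun substitutions, or of Jacobi-Perron substitutions, maps sets
connected by patterns to sets connected by patterns. -/
theorem IsAdmissibleProduct.exists_patternConnected {σ : Substitution}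
    (hσ : IsAdmissibleProduct σ) : ∃ jp : Prop, ∀ S, PatternConnected (IsPattern jp) S →
      PatternConnected (IsPattern jp) (dualSubstitution σ S) := by
  rcases hσ with ⟨w, -, rfl⟩ | ⟨w, ⟨-, hw, -⟩, rfl⟩
  · refine ⟨False, ?_⟩
    induction w with
    | nil => simp [dualSubstitution_one]
    | cons i w ih =>
      intro S hS
      rw [List.map_cons, List.prod_cons, dualSubstitution_mul (isUnimodular_brun i)]
      · exact ih _ (hS.brun i)
      · refine isUnimodular_prod ?_
        simp only [List.mem_map]
        rintro _ ⟨j, -, rfl⟩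
        exact isUnimodular_brun j
  · refine ⟨True, ?_⟩
    induction w with
    | nil => simp [dualSubstitution_one]
    | cons p w ih =>
      intro S hS
      rw [List.map_cons, List.prod_cons, dualSubstitution_mul (isUnimodular_jacobiPerron p.1 p.2)]
      · have hp := hw p (List.mem_cons_self ..)
        exact ih (fun q hq => hw q (List.mem_cons_of_mem _ hq)) _ (hS.jacobiPerron hp.1 hp.2)
      · refine isUnimodular_prod ?_
        simp only [List.mem_map]
        rintro _ ⟨q, -, rfl⟩
        exact isUnimodular_jacobiPerron q.1 q.2

theorem unitPattern_eq : unitPattern = {face 0 0 0 0, face 0 0 0 1, face 0 0 0 2} := by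
  ext ⟨y, j⟩
  simp only [Set.mem_insert_iff, Set.mem_singleton_iff, mk_eq_face_iff, ← and_or_left]
  have hj : j = 0 ∨ j = 1 ∨ j = 2 := by omega
  rw [and_iff_left hj]
  change y = 0 ↔ _
  rw [funext_iff, forall_fin_three]
  rfl

theorem isPreconnected_approximant {σ : Substitution} {jp : Prop}
    (hσ : ∀ S, PatternConnected (IsPattern jp) S →
      PatternConnected (IsPattern jp) (dualSubstitution σ S))
    (π : (Fin 3 → ℝ) →ₗ[ℝ] (Fin 3 → ℝ)) {Q : Set Face} (hQ : PatternConnected (IsPattern jp) Q)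
    (n : ℕ) : IsPreconnected (approximant σ π Q n) := by
  have hn : PatternConnected (IsPattern jp) ((dualSubstitution σ)^[n] Q) := by
    induction n with
    | zero => exact hQ
    | succ n ih =>
      rw [Function.iterate_succ_apply']
      exact hσ _ ih
  exact ((hn.isPreconnected fun _ => IsPattern.exists_mem).image _
    π.continuous_of_finiteDimensional.continuousOn).image _
    (incidenceMap σ ^ n).continuous_of_finiteDimensional.continuousOn

end RauzyFractal

/-- An admissible finite product `σ` of Brun or Jacobi-Perron substitutions is unimodular and
irreducible Pisot, the projection `π` onto the contracting plane of its incidence matrix along the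
expanding line exists, the Rauzy fractal of `σ` and its three subtiles exist (as Hausdorff limits),
and these four sets are connected. -/
theorem corollary4p6 (σ : Substitution) (hσ : IsAdmissibleProduct σ) :
    IsUnimodular σ ∧ IsIrreduciblePisot σ ∧
    ∃ π : (Fin 3 → ℝ) →ₗ[ℝ] (Fin 3 → ℝ), IsContractingProjection (incidenceMap σ) π ∧
      (∃ T : Set (Fin 3 → ℝ), IsRauzyFractal σ π T ∧ IsConnected T) ∧
      (∀ i : Fin 3, ∃ T : Set (Fin 3 → ℝ), IsRauzySubtile σ π i T ∧ IsConnected T) := by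

  obtain ⟨h1, h2⟩ := hσ.charpoly_eval_neg
  have hu := hσ.isUnimodular
  obtain ⟨π, hπ, hcomm, K, ρ, hK, hρ, hρ1, hdec⟩ := exists_contractingProjection hu h1 h2
  obtain ⟨C, hC⟩ := exists_hausdorffEDist_approximant_le hu hcomm hK hρ hdec
  obtain ⟨jp, hjp⟩ := hσ.exists_patternConnected
  have key : ∀ Q : Set Face, Q ⊆ unitPattern → Q.Nonempty → PatternConnected (IsPattern jp) Q →
      ∃ T : Set (Fin 3 → ℝ), IsHausdorffLimit (approximant σ π Q) T ∧ IsConnected T := by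
    intro Q hQ hne hconn
    obtain ⟨T, hT⟩ := exists_isHausdorffLimit (approximant_zero_nonempty σ π hne)
      (isBounded_approximant_zero σ π hQ) hρ hρ1 (hC Q)
    exact ⟨T, hT, hT.2.1, hT.isPreconnected (isPreconnected_approximant hjp π hconn)⟩
  refine ⟨hu, isIrreduciblePisot_of_eval_neg hu h1 h2, π, hπ, ?_, fun i => ?_⟩
  -- The unit pattern is itself a corner, and a single face is trivially connected.
  · exact key _ subset_rfl ⟨0, rfl⟩
      (unitPattern_eq ▸ PatternConnected.of_pattern (IsPattern.corner 0 0 0))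
  · exact key _ (Set.singleton_subset_iff.2 rfl) (Set.singleton_nonempty _)
      (patternConnected_singleton _)
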